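/- Let $k$ be a field and let $q\in k^{*}$ not be a root of unity. A root datum $\mathfrak T=(I,\cdot,Y,X,\langle\ ,\ \rangle,i_1,i_2)$ consists of a finite set $I$; a symmetric bilinear form $\cdot$ on $\mathbb Z[I]$ with $i\cdot i\in\{2,4,6,\dots\}$ and $C_{ij}:=2(i\cdot j)/(i\cdot i)\in\{0,-1,-2,\dots\}$ for $i\neq j$; finitely generated free abelian groups $Y,X$ with a perfect pairing $\langle\ ,\ \rangle\colon Y\times X\to\mathbb Z$; and injections $i_1\colon I\to Y$, $i_2\colon I\to X$ with $\langle i_1(i),i_2(j)\rangle=C_{ij}$. Put $c_i=(i\cdot i)/2$, $q_i=q^{c_i}$, $Z=\mathbb Z[i_1(I)]\subseteq Y$, and write $K_i=K_{i_1(i)}$. Let $U_q(\mathfrak T)$ be the Hopf algebra over $k$ generated by $E_i,F_i$ ($i\in I$) and $K_\mu$ ($\mu\in Z$) subject to $K_0=1$, $K_\mu K_\nu=K_{\mu+\nu}$, $K_\mu E_i=q^{\langle\mu,i_2(i)\rangle}E_iK_\mu$, $K_\mu F_i=q^{-\langle\mu,i_2(i)\rangle}F_iK_\mu$, $E_iF_j-F_jE_i=\delta_{ij}(H_i-H_i^{-1})/(q_i-q_i^{-1})$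 with $H_i=K_i^{c_i}$, and the quantum Serre relations; its coproduct is $\Delta E_i=E_i\otimes 1+H_i\otimes E_i$, $\Delta F_i=F_i\otimes H_i^{-1}+1\otimes F_i$, $\Delta K_\mu=K_\mu\otimes K_\mu$, and its antipode is $S E_i=-H_i^{-1}E_i$, $SF_i=-F_iH_i$, $SK_\mu=K_\mu^{-1}$. Let $\mathfrak J=(J,\cdot',Y',X',\langle\ ,\ \rangle',i_1',i_2')$ be a sub-root datum of $\mathfrak T$: there are given injections $\iota\colon J\to I$, $s_Y\colon Y'\to Y$, $s_X\colon X'\to X$ (the last two being homomorphisms with free abelian cokernels) compatible with the forms, the pairings and the maps $i_1,i_2,i'_1,i'_2$, together with a subgroup $X''\subseteq X$ such that $X=s_X(X')\oplus X''$ and $\langle s_Y(Y'),X''\rangle=0$. Let $\rho\colon X\to X'$ be the resulting projection, $D=I\setminus\iota(J)$, and for $d\in D$ let $\lambda'_d=\rho(-i_2(d))$. Let $U_q^{\leqslant}(\mathfrak T)$ be the subalgebra of $U_q(\mathfrak T)$ generated by all $F_i$ and $K_\mu$, with the $\mathbb N$-grading in which $K_\mu$ has degree $0$ and $F_i$ has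 degree $1$ if $i\in D$ and $0$ otherwise, and let $\pi$ be the projection onto its degree-zero part. Let $B=\{b\in U_q^{\leqslant}(\mathfrak T)\mid b_{(1)}\otimes\pi(b_{(2)})=b\otimes 1\}$ and let $B_1$ be its degree-one component. Let $\widetilde{U_q(\mathfrak J)}$ be the subalgebra of $U_q(\mathfrak T)$ generated by $E_{\iota(j)},F_{\iota(j)}$ ($j\in J$) and all $K_\mu$ ($\mu\in Z$), acting on $U_q(\mathfrak T)$ by the adjoint action $\mathrm{Ad}_u(v)=u_{(1)}vS(u_{(2)})$. For $d\in D$ let $V(\lambda'_d)$ be the $\widetilde{U_q(\mathfrak J)}$-submodule generated by $F_dH_d$. For $\lambda\in X'$ let $\Delta(\lambda)$ be the quotient of $U_q(\mathfrak J)$ by the left ideal generated by all $E_j$ and $K_j-q^{\langle i_1'(j),\lambda\rangle'}$ ($j\in J$), and let the Weyl module $L(\lambda)$ be its simple factor, i.e. the quotient of $\Delta(\lambda)$ by its maximal proper submodule. A $\widetilde{U_q(\mathfrak J)}$-module is called integrable if it is the sum of its weight spaces $\{m\mid K_\mu m=q^{\langle\mu,\lambda\rangle}m\ \ \forall\mu\in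 Z\}$ ($\lambda\in X$) and its restriction to $U_q(\mathfrak J)$ is integrable, that is, it is the sum of its weight spaces (with weights in $X'$) and for each vector $m$ and each $j\in J$ one has $E_j^nm=F_j^nm=0$ for all large $n$. Then for every $d\in D$ one has $V(\lambda'_d)\subseteq B_1$, and $V(\lambda'_d)$ is integrable; moreover $B_1$ is a $\widetilde{U_q(\mathfrak J)}$-submodule and is integrable. If $L(\lambda'_d)$ is finite-dimensional for all $d\in D$, then $V(\lambda'_d)$ is finite-dimensional for all $d\in D$ and $B_1$ is finite-dimensional. -/

import Mathlib

noncomputable section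
open scoped TensorProduct
namespace QEA

section Serre

variable {k : Type*} [Field k]

/-- Integer powers `q ^ n` of a unit, as elements of the field. -/
def qz (q : kˣ) (n : ℤ) : k := ((q ^ n : kˣ) : k)

theorem qz_zero (q : kˣ) : qz q 0 = 1 := by simp [qz]

theorem qz_add (q : kˣ) (m n : ℤ) : qz q (m + n) = qz q m * qz q n := by
  simp [qz, zpow_add]

theorem qz_mul' (q : kˣ) (m n l : ℤ) (h : m + n = l) : qz q m * qz q n = qz q l := by
  rw [← h, qz_add]

/-- Symmetric `q`-binomial coefficients, by the `q`-Pascal recursion. -/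
def qbinom (q : kˣ) : ℕ → ℕ → k
  | _, 0 => 1
  | 0, _ + 1 => 0
  | n + 1, j + 1 => qz q (j + 1) * qbinom q n (j + 1) + qz q (-((n : ℤ) - j)) * qbinom q n j

/-- The symmetric `q`-integer `[n] = q^(n-1) + q^(n-3) + ⋯ + q^(1-n)`. -/
def qint (q : kˣ) (n : ℕ) : k := ∑ i ∈ Finset.range n, qz q ((n : ℤ) - 1 - 2 * i)

/-- The symmetric `q`-factorial. -/
def qfact (q : kˣ) (n : ℕ) : k := ∏ i ∈ Finset.range n, qint q (i + 1)

theorem qbinom_zero_right (q : kˣ) (n : ℕ) : qbinom q n 0 = 1 := by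
  cases n <;> simp [qbinom]

theorem qbinom_succ_succ (q : kˣ) (n j : ℕ) : qbinom q (n + 1) (j + 1) =
    qz q (j + 1) * qbinom q n (j + 1) + qz q (-((n : ℤ) - j)) * qbinom q n j := by
  simp [qbinom]

theorem qbinom_eq_zero (q : kˣ) (n j : ℕ) (h : n < j) : qbinom q n j = 0 := by
  induction n generalizing j with
  | zero => obtain ⟨j, rfl⟩ := Nat.exists_eq_succ_of_ne_zero (by omega : j ≠ 0); simp [qbinom]
  | succ n ih =>
    obtain ⟨j, rfl⟩ := Nat.exists_eq_succ_of_ne_zero (by omega : j ≠ 0)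
    rw [Nat.succ_eq_add_one, qbinom_succ_succ, ih _ (by omega), ih _ (by omega)]; simp

theorem qbinom_self (q : kˣ) (n : ℕ) : qbinom q n n = 1 := by
  induction n with
  | zero => simp [qbinom]
  | succ n ih => rw [qbinom_succ_succ, ih, qbinom_eq_zero q n (n + 1) (by omega)]; simp [qz]

theorem qbinom_succ_succ' (q : kˣ) (n j : ℕ) : qbinom q (n + 1) (j + 1) =
    qz q (-(j + 1)) * qbinom q n (j + 1) + qz q ((n : ℤ) - j) * qbinom q n j := by
  induction n generalizing j with
  | zero => cases j <;> simp [qbinom, qz]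
  | succ n ih =>
    have h1 := qbinom_succ_succ q (n + 1) j
    rw [ih j] at h1
    cases j with
    | zero =>
      have h2 := qbinom_succ_succ q n 0
      rw [h1, h2]
      simp only [qbinom_zero_right, mul_add, ← mul_assoc, ← qz_add]
      push_cast
      simp only [mul_one]
      ring_nf
    | succ j =>
      have h2 := qbinom_succ_succ q n (j + 1)
      have h3 := qbinom_succ_succ q n j
      rw [ih j] at h1
      rw [h1, h2, h3]
      simp only [mul_add, ← mul_assoc, ← qz_add]
      push_cast
      ring_nf

theorem qbinom_symm (q : kˣ) (n j : ℕ) (h : j ≤ n) : qbinom q n (n - j) = qbinom q n j := by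
  induction n generalizing j with
  | zero => obtain rfl : j = 0 := by omega
            rfl
  | succ n ih =>
    rcases j with _ | j
    · simp [qbinom_zero_right, qbinom_self]
    · rcases Nat.eq_or_lt_of_le h with h' | h'
      · obtain rfl : j = n := by omega
        simp [qbinom_zero_right, qbinom_self]
      · obtain ⟨d, rfl⟩ : ∃ d, n = j + 1 + d := ⟨n - (j + 1), by omega⟩
        have e1 := ih (j + 1) (by omega)
        have e2 := ih j (by omega)
        rw [show j + 1 + d - (j + 1) = d by omega] at e1
        rw [show j + 1 + d - j = d + 1 by omega] at e2
        rw [show j + 1 + d + 1 - (j + 1) = d + 1 by omega, qbinom_succ_succ, qbinom_succ_succ',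
          e1, e2]
        push_cast
        ring_nf

theorem qint_add (q : kˣ) (m n : ℕ) :
    qint q (m + n) = qz q n * qint q m + qz q (-m) * qint q n := by
  simp only [qint, Finset.sum_range_add, Finset.mul_sum, ← qz_add]
  push_cast
  congr 1 <;> refine Finset.sum_congr rfl fun i _ => ?_ <;> congr 1 <;> ring

/-- The coefficients are the usual quotients of `q`-factorials. -/
theorem qbinom_mul_qfact (q : kˣ) (m n : ℕ) :
    qbinom q (m + n) m * (qfact q m * qfact q n) = qfact q (m + n) := by
  induction h : m + n generalizing m n with
  | zero => obtain ⟨rfl, rfl⟩ : m = 0 ∧ n = 0 := by omega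
            simp [qfact, qbinom]
  | succ s ih =>
    rcases m with _ | m
    · obtain rfl : n = s + 1 := by omega
      simp [qfact, qbinom_zero_right]
    rcases n with _ | n
    · obtain rfl : m = s := by omega
      simp [qfact, qbinom_self]
    have h1 := ih (m + 1) n (by omega)
    have h2 := ih m (n + 1) (by omega)
    have f : ∀ a, qfact q (a + 1) = qfact q a * qint q (a + 1) := fun a => by
      simp [qfact, Finset.prod_range_succ]
    have hs : qint q (s + 1) = qz q (m + 1 : ℕ) * qint q (n + 1)
        + qz q (-(n + 1 : ℕ)) * qint q (m + 1) := by
      rw [← h, add_comm, qint_add]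
    have e : (s : ℤ) - m = (n + 1 : ℕ) := by omega
    rw [qbinom_succ_succ, f s, hs, e]
    rw [f n, f m] at *
    push_cast at *
    linear_combination (qz q (m + 1) * qint q (n + 1)) * h1 +
      (qz q (-(n + 1)) * qint q (m + 1)) * h2

variable {A : Type*} [Ring A] [Algebra k A]

/-- The quantum Serre expression
`∑_{m=0}^{N} (-1)^m [N choose m]_p x^(N-m) y x^m`. -/
def serre (p : kˣ) (N : ℕ) (x y : A) : A :=
  ∑ m ∈ Finset.range (N + 1), ((-1) ^ m * qbinom p N m) • (x ^ (N - m) * y * x ^ m)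

/-- Iterated `q`-commutators, an auxiliary recursion for `serre`. -/
def serreRec (p : kˣ) (C : ℤ) (x y : A) : ℕ → A
  | 0 => y
  | m + 1 => x * serreRec p C x y m - qz p (C + 2 * m) • (serreRec p C x y m * x)

theorem serreRec_eq (p : kˣ) (C : ℤ) (x y : A) (m : ℕ) :
    serreRec p C x y m = ∑ s ∈ Finset.range (m + 1),
      ((-1) ^ s * qz p (s * (C + m - 1)) * qbinom p m s) • (x ^ (m - s) * y * x ^ s) := by
  induction m with
  | zero => simp [serreRec, qbinom, qz]
  | succ m ih =>
    have h1 : x * serreRec p C x y m = ∑ s ∈ Finset.range (m + 2),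
      ((-1) ^ s * qz p (s * (C + m - 1)) * qbinom p m s) • (x ^ (m + 1 - s) * y * x ^ s) := by
      rw [Finset.sum_range_succ, qbinom_eq_zero p m (m + 1) (by omega), ih, Finset.mul_sum]
      simp only [mul_zero, zero_smul, add_zero]
      refine Finset.sum_congr rfl fun s hs => ?_
      rw [Finset.mem_range] at hs
      rw [mul_smul_comm, show m + 1 - s = (m - s) + 1 by omega, pow_succ']
      simp only [mul_assoc]
    rw [serreRec, h1, ih, Finset.sum_mul, Finset.smul_sum, Finset.sum_range_succ', 
      Finset.sum_range_succ' _ (m + 1), add_sub_right_comm, ← Finset.sum_sub_distrib]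
    congr 1
    · refine Finset.sum_congr rfl fun s hs => ?_
      rw [Finset.mem_range] at hs
      rw [smul_mul_assoc, smul_smul, show m + 1 - (s + 1) = m - s by omega, mul_assoc _ (x ^ s),
        ← pow_succ, ← sub_smul, qbinom_succ_succ']
      congr 1
      have e1 : qz p (((s + 1 : ℕ) : ℤ) * (C + m - 1)) =
          qz p (((s + 1 : ℕ) : ℤ) * (C + (m + 1 : ℕ) - 1)) * qz p (-(s + 1)) := by
        rw [← qz_add]; congr 1; push_cast; ring
      have e2 : qz p (C + 2 * m) * qz p ((s : ℤ) * (C + m - 1)) =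
          qz p (((s + 1 : ℕ) : ℤ) * (C + (m + 1 : ℕ) - 1)) * qz p (m - s) := by
        rw [← qz_add, ← qz_add]; congr 1; push_cast; ring
      rw [e1, pow_succ]
      linear_combination (-(-1) ^ s * qbinom p m s) * e2
    · simp [qbinom_zero_right]

theorem serre_eq_serreRec (p : kˣ) (N : ℕ) (x y : A) :
    serre p N x y = serreRec p (1 - N) x y N := by
  rw [serreRec_eq, serre]
  simp [qz]

theorem serre_map {B : Type*} [Ring B] [Algebra k B] (f : A →ₐ[k] B) (p : kˣ) (N : ℕ) (x y : A) :
    f (serre p N x y) = serre p N (f x) (f y) := by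
  simp [serre, map_sum]

theorem serre_zero_right (p : kˣ) (N : ℕ) (x : A) : serre p N x 0 = 0 := by
  simp [serre]

theorem serre_op (p : kˣ) (N : ℕ) (x y : A) :
    serre p N (MulOpposite.op x) (MulOpposite.op y) =
      ((-1 : k) ^ N) • MulOpposite.op (serre p N x y) := by
  rw [serre, serre, ← Finset.sum_range_reflect, Finset.op_sum, Finset.smul_sum]
  refine Finset.sum_congr rfl fun m hm => ?_
  rw [Finset.mem_range] at hm
  rw [show N + 1 - 1 - m = N - m by omega, show N - (N - m) = m by omega,
    qbinom_symm p N m (by omega)]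
  rw [MulOpposite.op_smul, smul_smul, ← mul_assoc, ← pow_add]
  have : ((-1 : k) ^ (N + m)) = (-1) ^ (N - m) := by
    rw [show N + m = (N - m) + 2 * m by omega, pow_add, pow_mul]; simp
  rw [this]
  simp [mul_assoc]

theorem serreRec_twist (p : kˣ) (C : ℤ) (a b x y : A) (s t : k) (hab : a * b = b * a)
    (hxa : x * a = s • (a * x)) (hya : y * a = t • (a * y)) (hxb : x * b = t • (b * x)) (m : ℕ) :
    ∃ c : k, serreRec p C (a * x) (b * y) m = c • (a ^ m * b * serreRec p C x y m) := by
  have hz : ∀ m, ∃ c : k, serreRec p C x y m * a = c • (a * serreRec p C x y m) ∧ c = s ^ m * t := by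
    intro m
    refine ⟨s ^ m * t, ?_, rfl⟩
    induction m with
    | zero => simpa [serreRec] using hya
    | succ m ih =>
      simp only [serreRec, sub_mul, mul_sub, smul_sub, smul_mul_assoc, mul_smul_comm]
      rw [mul_assoc x, ih, mul_assoc _ x a, hxa, mul_smul_comm, mul_smul_comm, ← mul_assoc, hxa,
        ← mul_assoc (serreRec p C x y m) a x, ih]
      simp only [smul_mul_assoc, smul_smul, mul_assoc]
      congr 2 <;> ring
  have hxam : ∀ m, x * a ^ m = s ^ m • (a ^ m * x) := by
    intro m
    induction m with
    | zero => simp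
    | succ m ih =>
      rw [pow_succ a, ← mul_assoc, ih, smul_mul_assoc, mul_assoc, hxa, mul_smul_comm, smul_smul,
        pow_succ s, mul_assoc]
  have hba : ∀ m, a * (a ^ m * b) = a ^ (m + 1) * b := fun m => by rw [pow_succ', mul_assoc]
  have hba' : ∀ m, a ^ m * b * a = a ^ (m + 1) * b := fun m => by
    rw [mul_assoc, ← hab, ← mul_assoc, ← pow_succ]
  induction m with
  | zero => exact ⟨1, by simp [serreRec]⟩
  | succ m ih =>
    obtain ⟨c, hc⟩ := ih
    obtain ⟨_, hz, rfl⟩ := hz m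
    refine ⟨c * (s ^ m * t), ?_⟩
    have h1 : a * x * (a ^ m * b * serreRec p C x y m) =
        (s ^ m * t) • (a ^ (m + 1) * b * (x * serreRec p C x y m)) := by
      calc _ = a * ((x * a ^ m) * b) * serreRec p C x y m := by simp only [mul_assoc]
        _ = s ^ m • (a * (a ^ m * (x * b)) * serreRec p C x y m) := by
            rw [hxam]; simp only [smul_mul_assoc, mul_smul_comm, mul_assoc]
        _ = (s ^ m * t) • (a * (a ^ m * b) * (x * serreRec p C x y m)) := by
            rw [hxb]; simp only [smul_mul_assoc, mul_smul_comm, mul_assoc, smul_smul]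
        _ = _ := by rw [hba]
    have h2 : a ^ m * b * serreRec p C x y m * (a * x) =
        (s ^ m * t) • (a ^ (m + 1) * b * (serreRec p C x y m * x)) := by
      calc _ = a ^ m * b * (serreRec p C x y m * a) * x := by simp only [mul_assoc]
        _ = (s ^ m * t) • ((a ^ m * b * a) * (serreRec p C x y m * x)) := by
            rw [hz]; simp only [smul_mul_assoc, mul_smul_comm, mul_assoc]
        _ = _ := by rw [hba']
    rw [serreRec, serreRec, hc, mul_smul_comm, h1, smul_mul_assoc, h2]
    simp only [mul_sub, smul_sub, smul_smul, mul_smul_comm]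
    congr 2
    ring

/-- Rescaling both arguments by `q`-commuting elements preserves the vanishing of `serre`. -/
theorem serre_twist (p : kˣ) (N : ℕ) (a b x y : A) (s t : k) (hab : a * b = b * a)
    (hxa : x * a = s • (a * x)) (hya : y * a = t • (a * y)) (hxb : x * b = t • (b * x))
    (h : serre p N x y = 0) : serre p N (a * x) (b * y) = 0 := by
  rw [serre_eq_serreRec] at *
  obtain ⟨c, hc⟩ := serreRec_twist p (1 - N) a b x y s t hab hxa hya hxb N
  rw [hc, h, mul_zero, smul_zero]

/-- Auxiliary coefficients for `serre_add`. -/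
def serreCoeff (p : kˣ) (C : ℤ) : ℕ → ℕ → k
  | 0, 0 => 1
  | 0, _ + 1 => 0
  | m + 1, 0 => (1 - qz p (2 * C + 2 * m)) * serreCoeff p C m 0
  | m + 1, r + 1 => (1 - qz p (2 * C + 2 * m + 2 * (r + 1))) * serreCoeff p C m (r + 1)
      + qz p (2 * (m - r)) * serreCoeff p C m r

theorem serreCoeff_eq (p : kˣ) (C : ℤ) (m r : ℕ) : serreCoeff p C m r =
    qz p (r * (m - r)) * qbinom p m r * ∏ s ∈ Finset.Ico r m, (1 - qz p (2 * (C + s))) := by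
  induction m generalizing r with
  | zero => cases r <;> simp [serreCoeff, qbinom, qz]
  | succ m ih =>
    cases r with
    | zero =>
      rw [serreCoeff, ih, Finset.prod_Ico_succ_top (by omega)]
      simp only [qbinom_zero_right]
      simp [qz_zero]
      ring_nf
    | succ r =>
      rw [serreCoeff, ih, ih]
      rcases lt_trichotomy r m with h | h | h
      · have hp1 := Finset.prod_Ico_succ_top (show r + 1 ≤ m by omega)
          (fun s : ℕ => 1 - qz p (2 * (C + (s : ℤ))))
        have hp2 := Finset.prod_eq_prod_Ico_succ_bot h
          (fun s : ℕ => 1 - qz p (2 * (C + (s : ℤ))))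
        rw [hp1, hp2]
        generalize ∏ s ∈ Finset.Ico (r + 1) m, (1 - qz p (2 * (C + (s : ℤ)))) = Pi
        have b1 := qbinom_succ_succ p m r
        have b2 := qbinom_succ_succ' p m r
        have e1 : qz p (((r + 1 : ℕ) : ℤ) * (m - ((r + 1 : ℕ) : ℤ))) =
            qz p ((r + 1) * (m - r)) * qz p (-(r + 1)) := by
          rw [← qz_add]; congr 1; push_cast; ring
        have e2 : qz p (2 * C + 2 * m + 2 * (r + 1)) *
            qz p (((r + 1 : ℕ) : ℤ) * (m - ((r + 1 : ℕ) : ℤ))) =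
            qz p ((r + 1) * (m - r)) * qz p (2 * (C + m)) * qz p (r + 1) := by
          simp only [← qz_add]; congr 1; push_cast; ring
        have e3 : qz p (2 * (m - r)) * qz p (r * (m - r)) =
            qz p ((r + 1) * (m - r)) * qz p (m - r) := by
          simp only [← qz_add]; congr 1; ring
        have e4 : qz p (2 * (m - r)) * qz p (r * (m - r)) * qz p (2 * (C + r)) =
            qz p ((r + 1) * (m - r)) * qz p (2 * (C + m)) * qz p (-(m - r)) := by
          simp only [← qz_add]; congr 1; ring
        have e5 : qz p (((r + 1 : ℕ) : ℤ) * (((m + 1 : ℕ) : ℤ) - ((r + 1 : ℕ) : ℤ))) =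
            qz p ((r + 1) * (m - r)) := by
          congr 1; push_cast; ring
        rw [e5]
        linear_combination (qbinom p m (r + 1) * Pi) * e1 - (qbinom p m (r + 1) * Pi) * e2
          + (qbinom p m r * Pi) * e3 - (qbinom p m r * Pi) * e4
          - (qz p ((r + 1) * (m - r)) * Pi) * b2
          + (qz p ((r + 1) * (m - r)) * Pi * qz p (2 * (C + m))) * b1
      · subst h
        simp [qbinom_eq_zero p r (r + 1) (by omega), qbinom_self, qz]
      · simp [qbinom_eq_zero p m (r + 1) (by omega), qbinom_eq_zero p m r h,
          qbinom_eq_zero p (m + 1) (r + 1) (by omega)]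

theorem serreRec_add (p : kˣ) (C : ℤ) (P Q R S : A) (hQP : Q * P = qz p 2 • (P * Q))
    (hQR : Q * R = qz p C • (R * Q)) (hSP : S * P = qz p C • (P * S)) (m : ℕ) :
    serreRec p C (P + Q) (R + S) m = serreRec p C P R m +
      ∑ r ∈ Finset.range (m + 1), serreCoeff p C m r • (P ^ (m - r) * serreRec p C Q S r) := by
  have hQR' : ∀ m : ℕ, Q * serreRec p C P R m = qz p (C + 2 * m) • (serreRec p C P R m * Q) := by
    intro m
    induction m with
    | zero => simpa [serreRec] using hQR
    | succ m ih =>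
      have e : qz p (C + 2 * ((m + 1 : ℕ) : ℤ)) = qz p 2 * qz p (C + 2 * m) := by
        rw [← qz_add]; congr 1; push_cast; ring
      simp only [serreRec]
      rw [mul_sub, ← mul_assoc, hQP, mul_smul_comm, ← mul_assoc, ih, smul_mul_assoc, mul_assoc P,
        ih, smul_mul_assoc, mul_assoc _ Q P, hQP, e]
      simp only [sub_mul, smul_sub, smul_mul_assoc, mul_smul_comm, smul_smul, mul_assoc]
      congr 2
      ring
  have hSP' : ∀ m : ℕ, serreRec p C Q S m * P = qz p (C + 2 * m) • (P * serreRec p C Q S m) := by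
    intro m
    induction m with
    | zero => simpa [serreRec] using hSP
    | succ m ih =>
      have e : qz p (C + 2 * ((m + 1 : ℕ) : ℤ)) = qz p 2 * qz p (C + 2 * m) := by
        rw [← qz_add]; congr 1; push_cast; ring
      simp only [serreRec]
      rw [sub_mul, mul_assoc, ih, smul_mul_assoc, mul_assoc _ Q P, hQP, mul_smul_comm,
        mul_smul_comm, ← mul_assoc, hQP, ← mul_assoc _ P Q, ih, e]
      simp only [mul_sub, smul_sub, smul_mul_assoc, mul_smul_comm, smul_smul, mul_assoc]
      congr 2 <;> ring
  have hQPm : ∀ m : ℕ, Q * P ^ m = qz p (2 * m) • (P ^ m * Q) := by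
    intro m
    induction m with
    | zero => simp [qz]
    | succ m ih =>
      have e : qz p (2 * ((m + 1 : ℕ) : ℤ)) = qz p 2 * qz p (2 * m) := by
        rw [← qz_add]; congr 1; push_cast; ring
      rw [pow_succ', ← mul_assoc, hQP, smul_mul_assoc, mul_assoc, ih, mul_smul_comm, smul_smul, e,
        mul_assoc]
  induction m with
  | zero => simp [serreRec, serreCoeff]
  | succ m ih =>
    have key : ∀ r ∈ Finset.range (m + 1),
        (P + Q) * (P ^ (m - r) * serreRec p C Q S r) -
          qz p (C + 2 * m) • (P ^ (m - r) * serreRec p C Q S r * (P + Q)) =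
        (1 - qz p (2 * C + 2 * m + 2 * r)) • (P ^ (m + 1 - r) * serreRec p C Q S r) +
          qz p (2 * (m - r)) • (P ^ (m + 1 - (r + 1)) * serreRec p C Q S (r + 1)) := by
      intro r hr
      rw [Finset.mem_range] at hr
      have e1 : qz p (C + 2 * m) * qz p (C + 2 * r) = qz p (2 * C + 2 * m + 2 * r) := by
        rw [← qz_add]; congr 1; ring
      have e2 : qz p (2 * (m - r)) * qz p (C + 2 * r) = qz p (C + 2 * m) := by
        rw [← qz_add]; congr 1; ring
      have e3 : (((m - r : ℕ) : ℤ)) = m - r := by omega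
      rw [add_mul, mul_add, ← mul_assoc, ← pow_succ', show m - r + 1 = m + 1 - r by omega,
        ← mul_assoc Q, hQPm, mul_assoc _ _ P, hSP', show m + 1 - (r + 1) = m - r by omega,
        serreRec, mul_smul_comm, ← mul_assoc _ P, ← pow_succ, show m - r + 1 = m + 1 - r by omega,
        smul_add, smul_smul, e1, e3, ← e2]
      simp only [mul_sub, smul_sub, smul_mul_assoc, mul_smul_comm, smul_smul, mul_assoc, sub_smul,
        one_smul]
      abel
    have lhs : serreRec p C (P + Q) (R + S) (m + 1) = serreRec p C P R (m + 1) +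
        ∑ r ∈ Finset.range (m + 1), serreCoeff p C m r •
          ((1 - qz p (2 * C + 2 * m + 2 * r)) • (P ^ (m + 1 - r) * serreRec p C Q S r) +
          qz p (2 * (m - r)) • (P ^ (m + 1 - (r + 1)) * serreRec p C Q S (r + 1))) := by
      rw [← Finset.sum_congr rfl fun r hr => congrArg (serreCoeff p C m r • ·) (key r hr)]
      simp only [smul_sub, Finset.sum_sub_distrib]
      rw [serreRec, serreRec, ih]
      have h1 : ∑ r ∈ Finset.range (m + 1), serreCoeff p C m r •
          ((P + Q) * (P ^ (m - r) * serreRec p C Q S r)) = (P + Q) *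
          ∑ r ∈ Finset.range (m + 1), serreCoeff p C m r • (P ^ (m - r) * serreRec p C Q S r) := by
        rw [Finset.mul_sum]; simp only [mul_smul_comm]
      have h2 : ∑ r ∈ Finset.range (m + 1), serreCoeff p C m r •
          qz p (C + 2 * m) • (P ^ (m - r) * serreRec p C Q S r * (P + Q)) = qz p (C + 2 * m) •
          ((∑ r ∈ Finset.range (m + 1),
            serreCoeff p C m r • (P ^ (m - r) * serreRec p C Q S r)) * (P + Q)) := by
        rw [Finset.sum_mul, Finset.smul_sum]
        refine Finset.sum_congr rfl fun r _ => ?_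
        rw [smul_comm, smul_mul_assoc]
      rw [h1, h2]
      generalize ∑ r ∈ Finset.range (m + 1),
        serreCoeff p C m r • (P ^ (m - r) * serreRec p C Q S r) = X
      rw [mul_add (P + Q), add_mul P Q, hQR', add_mul _ X, mul_add _ P Q, smul_add, smul_add]
      abel
    rw [lhs]
    congr 1
    simp only [smul_add, Finset.sum_add_distrib]
    rw [Finset.sum_range_succ' _ (m + 1)]
    have h0 : serreCoeff p C m (m + 1) = 0 := by
      rw [serreCoeff_eq, qbinom_eq_zero p m (m + 1) (by omega)]; simp
    have hA : ∑ r ∈ Finset.range (m + 1), serreCoeff p C m r •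
          (1 - qz p (2 * C + 2 * m + 2 * r)) • (P ^ (m + 1 - r) * serreRec p C Q S r) =
        ∑ r ∈ Finset.range (m + 1), (serreCoeff p C m (r + 1) *
          (1 - qz p (2 * C + 2 * m + 2 * (r + 1)))) •
            (P ^ (m + 1 - (r + 1)) * serreRec p C Q S (r + 1)) +
          (serreCoeff p C m 0 * (1 - qz p (2 * C + 2 * m))) •
            (P ^ (m + 1) * serreRec p C Q S 0) := by
      rw [Finset.sum_range_succ', Finset.sum_range_succ _ m, h0]
      simp [smul_smul]
    rw [hA, add_right_comm, ← Finset.sum_add_distrib]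
    congr 1
    · refine Finset.sum_congr rfl fun r _ => ?_
      rw [serreCoeff, smul_smul, ← add_smul]
      congr 1
      ring
    · rw [serreCoeff, mul_comm]; simp

/-- Additivity of the quantum Serre expression on suitably `q`-commuting summands. -/
theorem serre_add (p : kˣ) (N : ℕ) (P Q R S : A) (hQP : Q * P = qz p 2 • (P * Q))
    (hQR : Q * R = qz p (1 - N) • (R * Q)) (hSP : S * P = qz p (1 - N) • (P * S)) :
    serre p N (P + Q) (R + S) = serre p N P R + serre p N Q S := by
  rw [serre_eq_serreRec, serre_eq_serreRec, serre_eq_serreRec, serreRec_add p _ P Q R S hQP hQR hSP,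
    Finset.sum_range_succ, Finset.sum_eq_zero, zero_add]
  · simp [serreCoeff_eq, qbinom_self, qz]
  · intro r hr
    rw [Finset.mem_range] at hr
    rw [serreCoeff_eq, Finset.prod_eq_zero (i := N - 1), mul_zero, zero_smul]
    · rw [Finset.mem_Ico]; omega
    · have : ((N - 1 : ℕ) : ℤ) = N - 1 := by omega
      rw [this]; simp [qz]

end Serre

/-- A root datum: a Cartan datum `(I, ·)` together with finitely generated free abelian groups
`Y`, `X` in perfect duality and embeddings `i₁ : I → Y`, `i₂ : I → X`
with `⟨i₁ i, i₂ j⟩ = 2 (i · j) / (i · i)`.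
The symmetric bilinear form on `ℤ[I]` is given by its values on the basis `I`. -/
structure RootDatum (I Y X : Type*) [AddCommGroup Y] [AddCommGroup X] where
  finite : Finite I
  form : I → I → ℤ
  form_symm : ∀ i j, form i j = form j i
  form_pos : ∀ i, 0 < form i i
  form_even : ∀ i, 2 ∣ form i i
  form_dvd : ∀ i j, form i i ∣ 2 * form i j
  form_nonpos : ∀ i j, i ≠ j → form i j ≤ 0
  free_Y : Module.Free ℤ Y
  finite_Y : Module.Finite ℤ Y
  free_X : Module.Free ℤ X
  finite_X : Module.Finite ℤ X
  pairing : Y →ₗ[ℤ] X →ₗ[ℤ] ℤ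
  perfect : pairing.IsPerfPair
  i₁ : I → Y
  i₂ : I → X
  i₁_injective : Function.Injective i₁
  i₂_injective : Function.Injective i₂
  pairing_eq : ∀ i j, pairing (i₁ i) (i₂ j) = 2 * form i j / form i i

namespace RootDatum

variable {I Y X : Type*} [AddCommGroup Y] [AddCommGroup X] (T : RootDatum I Y X)

/-- The Cartan matrix `C_{ij} = 2 (i · j) / (i · i)`. -/
def cartan (i j : I) : ℤ := 2 * T.form i j / T.form i i

/-- `c_i = (i · i) / 2`. -/
def c (i : I) : ℤ := T.form i i / 2

/-- The subgroup `Z = ℤ[i₁(I)]` of `Y`. -/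
def Z : AddSubgroup Y := AddSubgroup.closure (Set.range T.i₁)

/-- `i₁(i)` as an element of `Z`. -/
def z (i : I) : T.Z := ⟨T.i₁ i, AddSubgroup.subset_closure ⟨i, rfl⟩⟩

/-- The natural number `1 - C_{ij}` (used for `i ≠ j`). -/
def serreDeg (i j : I) : ℕ := (1 - T.cartan i j).toNat

theorem c_mul_cartan (i j : I) : T.c i * T.cartan i j = T.form i j := by
  obtain ⟨a, ha⟩ := T.form_even i
  obtain ⟨b, hb⟩ := T.form_dvd i j
  have hp := T.form_pos i
  have h1 : T.c i = a := by rw [c, ha]; omega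
  have h2 : T.cartan i j = b := by
    rw [cartan, hb]; exact Int.mul_ediv_cancel_left _ hp.ne'
  rw [h1, h2]
  have : 2 * T.form i j = 2 * (a * b) := by rw [hb, ha]; ring
  omega

theorem c_eq (i : I) : 2 * T.c i = T.form i i := by
  obtain ⟨a, ha⟩ := T.form_even i
  rw [c, ha]; omega

theorem serreDeg_cast {i j : I} (h : i ≠ j) : (1 - (T.serreDeg i j : ℤ)) = T.cartan i j := by
  have hp := T.form_pos i
  have hn := T.form_nonpos i j h
  have : T.cartan i j ≤ 0 := by
    rw [cartan]; exact Int.ediv_nonpos_of_nonpos_of_neg (by omega) hp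
  rw [serreDeg]; omega

end RootDatum

section Uq

variable {k : Type*} [Field k] {I Y X : Type*} [AddCommGroup Y] [AddCommGroup X]

/-- The generators `E_i`, `F_i` (`i ∈ I`) and `K_μ` (`μ ∈ Z`). -/
inductive Gen (T : RootDatum I Y X)
  | E (i : I)
  | F (i : I)
  | K (μ : T.Z)

/-- A family of elements `e i`, `f i`, `κ μ` of a `k`-algebra satisfying the defining relations of
the quantized enveloping algebra. Here `q_i = q ^ c_i` and `H_i = K_i ^ c_i = K_{c_i i}`. -/
structure SatisfiesRelations (T : RootDatum I Y X) (q : kˣ) {A : Type*} [Ring A] [Algebra k A]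
    (e f : I → A) (κ : T.Z → A) : Prop where
  K_zero : κ 0 = 1
  K_add : ∀ μ ν, κ (μ + ν) = κ μ * κ ν
  K_E : ∀ μ i, κ μ * e i = qz q (T.pairing (μ : Y) (T.i₂ i)) • (e i * κ μ)
  K_F : ∀ μ i, κ μ * f i = qz q (-T.pairing (μ : Y) (T.i₂ i)) • (f i * κ μ)
  E_F_same : ∀ i, e i * f i - f i * e i =
    (qz q (T.c i) - qz q (-T.c i))⁻¹ • (κ (T.c i • T.z i) - κ (-(T.c i • T.z i)))
  E_F_ne : ∀ i j, i ≠ j → e i * f j - f j * e i = 0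
  serre_E : ∀ i j, i ≠ j → serre (q ^ T.c i) (T.serreDeg i j) (e i) (e j) = 0
  serre_F : ∀ i j, i ≠ j → serre (q ^ T.c i) (T.serreDeg i j) (f i) (f j) = 0

/-- The defining relations, on the free algebra over the generators. -/
inductive Rel (T : RootDatum I Y X) (q : kˣ) :
    FreeAlgebra k (Gen T) → FreeAlgebra k (Gen T) → Prop
  | K_zero : Rel T q (FreeAlgebra.ι k (.K 0)) 1
  | K_add (μ ν : T.Z) : Rel T q (FreeAlgebra.ι k (.K (μ + ν)))
      (FreeAlgebra.ι k (.K μ) * FreeAlgebra.ι k (.K ν))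
  | K_E (μ : T.Z) (i : I) : Rel T q (FreeAlgebra.ι k (.K μ) * FreeAlgebra.ι k (.E i))
      (qz q (T.pairing (μ : Y) (T.i₂ i)) • (FreeAlgebra.ι k (.E i) * FreeAlgebra.ι k (.K μ)))
  | K_F (μ : T.Z) (i : I) : Rel T q (FreeAlgebra.ι k (.K μ) * FreeAlgebra.ι k (.F i))
      (qz q (-T.pairing (μ : Y) (T.i₂ i)) • (FreeAlgebra.ι k (.F i) * FreeAlgebra.ι k (.K μ)))
  | E_F_same (i : I) : Rel T q
      (FreeAlgebra.ι k (.E i) * FreeAlgebra.ι k (.F i) -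
        FreeAlgebra.ι k (.F i) * FreeAlgebra.ι k (.E i))
      ((qz q (T.c i) - qz q (-T.c i))⁻¹ •
        (FreeAlgebra.ι k (.K (T.c i • T.z i)) - FreeAlgebra.ι k (.K (-(T.c i • T.z i)))))
  | E_F_ne (i j : I) (h : i ≠ j) : Rel T q
      (FreeAlgebra.ι k (.E i) * FreeAlgebra.ι k (.F j) -
        FreeAlgebra.ι k (.F j) * FreeAlgebra.ι k (.E i)) 0
  | serre_E (i j : I) (h : i ≠ j) : Rel T q
      (serre (q ^ T.c i) (T.serreDeg i j) (FreeAlgebra.ι k (.E i)) (FreeAlgebra.ι k (.E j))) 0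
  | serre_F (i j : I) (h : i ≠ j) : Rel T q
      (serre (q ^ T.c i) (T.serreDeg i j) (FreeAlgebra.ι k (.F i)) (FreeAlgebra.ι k (.F j))) 0

/-- The quantized enveloping algebra `U_q(T)`. -/
def Uq (T : RootDatum I Y X) (q : kˣ) : Type _ := RingQuot (Rel T q)

namespace Uq

variable (T : RootDatum I Y X) (q : kˣ)

instance : Ring (Uq T q) := inferInstanceAs (Ring (RingQuot (Rel T q)))

instance : Algebra k (Uq T q) := inferInstanceAs (Algebra k (RingQuot (Rel T q)))

/-- The quotient map from the free algebra. -/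
def mk : FreeAlgebra k (Gen T) →ₐ[k] Uq T q := RingQuot.mkAlgHom k (Rel T q)

/-- The generator `E_i`. -/
def E (i : I) : Uq T q := mk T q (FreeAlgebra.ι k (.E i))

/-- The generator `F_i`. -/
def F (i : I) : Uq T q := mk T q (FreeAlgebra.ι k (.F i))

/-- The generator `K_μ`. -/
def K (μ : T.Z) : Uq T q := mk T q (FreeAlgebra.ι k (.K μ))

/-- `H_i = K_i ^ c_i = K_{c_i i}`. -/
def H (i : I) : Uq T q := K T q (T.c i • T.z i)

/-- `H_i⁻¹`. -/
def Hinv (i : I) : Uq T q := K T q (-(T.c i • T.z i))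

variable {T q} in
theorem mk_rel {x y : FreeAlgebra k (Gen T)} (h : Rel T q x y) : mk T q x = mk T q y :=
  RingQuot.mkAlgHom_rel k h

theorem satisfiesRelations : SatisfiesRelations T q (E T q) (F T q) (K T q) where
  K_zero := by simpa [E, F, K] using mk_rel (Rel.K_zero (T := T) (q := q))
  K_add μ ν := by simpa [E, F, K] using mk_rel (Rel.K_add (T := T) (q := q) μ ν)
  K_E μ i := by simpa [E, F, K] using mk_rel (Rel.K_E (T := T) (q := q) μ i)
  K_F μ i := by simpa [E, F, K] using mk_rel (Rel.K_F (T := T) (q := q) μ i)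
  E_F_same i := by simpa [E, F, K] using mk_rel (Rel.E_F_same (T := T) (q := q) i)
  E_F_ne i j h := by simpa [E, F, K] using mk_rel (Rel.E_F_ne (T := T) (q := q) i j h)
  serre_E i j h := by simpa [E, F, serre_map] using mk_rel (Rel.serre_E (T := T) (q := q) i j h)
  serre_F i j h := by simpa [E, F, serre_map] using mk_rel (Rel.serre_F (T := T) (q := q) i j h)

variable {A : Type*} [Ring A] [Algebra k A]

/-- The algebra map out of the free algebra with given values on generators. -/
def freeLift (e f : I → A) (κ : T.Z → A) : FreeAlgebra k (Gen T) →ₐ[k] A :=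
  FreeAlgebra.lift k fun
    | .E i => e i
    | .F i => f i
    | .K μ => κ μ

variable {T q}

/-- The universal property of `U_q(T)`. -/
def lift {e f : I → A} {κ : T.Z → A} (h : SatisfiesRelations T q e f κ) : Uq T q →ₐ[k] A :=
  RingQuot.liftAlgHom k ⟨freeLift T e f κ, by
    intro x y r
    cases r with
    | K_zero => simpa [freeLift] using h.K_zero
    | K_add μ ν => simpa [freeLift] using h.K_add μ ν
    | K_E μ i => simpa [freeLift] using h.K_E μ i
    | K_F μ i => simpa [freeLift] using h.K_F μ i
    | E_F_same i => simpa [freeLift] using h.E_F_same i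
    | E_F_ne i j hij => simpa [freeLift] using h.E_F_ne i j hij
    | serre_E i j hij => simpa [freeLift, serre_map] using h.serre_E i j hij
    | serre_F i j hij => simpa [freeLift, serre_map] using h.serre_F i j hij⟩

variable {e f : I → A} {κ : T.Z → A} (h : SatisfiesRelations T q e f κ)

theorem lift_E (i : I) : lift h (E T q i) = e i :=
  (RingQuot.liftAlgHom_mkAlgHom_apply k (freeLift T e f κ) _ _).trans (by simp [freeLift])

theorem lift_F (i : I) : lift h (F T q i) = f i :=
  (RingQuot.liftAlgHom_mkAlgHom_apply k (freeLift T e f κ) _ _).trans (by simp [freeLift])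

theorem lift_K (μ : T.Z) : lift h (K T q μ) = κ μ :=
  (RingQuot.liftAlgHom_mkAlgHom_apply k (freeLift T e f κ) _ _).trans (by simp [freeLift])

section HopfMaps

/-- The weight of `H_i` against `i₂ j`. -/
theorem pairing_H (T : RootDatum I Y X) (i j : I) :
    T.pairing ((T.c i • T.z i : T.Z) : Y) (T.i₂ j) = T.form i j := by
  rw [← T.c_mul_cartan i j, RootDatum.cartan, ← T.pairing_eq]
  simp [RootDatum.z]

theorem pairing_Hinv (T : RootDatum I Y X) (i j : I) :
    T.pairing ((-(T.c i • T.z i) : T.Z) : Y) (T.i₂ j) = -T.form i j := by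
  rw [← pairing_H T i j]; simp

theorem qz_zpow (q : kˣ) (m n : ℤ) : qz (q ^ m) n = qz q (m * n) := by
  simp [qz, zpow_mul]

theorem smul_flip {V : Type*} [AddCommGroup V] [Module k V] {q : kˣ} {n : ℤ} {x y : V}
    (h : x = qz q n • y) : y = qz q (-n) • x := by
  rw [h, smul_smul, ← qz_add]; simp [qz]

theorem K_comm (μ ν : T.Z) : K T q μ * K T q ν = K T q ν * K T q μ := by
  have h := satisfiesRelations T q
  rw [← h.K_add, ← h.K_add, add_comm]

theorem H_mul_E (i j : I) : H T q i * E T q j = qz q (T.form i j) • (E T q j * H T q i) := by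
  rw [H, (satisfiesRelations T q).K_E, pairing_H]

theorem Hinv_mul_E (i j : I) :
    Hinv T q i * E T q j = qz q (-T.form i j) • (E T q j * Hinv T q i) := by
  rw [Hinv, (satisfiesRelations T q).K_E, pairing_Hinv]

theorem H_mul_F (i j : I) : H T q i * F T q j = qz q (-T.form i j) • (F T q j * H T q i) := by
  rw [H, (satisfiesRelations T q).K_F, pairing_H]

theorem Hinv_mul_F (i j : I) :
    Hinv T q i * F T q j = qz q (T.form i j) • (F T q j * Hinv T q i) := by
  rw [Hinv, (satisfiesRelations T q).K_F, pairing_Hinv, neg_neg]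

theorem E_mul_Hinv (i j : I) :
    E T q j * Hinv T q i = qz q (T.form i j) • (Hinv T q i * E T q j) := by
  simpa using smul_flip (Hinv_mul_E (q := q) i j)

theorem F_mul_H (i j : I) :
    F T q j * H T q i = qz q (T.form i j) • (H T q i * F T q j) := by
  simpa using smul_flip (H_mul_F (q := q) i j)

theorem H_mul_Hinv (i : I) : H T q i * Hinv T q i = 1 := by
  have h := satisfiesRelations T q
  rw [H, Hinv, ← h.K_add, add_neg_cancel, h.K_zero]

theorem Hinv_mul_H (i : I) : Hinv T q i * H T q i = 1 := by
  have h := satisfiesRelations T q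
  rw [H, Hinv, ← h.K_add, neg_add_cancel, h.K_zero]

/-- `E_i F_j - F_j E_i` in terms of `H`. -/
theorem E_F_same' (i : I) : E T q i * F T q i - F T q i * E T q i =
    (qz q (T.c i) - qz q (-T.c i))⁻¹ • (H T q i - Hinv T q i) :=
  (satisfiesRelations T q).E_F_same i

theorem serreDeg_qz (q : kˣ) {i j : I} (h : i ≠ j) :
    qz (q ^ T.c i) (1 - (T.serreDeg i j : ℤ)) = qz q (T.form i j) := by
  rw [T.serreDeg_cast h, qz_zpow, T.c_mul_cartan]

theorem two_qz (q : kˣ) (i : I) : qz (q ^ T.c i) 2 = qz q (T.form i i) := by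
  rw [qz_zpow, mul_comm, T.c_eq]

/-- The relations hold for the coproduct values. -/
theorem comul_rel : SatisfiesRelations T q (A := Uq T q ⊗[k] Uq T q)
    (fun i => E T q i ⊗ₜ 1 + H T q i ⊗ₜ E T q i)
    (fun i => F T q i ⊗ₜ Hinv T q i + 1 ⊗ₜ F T q i)
    (fun μ => K T q μ ⊗ₜ K T q μ) where
  K_zero := by rw [(satisfiesRelations T q).K_zero, Algebra.TensorProduct.one_def]
  K_add μ ν := by
    rw [(satisfiesRelations T q).K_add, Algebra.TensorProduct.tmul_mul_tmul]
  K_E μ i := by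
    simp only [mul_add, add_mul, Algebra.TensorProduct.tmul_mul_tmul, mul_one, one_mul, smul_add]
    rw [(satisfiesRelations T q).K_E, H, K_comm μ, TensorProduct.tmul_smul,
      ← TensorProduct.smul_tmul']
  K_F μ i := by
    simp only [mul_add, add_mul, Algebra.TensorProduct.tmul_mul_tmul, mul_one, one_mul, smul_add]
    rw [(satisfiesRelations T q).K_F, Hinv, K_comm μ, TensorProduct.tmul_smul,
      ← TensorProduct.smul_tmul']
  E_F_same i := by
    have hEF := E_F_same' (q := q) (T := T) i
    rw [sub_eq_iff_eq_add] at hEF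
    simp only [mul_add, add_mul, Algebra.TensorProduct.tmul_mul_tmul, mul_one, one_mul]
    rw [hEF, H_mul_F, E_mul_Hinv]
    simp only [TensorProduct.tmul_add, TensorProduct.add_tmul, TensorProduct.tmul_sub,
      TensorProduct.sub_tmul, TensorProduct.tmul_smul, ← TensorProduct.smul_tmul', smul_smul,
      ← qz_add, add_neg_cancel, qz_zero, one_smul, smul_sub]
    simp only [H, Hinv]
    abel
  E_F_ne i j hij := by
    have hEF := (satisfiesRelations T q).E_F_ne i j hij
    rw [sub_eq_zero] at hEF
    simp only [mul_add, add_mul, Algebra.TensorProduct.tmul_mul_tmul, mul_one, one_mul]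
    rw [hEF, H_mul_F, E_mul_Hinv, T.form_symm j i]
    simp only [TensorProduct.tmul_smul, ← TensorProduct.smul_tmul', smul_smul,
      ← qz_add, add_neg_cancel, qz_zero, one_smul]
    abel
  serre_E i j hij := by
    rw [serre_add]
    · have h1 := (satisfiesRelations T q).serre_E i j hij
      have h2 : serre (q ^ T.c i) (T.serreDeg i j) (E T q i ⊗ₜ[k] (1 : Uq T q))
          (E T q j ⊗ₜ[k] (1 : Uq T q)) = 0 := by
        have := serre_map (Algebra.TensorProduct.includeLeft : Uq T q →ₐ[k] Uq T q ⊗[k] Uq T q)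
          (q ^ T.c i) (T.serreDeg i j) (E T q i) (E T q j)
        rw [h1, map_zero] at this
        exact this.symm
      have h3 : serre (q ^ T.c i) (T.serreDeg i j) ((1 : Uq T q) ⊗ₜ[k] E T q i)
          ((1 : Uq T q) ⊗ₜ[k] E T q j) = 0 := by
        have := serre_map (Algebra.TensorProduct.includeRight : Uq T q →ₐ[k] Uq T q ⊗[k] Uq T q)
          (q ^ T.c i) (T.serreDeg i j) (E T q i) (E T q j)
        rw [h1, map_zero] at this
        exact this.symm
      have h4 := serre_twist (q ^ T.c i) (T.serreDeg i j) (H T q i ⊗ₜ[k] (1 : Uq T q))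
        (H T q j ⊗ₜ[k] (1 : Uq T q)) _ _ 1 1 (by simp [H, K_comm (T.c i • T.z i)])
        (by simp) (by simp) (by simp) h3
      rw [h2, zero_add]
      simpa using h4
    · rw [two_qz]
      simp [H_mul_E, TensorProduct.smul_tmul']
    · rw [serreDeg_qz q hij]
      simp [H_mul_E, TensorProduct.smul_tmul']
    · rw [serreDeg_qz q hij]
      simp [H_mul_E, T.form_symm j i, TensorProduct.smul_tmul']
  serre_F i j hij := by
    simp only [add_comm (F T q _ ⊗ₜ[k] _)]
    rw [serre_add]
    · have h1 := (satisfiesRelations T q).serre_F i j hij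
      have h2 : serre (q ^ T.c i) (T.serreDeg i j) (F T q i ⊗ₜ[k] (1 : Uq T q))
          (F T q j ⊗ₜ[k] (1 : Uq T q)) = 0 := by
        have := serre_map (Algebra.TensorProduct.includeLeft : Uq T q →ₐ[k] Uq T q ⊗[k] Uq T q)
          (q ^ T.c i) (T.serreDeg i j) (F T q i) (F T q j)
        rw [h1, map_zero] at this
        exact this.symm
      have h3 : serre (q ^ T.c i) (T.serreDeg i j) ((1 : Uq T q) ⊗ₜ[k] F T q i)
          ((1 : Uq T q) ⊗ₜ[k] F T q j) = 0 := by
        have := serre_map (Algebra.TensorProduct.includeRight : Uq T q →ₐ[k] Uq T q ⊗[k] Uq T q)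
          (q ^ T.c i) (T.serreDeg i j) (F T q i) (F T q j)
        rw [h1, map_zero] at this
        exact this.symm
      have h4 := serre_twist (q ^ T.c i) (T.serreDeg i j) ((1 : Uq T q) ⊗ₜ[k] Hinv T q i)
        ((1 : Uq T q) ⊗ₜ[k] Hinv T q j) _ _ 1 1 (by simp [Hinv, K_comm (-(T.c i • T.z i))])
        (by simp) (by simp) (by simp) h2
      rw [h3, zero_add]
      simpa using h4
    · rw [two_qz]
      simp [Hinv_mul_F]
    · rw [serreDeg_qz q hij]
      simp [Hinv_mul_F]
    · rw [serreDeg_qz q hij]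
      simp [Hinv_mul_F, T.form_symm j i]

variable (T q)

/-- The coproduct: `Δ E_i = E_i ⊗ 1 + H_i ⊗ E_i`, `Δ F_i = F_i ⊗ H_i⁻¹ + 1 ⊗ F_i`,
`Δ K_μ = K_μ ⊗ K_μ`. -/
def comul : Uq T q →ₐ[k] Uq T q ⊗[k] Uq T q := lift comul_rel

variable {T q}

/-- The relations hold for the antipode values. -/
theorem antipode_rel : SatisfiesRelations T q (A := (Uq T q)ᵐᵒᵖ)
    (fun i => MulOpposite.op (-(Hinv T q i * E T q i)))
    (fun i => MulOpposite.op (-(F T q i * H T q i)))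
    (fun μ => MulOpposite.op (K T q (-μ))) where
  K_zero := by simp [(satisfiesRelations T q).K_zero]
  K_add μ ν := by
    rw [neg_add, (satisfiesRelations T q).K_add, K_comm, MulOpposite.op_mul]
  K_E μ i := by
    rw [← MulOpposite.op_mul, ← MulOpposite.op_mul, ← MulOpposite.op_smul]
    congr 1
    have e : E T q i * K T q (-μ) =
        qz q (T.pairing (μ : Y) (T.i₂ i)) • (K T q (-μ) * E T q i) := by
      simpa using smul_flip ((satisfiesRelations T q).K_E (-μ) i)
    rw [neg_mul, mul_neg, smul_neg, mul_assoc, e, mul_smul_comm, ← mul_assoc, ← mul_assoc, Hinv,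
      K_comm (-μ)]
  K_F μ i := by
    rw [← MulOpposite.op_mul, ← MulOpposite.op_mul, ← MulOpposite.op_smul]
    congr 1
    have e : F T q i * K T q (-μ) =
        qz q (-T.pairing (μ : Y) (T.i₂ i)) • (K T q (-μ) * F T q i) := by
      simpa using smul_flip ((satisfiesRelations T q).K_F (-μ) i)
    rw [neg_mul, mul_neg, smul_neg, mul_assoc, H, K_comm _ (-μ), ← mul_assoc, e, smul_mul_assoc,
      mul_assoc]
  E_F_same i := by
    rw [← MulOpposite.op_mul, ← MulOpposite.op_mul, ← MulOpposite.op_sub, ← MulOpposite.op_sub,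
      ← MulOpposite.op_smul]
    congr 1
    have hEF := E_F_same' (q := q) (T := T) i
    have h1 : F T q i * H T q i * (Hinv T q i * E T q i) = F T q i * E T q i := by
      rw [mul_assoc, ← mul_assoc (H T q i), H_mul_Hinv, one_mul]
    have h2 : Hinv T q i * E T q i * (F T q i * H T q i) = E T q i * F T q i := by
      have e : E T q i * H T q i = qz q (-T.form i i) • (H T q i * E T q i) :=
        smul_flip (H_mul_E i i)
      rw [F_mul_H, mul_smul_comm, mul_assoc, ← mul_assoc (E T q i), e]
      simp only [smul_mul_assoc, mul_smul_comm, smul_smul, ← qz_add, add_neg_cancel, qz_zero,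
        one_smul, ← mul_assoc]
      rw [Hinv_mul_H, one_mul]
    rw [neg_mul_neg, neg_mul_neg, h1, h2, neg_neg, ← neg_sub, hEF, ← smul_neg, neg_sub]
    rfl
  E_F_ne i j hij := by
    rw [← MulOpposite.op_mul, ← MulOpposite.op_mul, ← MulOpposite.op_sub,
      MulOpposite.op_eq_zero_iff]
    have hEF := (satisfiesRelations T q).E_F_ne i j hij
    rw [sub_eq_zero] at hEF
    have h1 : F T q j * H T q j * (Hinv T q i * E T q i) =
        Hinv T q i * E T q i * (F T q j * H T q j) := by
      have e1 : F T q j * Hinv T q i = qz q (-T.form i j) • (Hinv T q i * F T q j) :=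
        smul_flip (Hinv_mul_F i j)
      have e2 : H T q j * Hinv T q i = Hinv T q i * H T q j := K_comm _ _
      rw [mul_assoc, ← mul_assoc (H T q j), e2, mul_assoc, H_mul_E, mul_smul_comm, mul_smul_comm,
        ← mul_assoc, e1, smul_mul_assoc, smul_smul, ← qz_add, T.form_symm j i, add_neg_cancel,
        qz_zero, one_smul, mul_assoc, ← mul_assoc (F T q j), ← hEF]
      simp only [mul_assoc]
    rw [neg_mul_neg, neg_mul_neg, h1, sub_self]
  serre_E i j hij := by
    rw [serre_op, ← neg_mul, ← neg_mul, serre_twist (q ^ T.c i) (T.serreDeg i j) _ _ _ _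
      (qz q (T.form i i)) (qz q (T.form i j)) _ _ _ _
      ((satisfiesRelations T q).serre_E i j hij)]
    · simp
    · simpa [Hinv] using K_comm _ _
    · simp [E_mul_Hinv]
    · simp [E_mul_Hinv]
    · simp [E_mul_Hinv, T.form_symm j i]
  serre_F i j hij := by
    have hF : ∀ i, -(F T q i * H T q i) = (-(qz q (T.form i i)) • H T q i) * F T q i := by
      intro i
      rw [F_mul_H, smul_mul_assoc, neg_smul]
    rw [serre_op, hF, hF, serre_twist (q ^ T.c i) (T.serreDeg i j) _ _ _ _
      (qz q (T.form i i)) (qz q (T.form i j)) _ _ _ _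
      ((satisfiesRelations T q).serre_F i j hij)]
    · simp
    · simp only [smul_mul_smul_comm, H, K_comm (T.c i • T.z i), mul_comm (-qz q (T.form i i))]
    · simp [F_mul_H, smul_smul, mul_comm]
    · simp [F_mul_H, smul_smul, mul_comm]
    · simp [F_mul_H, T.form_symm j i, smul_smul, mul_comm]

variable (T q)

/-- The antipode, as an algebra map to the opposite algebra: `S E_i = - H_i⁻¹ E_i`,
`S F_i = - F_i H_i`, `S K_μ = K_μ⁻¹`. -/
def antipode : Uq T q →ₐ[k] (Uq T q)ᵐᵒᵖ := lift antipode_rel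

/-- Right multiplication by the antipode, `v ↦ v S(u)`, which is multiplicative in `u`. -/
def mulRightAntipode : Uq T q →ₐ[k] Module.End k (Uq T q) :=
  (Algebra.lsmul k k (Uq T q) : (Uq T q)ᵐᵒᵖ →ₐ[k] Module.End k (Uq T q)).comp (antipode T q)

theorem mulRightAntipode_apply (u v : Uq T q) :
    mulRightAntipode T q u v = v * (antipode T q u).unop := rfl

theorem commute_mulRightAntipode (u v : Uq T q) :
    Commute (Algebra.lmul k (Uq T q) u) (mulRightAntipode T q v) :=
  LinearMap.ext fun w => (mul_assoc u w (antipode T q v).unop).symm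

/-- The adjoint action `Ad_u(v) = u₍₁₎ v S(u₍₂₎)` of `U_q(T)` on itself. -/
def Ad : Uq T q →ₐ[k] Module.End k (Uq T q) :=
  (Algebra.TensorProduct.lift (Algebra.lmul k (Uq T q)) (mulRightAntipode T q)
    (commute_mulRightAntipode T q)).comp (comul T q)

end HopfMaps

end Uq
end Uq

section HopfValues

variable {k : Type*} [Field k] {I Y X : Type*} [AddCommGroup Y] [AddCommGroup X]
  (T : RootDatum I Y X) (q : kˣ)

namespace Uq

theorem comul_E (i : I) : comul T q (E T q i) = E T q i ⊗ₜ 1 + H T q i ⊗ₜ E T q i := lift_E _ i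

theorem comul_F (i : I) : comul T q (F T q i) = F T q i ⊗ₜ Hinv T q i + 1 ⊗ₜ F T q i := lift_F _ i

theorem comul_K (μ : T.Z) : comul T q (K T q μ) = K T q μ ⊗ₜ K T q μ := lift_K _ μ

theorem antipode_E (i : I) :
    antipode T q (E T q i) = MulOpposite.op (-(Hinv T q i * E T q i)) := lift_E _ i

theorem antipode_F (i : I) :
    antipode T q (F T q i) = MulOpposite.op (-(F T q i * H T q i)) := lift_F _ i

theorem antipode_K (μ : T.Z) : antipode T q (K T q μ) = MulOpposite.op (K T q (-μ)) := lift_K _ μ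

theorem Ad_aux (u v w : Uq T q) :
    Algebra.TensorProduct.lift (Algebra.lmul k (Uq T q)) (mulRightAntipode T q)
      (commute_mulRightAntipode T q) (u ⊗ₜ[k] v) w = u * (w * (antipode T q v).unop) := by
  rw [Algebra.TensorProduct.lift_tmul]
  rfl

theorem Ad_E (i : I) (x : Uq T q) :
    Ad T q (E T q i) x = E T q i * x - H T q i * x * Hinv T q i * E T q i := by
  rw [Ad, AlgHom.comp_apply, comul_E, map_add, LinearMap.add_apply, Ad_aux, Ad_aux, antipode_E,
    map_one, MulOpposite.unop_one, MulOpposite.unop_op]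
  noncomm_ring

theorem Ad_F (i : I) (x : Uq T q) :
    Ad T q (F T q i) x = (F T q i * x - x * F T q i) * H T q i := by
  rw [Ad, AlgHom.comp_apply, comul_F, map_add, LinearMap.add_apply, Ad_aux, Ad_aux, antipode_F,
    Hinv, antipode_K, neg_neg, ← H, MulOpposite.unop_op, MulOpposite.unop_op]
  noncomm_ring

theorem Ad_K (μ : T.Z) (x : Uq T q) : Ad T q (K T q μ) x = K T q μ * x * K T q (-μ) := by
  rw [Ad, AlgHom.comp_apply, comul_K, Ad_aux, antipode_K, MulOpposite.unop_op, mul_assoc]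

end Uq

end HopfValues

section Grading

variable {k : Type*} [Field k] {I Y X : Type*} [AddCommGroup Y] [AddCommGroup X]
  (T : RootDatum I Y X) (q : kˣ) (γ : I → ℤ)

namespace Uq

theorem grading_rel : SatisfiesRelations T q (A := AddMonoidAlgebra (Uq T q) ℤ)
    (fun i => AddMonoidAlgebra.single (γ i) (E T q i))
    (fun i => AddMonoidAlgebra.single (-γ i) (F T q i))
    (fun μ => AddMonoidAlgebra.single 0 (K T q μ)) where
  K_zero := by rw [(satisfiesRelations T q).K_zero]; rfl
  K_add μ ν := by
    rw [AddMonoidAlgebra.single_mul_single, (satisfiesRelations T q).K_add, add_zero]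
  K_E μ i := by
    rw [AddMonoidAlgebra.single_mul_single, AddMonoidAlgebra.single_mul_single,
      (satisfiesRelations T q).K_E, AddMonoidAlgebra.smul_single, add_comm]
  K_F μ i := by
    rw [AddMonoidAlgebra.single_mul_single, AddMonoidAlgebra.single_mul_single,
      (satisfiesRelations T q).K_F, AddMonoidAlgebra.smul_single, add_comm]
  E_F_same i := by
    rw [AddMonoidAlgebra.single_mul_single, AddMonoidAlgebra.single_mul_single,
      add_neg_cancel, neg_add_cancel, ← AddMonoidAlgebra.single_sub, ← AddMonoidAlgebra.single_sub,
      AddMonoidAlgebra.smul_single, (satisfiesRelations T q).E_F_same]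
  E_F_ne i j hij := by
    rw [AddMonoidAlgebra.single_mul_single, AddMonoidAlgebra.single_mul_single,
      add_comm (γ i), ← AddMonoidAlgebra.single_sub, (satisfiesRelations T q).E_F_ne i j hij,
      AddMonoidAlgebra.single_zero]
  serre_E i j hij := by
    have h1 := (satisfiesRelations T q).serre_E i j hij
    have h2 : serre (q ^ T.c i) (T.serreDeg i j)
        (AddMonoidAlgebra.single 0 (E T q i) : AddMonoidAlgebra (Uq T q) ℤ)
        (AddMonoidAlgebra.single 0 (E T q j)) = 0 := by
      have := serre_map (AddMonoidAlgebra.singleZeroAlgHom : Uq T q →ₐ[k] AddMonoidAlgebra (Uq T q) ℤ)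
        (q ^ T.c i) (T.serreDeg i j) (E T q i) (E T q j)
      rw [h1, map_zero] at this
      exact this.symm
    have h3 := serre_twist (q ^ T.c i) (T.serreDeg i j)
      (AddMonoidAlgebra.single (γ i) 1) (AddMonoidAlgebra.single (γ j) 1) _ _ 1 1
      (by rw [AddMonoidAlgebra.single_mul_single, AddMonoidAlgebra.single_mul_single, add_comm])
      (by simp)
      (by simp)
      (by simp) h2
    simpa [AddMonoidAlgebra.single_mul_single] using h3
  serre_F i j hij := by
    have h1 := (satisfiesRelations T q).serre_F i j hij
    have h2 : serre (q ^ T.c i) (T.serreDeg i j)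
        (AddMonoidAlgebra.single 0 (F T q i) : AddMonoidAlgebra (Uq T q) ℤ)
        (AddMonoidAlgebra.single 0 (F T q j)) = 0 := by
      have := serre_map (AddMonoidAlgebra.singleZeroAlgHom : Uq T q →ₐ[k] AddMonoidAlgebra (Uq T q) ℤ)
        (q ^ T.c i) (T.serreDeg i j) (F T q i) (F T q j)
      rw [h1, map_zero] at this
      exact this.symm
    have h3 := serre_twist (q ^ T.c i) (T.serreDeg i j)
      (AddMonoidAlgebra.single (-γ i) 1) (AddMonoidAlgebra.single (-γ j) 1) _ _ 1 1
      (by rw [AddMonoidAlgebra.single_mul_single, AddMonoidAlgebra.single_mul_single, add_comm])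
      (by simp)
      (by simp)
      (by simp) h2
    simpa [AddMonoidAlgebra.single_mul_single] using h3

/-- The `ℤ`-grading of `U_q(T)` with `deg E_i = - deg F_i = γ i`, `deg K_μ = 0`, as a coaction
of the group algebra of `ℤ`, i.e. as an algebra map to Laurent polynomials over `U_q(T)`. -/
def coaction : Uq T q →ₐ[k] AddMonoidAlgebra (Uq T q) ℤ := lift (grading_rel T q γ)

/-- The projection of `U_q(T)` onto its degree `n` component. -/
def degreeProj (n : ℤ) : Uq T q →ₗ[k] Uq T q :=
  Finsupp.lapply n ∘ₗ (AddMonoidAlgebra.coeffLinearEquiv k).toLinearMap ∘ₗ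
    (coaction T q γ).toLinearMap

/-- The degree `n` component of `U_q(T)`. -/
def degreePart (n : ℤ) : Submodule k (Uq T q) :=
  LinearMap.eqLocus (coaction T q γ).toLinearMap (AddMonoidAlgebra.lsingle n)

end Uq

end Grading

section Modules

variable {k : Type*} [Field k] {I Y X : Type*} [AddCommGroup Y] [AddCommGroup X]
  (T : RootDatum I Y X) (q : kˣ)

/-- The left ideal `∑ U_q(T) E_i + ∑ U_q(T) (K_i - q^⟨i₁(i), lam⟩)`. -/
def vermaIdeal (lam : X) : Submodule (Uq T q) (Uq T q) :=
  Submodule.span (Uq T q) (Set.range (Uq.E T q) ∪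
    Set.range fun i => Uq.K T q (T.z i) - algebraMap k _ (qz q (T.pairing (T.i₁ i) lam)))

/-- The Verma module `Δ(lam)`. -/
abbrev Verma (lam : X) : Type _ := Uq T q ⧸ vermaIdeal T q lam

/-- The Weyl module `L(lam)` is finite-dimensional. Here `L(lam)` is the simple factor
`Δ(lam) ⧸ N` of the Verma module by its maximal proper submodule `N`. (If there were several
maximal proper submodules, one of them giving a finite-dimensional factor would suffice.) -/
def WeylModuleFiniteDimensional (lam : X) : Prop :=
  ∃ N : Submodule (Uq T q) (Verma T q lam), IsCoatom N ∧ FiniteDimensional k (Verma T q lam ⧸ N)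

variable {M : Type*} [AddCommGroup M] [Module k M]

/-- The `lam`-weight space of a representation of `U_q(T)`. -/
def weightSpace (φ : Uq T q →ₐ[k] Module.End k M) (lam : X) : Submodule k M where
  carrier := {m | ∀ μ : T.Z, φ (Uq.K T q μ) m = qz q (T.pairing (μ : Y) lam) • m}
  add_mem' ha hb μ := by rw [map_add, ha μ, hb μ, smul_add]
  zero_mem' μ := by simp
  smul_mem' a m hm μ := by rw [map_smul, hm μ, smul_comm]

/-- A subspace `W` of a representation `φ` of `U_q(T)` is an integrable `U_q(T)`-submodule: it is
stable, it is the sum of its weight spaces, and all `E_i` and `F_i` act locally nilpotently. -/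
structure IsIntegrableSubmodule (φ : Uq T q →ₐ[k] Module.End k M) (W : Submodule k M) : Prop where
  stable : ∀ u, ∀ w ∈ W, φ u w ∈ W
  weights : W = ⨆ lam : X, weightSpace T q φ lam ⊓ W
  E_nilpotent : ∀ i, ∀ w ∈ W, ∃ n₀ : ℕ, ∀ n ≥ n₀, φ (Uq.E T q i ^ n) w = 0
  F_nilpotent : ∀ i, ∀ w ∈ W, ∃ n₀ : ℕ, ∀ n ≥ n₀, φ (Uq.F T q i ^ n) w = 0

end Modules

/-- The data of a sub-root datum `S ⊆_ι T`, including the choice of the complement `X''`. -/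
structure SubRootDatum {J Y' X' I Y X : Type*} [AddCommGroup Y'] [AddCommGroup X']
    [AddCommGroup Y] [AddCommGroup X] (S : RootDatum J Y' X') (T : RootDatum I Y X) where
  ι : J → I
  ι_injective : Function.Injective ι
  form_eq : ∀ i j, T.form (ι i) (ι j) = S.form i j
  sY : Y' →ₗ[ℤ] Y
  sX : X' →ₗ[ℤ] X
  sY_injective : Function.Injective sY
  sX_injective : Function.Injective sX
  free_quot_Y : Module.Free ℤ (Y ⧸ LinearMap.range sY)
  free_quot_X : Module.Free ℤ (X ⧸ LinearMap.range sX)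
  pairing_eq : ∀ y x, T.pairing (sY y) (sX x) = S.pairing y x
  X'' : Submodule ℤ X
  isCompl : IsCompl (LinearMap.range sX) X''
  orthogonal : ∀ y, ∀ x ∈ X'', T.pairing (sY y) x = 0
  sY_i₁ : ∀ j, sY (S.i₁ j) = T.i₁ (ι j)
  sX_i₂ : ∀ j, sX (S.i₂ j) = T.i₂ (ι j)

namespace SubRootDatum

variable {J Y' X' I Y X : Type*} [AddCommGroup Y'] [AddCommGroup X']
    [AddCommGroup Y] [AddCommGroup X] {S : RootDatum J Y' X'} {T : RootDatum I Y X}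
    (σ : SubRootDatum S T)

/-- `D = I \ ι(J)`. -/
abbrev D : Type _ := {i : I // i ∉ Set.range σ.ι}

/-- The restriction map `ρ : X → X'`, the projection along `X''`. -/
def ρ : X →ₗ[ℤ] X' :=
  (LinearEquiv.ofInjective σ.sX σ.sX_injective).symm.toLinearMap ∘ₗ
    Submodule.projectionOnto (LinearMap.range σ.sX) σ.X'' σ.isCompl

/-- The weight `λ'_d = ρ(- i₂(d))`. -/
def weight (d : σ.D) : X' := σ.ρ (-T.i₂ d)

open Classical in
/-- The degree function on `I` whose associated `ℤ`-grading of `U_q(T)` has `deg F_i = χ_D(i)`,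
i.e. `-χ_D`. -/
def negChi (i : I) : ℤ := if i ∈ Set.range σ.ι then 0 else -1

/-- The map `Z' → Z` induced by `s_Y`. -/
def sZ (ν : S.Z) : T.Z := ⟨σ.sY ν, by
  have h : S.Z ≤ T.Z.comap σ.sY.toAddMonoidHom := by
    rw [RootDatum.Z, AddSubgroup.closure_le]
    rintro _ ⟨j, rfl⟩
    exact AddSubgroup.subset_closure ⟨σ.ι j, (σ.sY_i₁ j).symm⟩
  exact h ν.2⟩

theorem c_eq (j : J) : T.c (σ.ι j) = S.c j := by simp [RootDatum.c, σ.form_eq]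

theorem serreDeg_eq (i j : J) : T.serreDeg (σ.ι i) (σ.ι j) = S.serreDeg i j := by
  simp [RootDatum.serreDeg, RootDatum.cartan, σ.form_eq]

theorem sZ_add (μ ν : S.Z) : σ.sZ (μ + ν) = σ.sZ μ + σ.sZ ν := by ext; simp [sZ]

theorem sZ_c (j : J) : σ.sZ (S.c j • S.z j) = T.c (σ.ι j) • T.z (σ.ι j) := by
  ext; simp [sZ, σ.c_eq, RootDatum.z, σ.sY_i₁]

theorem sZ_neg (μ : S.Z) : σ.sZ (-μ) = -σ.sZ μ := by ext; simp [sZ]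

theorem pairing_sZ (μ : S.Z) (j : J) :
    T.pairing (σ.sZ μ : Y) (T.i₂ (σ.ι j)) = S.pairing (μ : Y') (S.i₂ j) := by
  rw [← σ.sX_i₂, ← σ.pairing_eq]; rfl

variable {k : Type*} [Field k] (q : kˣ)

theorem incl_rel : SatisfiesRelations S q (fun j => Uq.E T q (σ.ι j)) (fun j => Uq.F T q (σ.ι j))
    (fun μ => Uq.K T q (σ.sZ μ)) where
  K_zero := by
    have : σ.sZ 0 = 0 := by ext; simp [sZ]
    rw [this, (Uq.satisfiesRelations T q).K_zero]
  K_add μ ν := by rw [σ.sZ_add, (Uq.satisfiesRelations T q).K_add]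
  K_E μ j := by rw [(Uq.satisfiesRelations T q).K_E, σ.pairing_sZ]
  K_F μ j := by rw [(Uq.satisfiesRelations T q).K_F, σ.pairing_sZ]
  E_F_same j := by
    rw [(Uq.satisfiesRelations T q).E_F_same, σ.sZ_neg, σ.sZ_c, σ.c_eq]
  E_F_ne i j h := (Uq.satisfiesRelations T q).E_F_ne _ _ (σ.ι_injective.ne h)
  serre_E i j h := by
    rw [← σ.c_eq, ← σ.serreDeg_eq]
    exact (Uq.satisfiesRelations T q).serre_E _ _ (σ.ι_injective.ne h)
  serre_F i j h := by
    rw [← σ.c_eq, ← σ.serreDeg_eq]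
    exact (Uq.satisfiesRelations T q).serre_F _ _ (σ.ι_injective.ne h)

/-- The homomorphism `U_q(S) → U_q(T)`: `E_j ↦ E_{ι j}`, `F_j ↦ F_{ι j}`, `K_ν ↦ K_ν`. -/
def incl : Uq S q →ₐ[k] Uq T q := Uq.lift (σ.incl_rel q)

/-- The adjoint action of `U_q(T)` on itself, restricted to `U_q(S)`. -/
def adRestrict : Uq S q →ₐ[k] Module.End k (Uq T q) := (Uq.Ad T q).comp (σ.incl q)

/-- The extension of `U_q(S)` by the Cartan part of `U_q(T)`: the subalgebra of `U_q(T)` generated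
by `E_j`, `F_j` for `j ∈ ι(J)` and all `K_μ`, `μ ∈ Z`. -/
def tildeUq : Subalgebra k (Uq T q) :=
  Algebra.adjoin k (Set.range (fun j => Uq.E T q (σ.ι j)) ∪ Set.range (fun j => Uq.F T q (σ.ι j)) ∪
    Set.range (Uq.K T q))

end SubRootDatum

/-- The quantum negative Borel subalgebra, generated by all `F_i` and `K_μ`. -/
def negBorel {k I Y X : Type*} [Field k] [AddCommGroup Y] [AddCommGroup X]
    (T : RootDatum I Y X) (q : kˣ) : Subalgebra k (Uq T q) :=
  Algebra.adjoin k (Set.range (Uq.F T q) ∪ Set.range (Uq.K T q))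

namespace SubRootDatum

variable {J Y' X' I Y X : Type*} [AddCommGroup Y'] [AddCommGroup X']
    [AddCommGroup Y] [AddCommGroup X] {S : RootDatum J Y' X'} {T : RootDatum I Y X}
    (σ : SubRootDatum S T) {k : Type*} [Field k] (q : kˣ)

/-- The algebra of coinvariants `B = {b ∈ U_q^≤(T) | b₍₁₎ ⊗ π(b₍₂₎) = b ⊗ 1}`, where `π` is the
projection onto the degree zero component for the grading `deg F_i = χ_D(i)`. -/
def B : Submodule k (Uq T q) :=
  Subalgebra.toSubmodule (negBorel T q) ⊓
    LinearMap.eqLocus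
      ((Uq.degreeProj T q σ.negChi 0).lTensor (Uq T q) ∘ₗ (Uq.comul T q).toLinearMap)
      ((TensorProduct.mk k (Uq T q) (Uq T q)).flip 1)

/-- The first graded component `B_1` of `B`. -/
def B₁ : Submodule k (Uq T q) := σ.B q ⊓ Uq.degreePart T q σ.negChi 1

/-- `V(λ'_d)`, the cyclic submodule generated by `F_d H_d` under the adjoint action of the
extension `tildeUq` of `U_q(S)`. -/
def V (d : σ.D) : Submodule k (Uq T q) :=
  (Subalgebra.toSubmodule (σ.tildeUq q)).map
    ((Uq.Ad T q).toLinearMap.flip (Uq.F T q d * Uq.H T q d))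

/-- A subspace `W` of `U_q(T)` is an integrable module for the adjoint action of `tildeUq`: it is
`tildeUq`-stable, it is the sum of its weight spaces for all `K_μ`, `μ ∈ Z` (with weights in `X`),
and its restriction to `U_q(S)` is an integrable `U_q(S)`-module. -/
structure IsIntegrable (W : Submodule k (Uq T q)) : Prop where
  stable : ∀ u ∈ σ.tildeUq q, ∀ w ∈ W, Uq.Ad T q u w ∈ W
  weights : W = ⨆ lam : X, weightSpace T q (Uq.Ad T q) lam ⊓ W
  restrict : IsIntegrableSubmodule S q (σ.adRestrict q) W

end SubRootDatum

end QEA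

end

open scoped TensorProduct

/-! The vector F_d H_d is a highest weight vector for the adjoint action of U_q(S). It is killed by
Ad E_j because E_j commutes with F_d. The powers of Ad F_j send it to iterated q-commutators of F_j
with F_d, times a Cartan factor, and the quantum Serre relation makes these vanish at exponent 1 -
C_{jd} (`pow_serreDeg_Ad_F_apply`). Hence V(λ'_d) is spanned by the F-words applied to F_d H_d
(`V_eq_wordSpan`). Local nilpotency of E_j follows by counting letters, that of F_j from the Serre
relations.

V(λ'_d) lies in B_1 because F_d H_d does and each Ad F_j preserves B_1. In fact B_1 is the sum of
the V(λ'_d) (`B₁_eq_iSup`), from which integrability of B_1 follows. A degree-one element of the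
negative Borel part is a sum of products w a with w in ∑ V(λ'_d) and a in the degree-zero
subalgebra. Applying x ⊗ y ↦ x S(y) to x₍₁₎ ⊗ π(x₍₂₎) sends w a to a scalar multiple of w, but fixes
every coinvariant.

Finite-dimensionality is proved without complete reducibility and without a comparison map between
V(λ'_d) and L(λ'_d). Write n_i for the values of the highest weight on the coroots. Summing the
weights of a basis of a finite-dimensional highest weight module yields an integer vector m ≥ 0 with
C m ≥ n (`exists_cartan_ge`). Conversely, in any highest weight module with F_i^{n_i+1} v = 0, the
weights λ - ∑ b_i α_i are stable under the simple reflections that shrink b. This gives the norm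
inequality `quadForm_le`, and the vector m turns it into a sum of nonnegative squares bounding b
(`bounded_of_reflection`). Only finitely many F-words then act nontrivially on v. The rank-one input
to both halves is that E_i^p and F_i^p are injective on vectors of weight -p and p when q is not a
root of unity. -/

namespace QEA

/-! ### q-integers and the symmetry q ↦ q⁻¹. -/

section QNumbers

variable {k : Type*} [Field k]

theorem qz_injective {q : kˣ} (hq : ∀ n : ℕ, 0 < n → q ^ n ≠ 1) :
    Function.Injective (qz q : ℤ → k) := by
  have h : Function.Injective fun n : ℤ => q ^ n := by
    rw [injective_zpow_iff_not_isOfFinOrder, isOfFinOrder_iff_pow_eq_one]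
    rintro ⟨n, h0, h1⟩
    exact hq n h0 h1
  exact Units.val_injective.comp h

/-- The `q`-integer `[n]` at the parameter `q ^ c`, for `n : ℤ`. -/
def qbracket (q : kˣ) (c n : ℤ) : k :=
  (qz q c - qz q (-c))⁻¹ * (qz q (c * n) - qz q (-(c * n)))

theorem qbracket_neg (q : kˣ) (c n : ℤ) : qbracket q c (-n) = -qbracket q c n := by
  simp only [qbracket, mul_neg, neg_neg]
  ring

theorem qz_sub_ne_zero {q : kˣ} (hq : ∀ n : ℕ, 0 < n → q ^ n ≠ 1) {n : ℤ} (hn : n ≠ 0) :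
    qz q n - qz q (-n) ≠ 0 := by
  rw [sub_ne_zero]
  intro h
  have := qz_injective hq h
  omega

theorem qbracket_ne_zero {q : kˣ} (hq : ∀ n : ℕ, 0 < n → q ^ n ≠ 1) {c n : ℤ} (hc : c ≠ 0)
    (hn : n ≠ 0) : qbracket q c n ≠ 0 :=
  mul_ne_zero (inv_ne_zero (qz_sub_ne_zero hq hc)) (qz_sub_ne_zero hq (mul_ne_zero hc hn))

theorem qbracket_one {q : kˣ} (hq : ∀ n : ℕ, 0 < n → q ^ n ≠ 1) {c : ℤ} (hc : c ≠ 0) :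
    qbracket q c 1 = 1 := by
  rw [qbracket, mul_one, inv_mul_cancel₀ (qz_sub_ne_zero hq hc)]

/-- The inductive step of `pow_comm_lower`. After clearing denominators it is an identity between
Laurent polynomials in q. -/
theorem qbracket_mul_add {q : kˣ} (hq : ∀ n : ℕ, 0 < n → q ^ n ≠ 1) {c : ℤ} (hc : c ≠ 0)
    (r p : ℤ) : qbracket q c (r + 1) * qbracket q c (p + r) =
      qbracket q c r * qbracket q c (p + r - 1) + qbracket q c (p + 2 * r) := by
  have h := qz_sub_ne_zero hq hc
  simp only [qbracket]
  field_simp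
  simp only [mul_sub, sub_mul, ← qz_add]
  ring_nf

/-- The two q-Pascal rules are exchanged by q ↦ q⁻¹. This is needed because iterating Ad F_i
produces q-commutators at q_i⁻¹, while the Serre relations are stated at q_i. -/
theorem qbinom_inv (q : kˣ) (n j : ℕ) : qbinom q⁻¹ n j = qbinom q n j := by
  have hz : ∀ m : ℤ, qz q⁻¹ m = qz q (-m) := fun m => by simp [qz]
  induction n generalizing j with
  | zero => cases j <;> simp [qbinom]
  | succ n ih =>
    cases j with
    | zero => simp [qbinom_zero_right]
    | succ j => rw [qbinom_succ_succ, qbinom_succ_succ', ih, ih, hz, hz, neg_neg]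

theorem serre_inv {A : Type*} [Ring A] [Algebra k A] (q : kˣ) (N : ℕ) (x y : A) :
    serre q⁻¹ N x y = serre q N x y := by
  simp only [serre, qbinom_inv]

end QNumbers

/-! ### Rank one: powers of e and f on weight vectors. -/

section SlTwo

variable {k M : Type*} [Field k] [AddCommGroup M] [Module k M] {q : kˣ} {c : ℤ}
  {e f : Module.End k M} {Wt : ℤ → Submodule k M}

/-- Each further e crosses f at a weight higher by 2, and the resulting brackets are summed by
`qbracket_mul_add`. No Cartan element appears, only a family `Wt` of subspaces; this makes it
possible to exchange e and f later by reindexing p ↦ -p. -/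
theorem pow_comm_lower (hq : ∀ n : ℕ, 0 < n → q ^ n ≠ 1) (hc : c ≠ 0)
    (he : ∀ p, ∀ u ∈ Wt p, e u ∈ Wt (p + 2))
    (hef : ∀ p, ∀ u ∈ Wt p, e (f u) = f (e u) + qbracket q c p • u)
    {p : ℤ} {u : M} (hu : u ∈ Wt p) (r : ℕ) :
    (e ^ (r + 1)) (f u) =
      f ((e ^ (r + 1)) u) + (qbracket q c (r + 1) * qbracket q c (p + r)) • (e ^ r) u := by
  have hmem : ∀ r : ℕ, (e ^ r) u ∈ Wt (p + 2 * r) := by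
    intro r
    induction r with
    | zero => simpa using hu
    | succ r ih =>
      rw [pow_succ', Module.End.mul_apply]
      convert he _ _ ih using 2
      push_cast; ring
  induction r with
  | zero => simp [hef p u hu, qbracket_one hq hc]
  | succ r ih =>
    rw [pow_succ', Module.End.mul_apply, ih, map_add, map_smul, hef _ _ (hmem (r + 1)),
      ← Module.End.mul_apply e (e ^ (r + 1)), ← pow_succ', ← Module.End.mul_apply e (e ^ r),
      ← pow_succ', add_assoc, ← add_smul]
    have h := qbracket_mul_add hq hc ((r + 1 : ℕ) : ℤ) p
    push_cast at h ⊢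
    rw [h]
    congr 2
    rw [add_comm, add_sub_assoc, add_sub_cancel_right]

/-- On a module with weights where `f` is locally nilpotent, `e ^ m` is injective on weight
`-m` vectors. -/
theorem pow_apply_ne_zero (hq : ∀ n : ℕ, 0 < n → q ^ n ≠ 1) (hc : c ≠ 0)
    (he : ∀ p, ∀ u ∈ Wt p, e u ∈ Wt (p + 2)) (hf : ∀ p, ∀ u ∈ Wt p, f u ∈ Wt (p - 2))
    (hef : ∀ p, ∀ u ∈ Wt p, e (f u) = f (e u) + qbracket q c p • u)
    (N m : ℕ) {u : M} (hu : u ∈ Wt (-m)) (h0 : u ≠ 0) (hN : (f ^ N) u = 0) : (e ^ m) u ≠ 0 := by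
  induction N generalizing m u with
  | zero => exact absurd hN h0
  | succ N ih =>
    -- If u is a lowest weight vector, e^{s+1} u = 0 would give [s+1][s-m] e^s u = 0, and both
    -- brackets are nonzero for s < m.
    by_cases hfu : f u = 0
    · suffices h : ∀ s ≤ m, (e ^ s) u ≠ 0 from h m le_rfl
      intro s hs
      induction s with
      | zero => simpa using h0
      | succ s ihs =>
        intro h
        have h1 := pow_comm_lower hq hc he hef hu s
        rw [hfu, h, map_zero, map_zero, zero_add] at h1
        refine smul_ne_zero (mul_ne_zero ?_ ?_) (ihs (by omega)) h1.symm
        · exact qbracket_ne_zero hq hc (by omega)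
        · exact qbracket_ne_zero hq hc (by omega)
    -- Otherwise f u has weight -(m+2) and is killed by a smaller power of f. If e^m u = 0,
    -- commuting e^{m+2} past f would give e^{m+2} f u = 0.
    · have h1 : (e ^ (m + 2)) (f u) ≠ 0 := by
        refine ih (m + 2) ?_ hfu (by rwa [pow_succ, Module.End.mul_apply] at hN)
        convert hf _ _ hu using 2
        push_cast; ring
      intro h
      have h2 : (e ^ (m + 1)) u = 0 := by rw [pow_succ', Module.End.mul_apply, h, map_zero]
      have h3 : (e ^ (m + 2)) u = 0 := by rw [pow_succ', Module.End.mul_apply, h2, map_zero]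
      have h4 := pow_comm_lower hq hc he hef hu (m + 1)
      rw [h2, show m + 1 + 1 = m + 2 from rfl, h3, map_zero, smul_zero, add_zero] at h4
      exact h1 h4

/-- The variant of `pow_apply_ne_zero` with the roles of `e` and `f` exchanged. -/
theorem pow_apply_ne_zero' (hq : ∀ n : ℕ, 0 < n → q ^ n ≠ 1) (hc : c ≠ 0)
    (he : ∀ p, ∀ u ∈ Wt p, e u ∈ Wt (p + 2)) (hf : ∀ p, ∀ u ∈ Wt p, f u ∈ Wt (p - 2))
    (hef : ∀ p, ∀ u ∈ Wt p, e (f u) = f (e u) + qbracket q c p • u)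
    (N m : ℕ) {u : M} (hu : u ∈ Wt m) (h0 : u ≠ 0) (hN : (e ^ N) u = 0) : (f ^ m) u ≠ 0 := by
  refine pow_apply_ne_zero (e := f) (f := e) (Wt := fun p => Wt (-p)) hq hc (fun p u hu => ?_)
    (fun p u hu => ?_) (fun p u hu => ?_) N m (by simpa using hu) h0 hN
  · convert hf _ _ hu using 2; ring
  · convert he _ _ hu using 2; ring
  · rw [hef _ _ hu, qbracket_neg]; simp

end SlTwo

/-! ### Locally nilpotent vectors and the Serre relations. -/

section NilVectors

variable {k M : Type*} [Field k] [AddCommGroup M] [Module k M]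

theorem pow_apply_eq_zero_of_le {f : Module.End k M} {u : M} {m n : ℕ} (h : m ≤ n)
    (hm : (f ^ m) u = 0) : (f ^ n) u = 0 := by
  rw [← Nat.sub_add_cancel h, pow_add, Module.End.mul_apply, hm, map_zero]

/-- The vectors on which an endomorphism acts nilpotently. -/
def nilVectors (f : Module.End k M) : Submodule k M where
  carrier := {u | ∃ n : ℕ, (f ^ n) u = 0}
  zero_mem' := ⟨0, by simp⟩
  add_mem' := by
    rintro a b ⟨m, hm⟩ ⟨n, hn⟩
    exact ⟨m + n, by rw [map_add, pow_apply_eq_zero_of_le (Nat.le_add_right m n) hm,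
      pow_apply_eq_zero_of_le (Nat.le_add_left n m) hn, add_zero]⟩
  smul_mem' := by
    rintro a u ⟨n, hn⟩
    exact ⟨n, by rw [map_smul, hn, smul_zero]⟩

theorem apply_mem_nilVectors {f : Module.End k M} {u : M} :
    f u ∈ nilVectors f ↔ u ∈ nilVectors f := by
  constructor
  · rintro ⟨n, hn⟩
    exact ⟨n + 1, by rwa [pow_succ, Module.End.mul_apply]⟩
  · rintro ⟨n, hn⟩
    refine ⟨n, ?_⟩
    rw [← Module.End.mul_apply, ← pow_succ]
    exact pow_apply_eq_zero_of_le (Nat.le_succ n) hn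

theorem pow_apply_mem_nilVectors {f : Module.End k M} {u : M} (n : ℕ) :
    (f ^ n) u ∈ nilVectors f ↔ u ∈ nilVectors f := by
  induction n with
  | zero => simp
  | succ n ih => rw [pow_succ', Module.End.mul_apply, apply_mem_nilVectors, ih]

/-- If `g` satisfies a quantum Serre relation with `f`, then `g` preserves local
`f`-nilpotency. -/
theorem nilVectors_stable_of_serre {f g : Module.End k M} {p : kˣ} {N : ℕ}
    (h : serre p N f g = 0) {u : M} (hu : u ∈ nilVectors f) : g u ∈ nilVectors f := by
  obtain ⟨n, hn⟩ := hu
  induction n using Nat.strong_induction_on generalizing u with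
  | _ n ih =>
    rcases n with _ | n
    · simp at hn; simp [hn]
    rw [serre, Finset.sum_range_succ'] at h
    have h1 := congrArg (fun T : Module.End k M => T u) h
    simp only [LinearMap.add_apply, LinearMap.zero_apply, LinearMap.sum_apply, LinearMap.smul_apply,
      Module.End.mul_apply, pow_zero, qbinom_zero_right, mul_one, one_smul, Nat.sub_zero] at h1
    -- The relation writes f^N g u as a combination of f^{N-s} g f^s u with s ≥ 1, and f^s u is
    -- killed by a smaller power of f than u.
    rw [← pow_apply_mem_nilVectors N, ← neg_mem_iff, ← eq_neg_of_add_eq_zero_left h1]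
    refine sum_mem fun m _ => Submodule.smul_mem _ _ ?_
    rw [pow_apply_mem_nilVectors]
    refine ih (n - m) (by omega) ?_
    rw [← Module.End.mul_apply, ← pow_add]
    exact pow_apply_eq_zero_of_le (by omega) hn

end NilVectors

/-! ### Checking stability on generators. -/

section Stability

variable {k A M : Type*} [Field k] [Ring A] [Algebra k A] [AddCommGroup M] [Module k M]

theorem adjoin_apply_mem {φ : A →ₐ[k] Module.End k M} {s : Set A} {W : Submodule k M}
    (h : ∀ x ∈ s, ∀ w ∈ W, φ x w ∈ W) {u : A} (hu : u ∈ Algebra.adjoin k s) :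
    ∀ w ∈ W, φ u w ∈ W := by
  induction hu using Algebra.adjoin_induction with
  | mem x hx => exact h x hx
  | algebraMap r =>
    intro w hw
    rw [AlgHom.commutes, Module.algebraMap_end_apply]
    exact W.smul_mem _ hw
  | add x y _ _ hx hy =>
    intro w hw
    rw [map_add]
    exact W.add_mem (hx w hw) (hy w hw)
  | mul x y _ _ hx hy =>
    intro w hw
    rw [map_mul]
    exact hx _ (hy w hw)

theorem mem_of_mul_left_mem {s : Set A} {W : Submodule k A} (h1 : 1 ∈ W)
    (h : ∀ x ∈ s, ∀ w ∈ W, x * w ∈ W) {u : A} (hu : u ∈ Algebra.adjoin k s) : u ∈ W := by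
  simpa using adjoin_apply_mem (φ := Algebra.lmul k A) h hu 1 h1

end Stability

namespace Uq

variable {k : Type*} [Field k] {I Y X : Type*} [AddCommGroup Y] [AddCommGroup X]
  (T : RootDatum I Y X) (q : kˣ)

theorem adjoin_generators :
    Algebra.adjoin k (Set.range (E T q) ∪ Set.range (F T q) ∪ Set.range (K T q)) = ⊤ := by
  have hs : Function.Surjective (mk T q) := RingQuot.mkAlgHom_surjective k _
  rw [eq_top_iff, ← AlgHom.range_eq_top _ |>.2 hs, ← Algebra.map_top,
    ← FreeAlgebra.adjoin_range_ι, AlgHom.map_adjoin]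
  refine Algebra.adjoin_mono ?_
  rintro _ ⟨_, ⟨g | g | g, rfl⟩, rfl⟩
  · exact Or.inl (Or.inl ⟨g, rfl⟩)
  · exact Or.inl (Or.inr ⟨g, rfl⟩)
  · exact Or.inr ⟨g, rfl⟩

end Uq

/-! ### Weight vectors, words in the F_i, highest weight modules. -/

section Weights

variable {k : Type*} [Field k] {I Y X : Type*} [AddCommGroup Y] [AddCommGroup X]
  {T : RootDatum I Y X} {q : kˣ} {M : Type*} [AddCommGroup M] [Module k M]
  (φ : Uq T q →ₐ[k] Module.End k M)

theorem RootDatum.c_pos (i : I) : 0 < T.c i := by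
  have := T.c_eq i
  have := T.form_pos i
  omega

theorem F_mem_weightSpace {φ : Uq T q →ₐ[k] Module.End k M} {lam : X} {u : M}
    (hu : u ∈ weightSpace T q φ lam) (i : I) :
    φ (Uq.F T q i) u ∈ weightSpace T q φ (lam - T.i₂ i) := by
  intro μ
  rw [← Module.End.mul_apply, ← map_mul, (Uq.satisfiesRelations T q).K_F, map_smul, map_mul,
    LinearMap.smul_apply, Module.End.mul_apply, hu μ, map_smul, smul_smul, ← qz_add, map_sub,
    neg_add_eq_sub]

/-- The `H_i`-eigenspace with eigenvalue `q_i ^ p`. -/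
def hWeight (i : I) (p : ℤ) : Submodule k M :=
  LinearMap.ker (φ (Uq.H T q i) - qz q (T.c i * p) • LinearMap.id)

variable {φ}

theorem mem_hWeight {i : I} {p : ℤ} {u : M} :
    u ∈ hWeight φ i p ↔ φ (Uq.H T q i) u = qz q (T.c i * p) • u := by
  simp [hWeight, sub_eq_zero]

theorem weightSpace_le_hWeight (lam : X) (i : I) :
    weightSpace T q φ lam ≤ hWeight φ i (T.pairing (T.i₁ i) lam) := by
  intro u hu
  rw [mem_hWeight, Uq.H, hu]
  simp [RootDatum.z]

theorem E_mem_hWeight {i : I} {p : ℤ} {u : M} (hu : u ∈ hWeight φ i p) :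
    φ (Uq.E T q i) u ∈ hWeight φ i (p + 2) := by
  rw [mem_hWeight] at *
  rw [← Module.End.mul_apply, ← map_mul, Uq.H_mul_E, map_smul, map_mul,
    LinearMap.smul_apply, Module.End.mul_apply, hu, map_smul, smul_smul, ← qz_add, ← T.c_eq]
  ring_nf

theorem F_mem_hWeight {i : I} {p : ℤ} {u : M} (hu : u ∈ hWeight φ i p) :
    φ (Uq.F T q i) u ∈ hWeight φ i (p - 2) := by
  rw [mem_hWeight] at *
  rw [← Module.End.mul_apply, ← map_mul, Uq.H_mul_F, map_smul, map_mul,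
    LinearMap.smul_apply, Module.End.mul_apply, hu, map_smul, smul_smul, ← qz_add, ← T.c_eq]
  ring_nf

theorem Hinv_apply_hWeight {i : I} {p : ℤ} {u : M} (hu : u ∈ hWeight φ i p) :
    φ (Uq.Hinv T q i) u = qz q (-(T.c i * p)) • u := by
  rw [mem_hWeight] at hu
  apply Uq.smul_flip
  rw [← map_smul, ← hu, ← Module.End.mul_apply, ← map_mul, Uq.Hinv_mul_H, map_one,
    Module.End.one_apply]

theorem E_F_apply {i : I} {p : ℤ} {u : M} (hu : u ∈ hWeight φ i p) :
    φ (Uq.E T q i) (φ (Uq.F T q i) u) =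
      φ (Uq.F T q i) (φ (Uq.E T q i) u) + qbracket q (T.c i) p • u := by
  rw [← sub_eq_iff_eq_add', ← Module.End.mul_apply, ← Module.End.mul_apply, ← map_mul, ← map_mul,
    ← LinearMap.sub_apply, ← map_sub, Uq.E_F_same', map_smul, map_sub, LinearMap.smul_apply,
    LinearMap.sub_apply, Hinv_apply_hWeight hu, mem_hWeight.1 hu, ← sub_smul, smul_smul, qbracket]

theorem E_F_apply_of_ne {i j : I} (hij : i ≠ j) (u : M) :
    φ (Uq.E T q i) (φ (Uq.F T q j) u) = φ (Uq.F T q j) (φ (Uq.E T q i) u) := by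
  rw [← sub_eq_zero, ← Module.End.mul_apply, ← Module.End.mul_apply, ← map_mul, ← map_mul,
    ← LinearMap.sub_apply, ← map_sub, (Uq.satisfiesRelations T q).E_F_ne i j hij, map_zero,
    LinearMap.zero_apply]

/-- The action of the monomial `F_{j₁} ⋯ F_{jᵣ}`. -/
def fWord (φ : Uq T q →ₐ[k] Module.End k M) (w : List I) : Module.End k M :=
  (w.map fun i => φ (Uq.F T q i)).prod

theorem fWord_nil (v : M) : fWord φ [] v = v := rfl

theorem fWord_cons (i : I) (w : List I) (v : M) :
    fWord φ (i :: w) v = φ (Uq.F T q i) (fWord φ w v) := by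
  simp [fWord]

theorem fWord_mem_weightSpace {lam : X} {v : M} (hv : v ∈ weightSpace T q φ lam) (w : List I) :
    fWord φ w v ∈ weightSpace T q φ (lam - (w.map T.i₂).sum) := by
  induction w with
  | nil => simpa [fWord_nil] using hv
  | cons i w ih =>
    rw [fWord_cons]
    convert F_mem_weightSpace ih i using 2
    simp; abel

/-- A highest weight vector. -/
structure IsHighestWeight (φ : Uq T q →ₐ[k] Module.End k M) (lam : X) (v : M) : Prop where
  E_apply : ∀ i, φ (Uq.E T q i) v = 0
  weight : v ∈ weightSpace T q φ lam

variable (φ) in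
/-- The span of the vectors `F_{j₁} ⋯ F_{jᵣ} v`. -/
def wordSpan (v : M) : Submodule k M := Submodule.span k (Set.range fun w => fWord φ w v)

variable (φ) in
/-- The span of the vectors `F_{j₁} ⋯ F_{jᵣ} v` in which each `F_i` occurs `b i` times. -/
def contentSpan [DecidableEq I] (v : M) (b : I → ℤ) : Submodule k M :=
  Submodule.span k ((fun w => fWord φ w v) '' {w | ∀ i, (w.count i : ℤ) = b i})

variable {lam : X} {v : M}

theorem fWord_mem_wordSpan (w : List I) : fWord φ w v ∈ wordSpan φ v :=
  Submodule.subset_span ⟨w, rfl⟩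

theorem self_mem_wordSpan : v ∈ wordSpan φ v := fWord_mem_wordSpan []

theorem wordSpan_le {W : Submodule k M} : wordSpan φ v ≤ W ↔ ∀ w, fWord φ w v ∈ W := by
  rw [wordSpan, Submodule.span_le]
  exact Set.range_subset_iff

theorem apply_mem_of_fWord {f : Module.End k M} {W : Submodule k M}
    (h : ∀ w, f (fWord φ w v) ∈ W) : ∀ u ∈ wordSpan φ v, f u ∈ W := by
  have : wordSpan φ v ≤ W.comap f := wordSpan_le.2 h
  exact this

theorem F_mem_wordSpan (i : I) : ∀ u ∈ wordSpan φ v, φ (Uq.F T q i) u ∈ wordSpan φ v :=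
  apply_mem_of_fWord fun w => by
    rw [← fWord_cons]
    exact fWord_mem_wordSpan _

theorem K_mem_wordSpan (hv : v ∈ weightSpace T q φ lam) (μ : T.Z) :
    ∀ u ∈ wordSpan φ v, φ (Uq.K T q μ) u ∈ wordSpan φ v :=
  apply_mem_of_fWord fun w => by
    rw [fWord_mem_weightSpace hv w μ]
    exact Submodule.smul_mem _ _ (fWord_mem_wordSpan w)

section Content

variable [DecidableEq I]

theorem F_mem_contentSpan {b : I → ℤ} {u : M} (hu : u ∈ contentSpan φ v b) (i : I) :
    φ (Uq.F T q i) u ∈ contentSpan φ v (b + Pi.single i 1) := by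
  suffices h : contentSpan φ v b ≤ (contentSpan φ v (b + Pi.single i 1)).comap (φ (Uq.F T q i)) from
    h hu
  rw [contentSpan, Submodule.span_le]
  rintro _ ⟨w, hw, rfl⟩
  refine Submodule.subset_span ⟨i :: w, fun j => ?_, fWord_cons _ _ _⟩
  rw [List.count_cons, Pi.add_apply, ← hw j]
  by_cases h : i = j
  · subst h; simp
  · simp [h, Ne.symm h]

/-- Moving E_i to the right through a word, it commutes with F_j for j ≠ i, contributes a scalar in
place of each F_i it meets, and finally kills v. Contents are ℤ-valued so that subtraction makes
sense: a content with a negative entry is that of no word and has zero span. -/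
theorem E_mem_contentSpan (hv : IsHighestWeight φ lam v) {b : I → ℤ} {u : M}
    (hu : u ∈ contentSpan φ v b) (i : I) :
    φ (Uq.E T q i) u ∈ contentSpan φ v (b - Pi.single i 1) := by
  suffices h : contentSpan φ v b ≤ (contentSpan φ v (b - Pi.single i 1)).comap (φ (Uq.E T q i)) from
    h hu
  rw [contentSpan, Submodule.span_le]
  rintro _ ⟨w, hw, rfl⟩
  clear hu
  rw [SetLike.mem_coe, Submodule.mem_comap]
  dsimp only
  induction w generalizing b with
  | nil => rw [fWord_nil, hv.E_apply]; exact zero_mem _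
  | cons j w ih =>
    have hc : ∀ l, (w.count l : ℤ) = (b - Pi.single j 1 : I → ℤ) l := by
      intro l
      rw [Pi.sub_apply, ← hw l, List.count_cons]
      by_cases h : j = l
      · subst h; simp
      · simp [h, Ne.symm h]
    have h1 := F_mem_contentSpan (ih hc) j
    rw [show b - Pi.single j 1 - Pi.single i 1 + Pi.single j 1 = b - Pi.single i (1 : ℤ) by abel]
      at h1
    rw [fWord_cons]
    by_cases hij : i = j
    · subst hij
      rw [E_F_apply (weightSpace_le_hWeight _ i (fWord_mem_weightSpace hv.weight w))]
      exact add_mem h1 (Submodule.smul_mem _ _ (Submodule.subset_span ⟨w, hc, rfl⟩))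
    · rw [E_F_apply_of_ne hij]
      exact h1

theorem pow_E_mem_contentSpan (hv : IsHighestWeight φ lam v) {b : I → ℤ} {u : M}
    (hu : u ∈ contentSpan φ v b) (i : I) (n : ℕ) :
    (φ (Uq.E T q i) ^ n) u ∈ contentSpan φ v (b - Pi.single i (n : ℤ)) := by
  induction n with
  | zero => simpa using hu
  | succ n ih =>
    rw [pow_succ', Module.End.mul_apply]
    convert E_mem_contentSpan hv ih i using 1
    rw [sub_sub, ← Pi.single_add]
    push_cast; rfl

theorem fWord_mem_contentSpan (w : List I) :
    fWord φ w v ∈ contentSpan φ v fun i => (w.count i : ℤ) :=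
  Submodule.subset_span ⟨w, fun _ => rfl, rfl⟩

theorem exists_fWord_ne_zero {b : I → ℤ} {u : M} (hu : u ∈ contentSpan φ v b) (h0 : u ≠ 0) :
    ∃ w : List I, (∀ i, (w.count i : ℤ) = b i) ∧ fWord φ w v ≠ 0 := by
  by_contra! h
  refine h0 ((Submodule.mem_bot k).1 (Submodule.span_le.2 ?_ hu))
  rintro _ ⟨w, hw, rfl⟩
  exact h w hw

theorem sum_map_i₂ [Fintype I] (w : List I) :
    (w.map T.i₂).sum = ∑ i, (w.count i : ℤ) • T.i₂ i := by
  induction w with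
  | nil => simp
  | cons j w ih =>
    simp only [List.map_cons, List.sum_cons, ih, List.count_cons, Nat.cast_add, add_smul,
      Finset.sum_add_distrib]
    rw [add_comm]
    congr 1
    rw [Finset.sum_eq_single j]
    · simp
    · intro l _ h
      simp [Ne.symm h]
    · simp

theorem contentSpan_le_hWeight [Fintype I] (hv : v ∈ weightSpace T q φ lam) (b : I → ℤ) (i : I) :
    contentSpan φ v b ≤ hWeight φ i (T.pairing (T.i₁ i) lam - ∑ j, T.cartan i j * b j) := by
  rw [contentSpan, Submodule.span_le]
  rintro _ ⟨w, hw, rfl⟩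
  have h : T.pairing (T.i₁ i) (lam - (w.map T.i₂).sum) =
      T.pairing (T.i₁ i) lam - ∑ j, T.cartan i j * b j := by
    rw [sum_map_i₂, map_sub, map_sum]
    congr 1
    refine Finset.sum_congr rfl fun j _ => ?_
    rw [← hw j, map_smul, T.pairing_eq, RootDatum.cartan, smul_eq_mul, mul_comm]
  rw [← h]
  exact weightSpace_le_hWeight _ i (fWord_mem_weightSpace hv w)

end Content

theorem E_mem_wordSpan (hv : IsHighestWeight φ lam v) (i : I) :
    ∀ u ∈ wordSpan φ v, φ (Uq.E T q i) u ∈ wordSpan φ v :=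
  apply_mem_of_fWord fun w => by
    classical
    refine Submodule.span_mono ?_ (E_mem_contentSpan hv (fWord_mem_contentSpan w) i)
    exact Set.image_subset_range _ _

theorem apply_mem_wordSpan (hv : IsHighestWeight φ lam v) (u : Uq T q) :
    ∀ w ∈ wordSpan φ v, φ u w ∈ wordSpan φ v := by
  have hu : u ∈ Algebra.adjoin k _ := (Uq.adjoin_generators T q).ge Algebra.mem_top
  refine adjoin_apply_mem ?_ hu
  rintro _ ((⟨i, rfl⟩ | ⟨i, rfl⟩) | ⟨μ, rfl⟩)
  · exact E_mem_wordSpan hv i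
  · exact F_mem_wordSpan i
  · exact K_mem_wordSpan hv.weight μ

/-- Each E_i lowers the i-th content by one, and no word contains a letter a negative number of
times. -/
theorem E_nilpotent (hv : IsHighestWeight φ lam v) (i : I) :
    wordSpan φ v ≤ nilVectors (φ (Uq.E T q i)) := by
  classical
  refine wordSpan_le.2 fun w => ⟨w.count i + 1, ?_⟩
  by_contra h
  obtain ⟨w', hw', -⟩ := exists_fWord_ne_zero
    (pow_E_mem_contentSpan hv (fWord_mem_contentSpan w) i (w.count i + 1)) h
  have := hw' i
  simp at this

/-- Nilpotency need only be known on the generating vector: by the Serre relation, applying F_j with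
j ≠ i does not destroy local F_i-nilpotency. -/
theorem F_nilpotent {i : I} (hF : v ∈ nilVectors (φ (Uq.F T q i))) :
    wordSpan φ v ≤ nilVectors (φ (Uq.F T q i)) := by
  refine wordSpan_le.2 fun w => ?_
  induction w with
  | nil => exact hF
  | cons j w ih =>
    rw [fWord_cons]
    by_cases hij : i = j
    · subst hij; rwa [apply_mem_nilVectors]
    · refine nilVectors_stable_of_serre (p := q ^ T.c i) (N := T.serreDeg i j) ?_ ih
      rw [← serre_map, (Uq.satisfiesRelations T q).serre_F i j hij, map_zero]

theorem wordSpan_weights (hv : v ∈ weightSpace T q φ lam) :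
    wordSpan φ v = ⨆ μ : X, weightSpace T q φ μ ⊓ wordSpan φ v := by
  refine le_antisymm (wordSpan_le.2 fun w => ?_) (iSup_le fun _ => inf_le_right)
  exact Submodule.mem_iSup_of_mem _ ⟨fWord_mem_weightSpace hv w, fWord_mem_wordSpan w⟩

theorem isIntegrableSubmodule_wordSpan (hv : IsHighestWeight φ lam v)
    (hF : ∀ i, v ∈ nilVectors (φ (Uq.F T q i))) :
    IsIntegrableSubmodule T q φ (wordSpan φ v) where
  stable := apply_mem_wordSpan hv
  weights := wordSpan_weights hv.weight
  E_nilpotent i w hw := by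
    obtain ⟨n, hn⟩ := E_nilpotent hv i hw
    exact ⟨n, fun m hm => by rw [map_pow]; exact pow_apply_eq_zero_of_le hm hn⟩
  F_nilpotent i w hw := by
    obtain ⟨n, hn⟩ := F_nilpotent (hF i) hw
    exact ⟨n, fun m hm => by rw [map_pow]; exact pow_apply_eq_zero_of_le hm hn⟩

end Weights

/-! ### Combinatorics of the root lattice: bounding the weights. -/

section WeightBound

variable {I Y X : Type*} [AddCommGroup Y] [AddCommGroup X] {T : RootDatum I Y X}

/-- The vertex `i` lies in a component of the Dynkin diagram where `n` is positive somewhere. -/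
def RootDatum.Linked (T : RootDatum I Y X) (n : I → ℤ) (i : I) : Prop :=
  ∃ i₀, 0 < n i₀ ∧ Relation.ReflTransGen (fun a b => T.form a b ≠ 0) i₀ i

/-- Induction along paths of the Dynkin diagram. The relation `form a b ≠ 0` also allows the
constant steps a = b, which are discarded here. -/
theorem RootDatum.Linked.induction {n : I → ℤ} {P : I → Prop} (h0 : ∀ i, 0 < n i → P i)
    (h1 : ∀ i j, T.Linked n i → P i → i ≠ j → T.form i j ≠ 0 → P j) {i : I} (hi : T.Linked n i) :
    P i := by
  obtain ⟨i₀, hi₀, h⟩ := hi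
  induction h with
  | refl => exact h0 _ hi₀
  | @tail a b hab hb ih =>
    by_cases hne : a = b
    · exact hne ▸ ih
    · exact h1 a b ⟨i₀, hi₀, hab⟩ ih hne hb

variable [Fintype I]

/-- The quadratic form on the root lattice. -/
def RootDatum.quadForm (T : RootDatum I Y X) (b : I → ℤ) : ℤ := ∑ i, b i * ∑ j, T.form i j * b j

theorem RootDatum.c_mul_sum_cartan (b : I → ℤ) (i : I) :
    T.c i * ∑ j, T.cartan i j * b j = ∑ j, T.form i j * b j := by
  simp only [Finset.mul_sum, ← mul_assoc, T.c_mul_cartan]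

/-- For p = n_i - (C b)_i the added terms equal 2 c_i n_i p. Thus b·b - 2 ∑ c_i n_i b_i is unchanged
by the i-th simple reflection of the weight λ - ∑ b_j α_j. -/
theorem RootDatum.quadForm_add_single [DecidableEq I] (b : I → ℤ) (i : I) (p : ℤ) :
    T.quadForm (b + Pi.single i p) =
      T.quadForm b + 2 * p * ∑ j, T.form i j * b j + p ^ 2 * T.form i i := by
  have h1 : ∀ a, ∑ j, T.form a j * (b + Pi.single i p : I → ℤ) j =
      (∑ j, T.form a j * b j) + T.form a i * p := fun a => by
    simp [mul_add, Finset.sum_add_distrib, Pi.single_apply]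
  have h2 : ∑ a, b a * (T.form a i * p) = p * ∑ j, T.form i j * b j := by
    rw [Finset.mul_sum]
    refine Finset.sum_congr rfl fun a _ => ?_
    rw [T.form_symm a i]; ring
  simp only [RootDatum.quadForm, h1]
  simp only [Pi.add_apply, add_mul, mul_add, Finset.sum_add_distrib, h2, Pi.single_apply, ite_mul,
    zero_mul, Finset.sum_ite_eq', Finset.mem_univ, if_true]
  ring

/-- For μ = λ - ∑ b_j α_j this is the inequality |μ|² ≤ |λ|². While μ is negative on some coroot,
reflecting there preserves the difference of the two sides and decreases ∑ b_i, which stays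
nonnegative on R; so the process stops. At a dominant μ one has (C b)_i ≤ n_i, and even b·b ≤ ∑ c_i
n_i b_i holds termwise. -/
theorem RootDatum.quadForm_le [DecidableEq I] {n : I → ℤ} (hn : ∀ i, 0 ≤ n i)
    {R : Set (I → ℤ)} (hR0 : ∀ b ∈ R, ∀ i, 0 ≤ b i)
    (hR : ∀ b ∈ R, ∀ i, n i - ∑ j, T.cartan i j * b j < 0 →
      b + Pi.single i (n i - ∑ j, T.cartan i j * b j) ∈ R) {b : I → ℤ} (hb : b ∈ R) :
    T.quadForm b ≤ 2 * ∑ i, T.c i * n i * b i := by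
  induction hs : (∑ i, b i).toNat using Nat.strong_induction_on generalizing b with
  | _ s ih =>
    by_cases h : ∀ i, 0 ≤ n i - ∑ j, T.cartan i j * b j
    · have h1 : T.quadForm b ≤ ∑ i, T.c i * n i * b i := by
        refine Finset.sum_le_sum fun i _ => ?_
        rw [mul_comm (b i), ← RootDatum.c_mul_sum_cartan]
        refine mul_le_mul_of_nonneg_right ?_ (hR0 b hb i)
        exact mul_le_mul_of_nonneg_left (by linarith [h i]) (RootDatum.c_pos i).le
      have h2 : 0 ≤ ∑ i, T.c i * n i * b i := Finset.sum_nonneg fun i _ =>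
        mul_nonneg (mul_nonneg (RootDatum.c_pos i).le (hn i)) (hR0 b hb i)
      linarith
    · push Not at h
      obtain ⟨i, hi⟩ := h
      have hb' := hR b hb i hi
      have hC := RootDatum.c_mul_sum_cartan (T := T) b i
      have hc := T.c_eq i
      obtain ⟨p, hp⟩ : ∃ p, p = n i - ∑ j, T.cartan i j * b j := ⟨_, rfl⟩
      rw [← hp] at hi hb'
      have hsum : ∑ a, (b + Pi.single i p : I → ℤ) a = ∑ a, b a + p := by
        simp [Finset.sum_add_distrib]
      have hnn : 0 ≤ ∑ a, (b + Pi.single i p : I → ℤ) a := Finset.sum_nonneg fun a _ => hR0 _ hb' a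
      have h1 := ih (∑ a, (b + Pi.single i p : I → ℤ) a).toNat (by omega) hb' rfl
      have h2 : ∑ a, T.c a * n a * (b + Pi.single i p : I → ℤ) a =
          (∑ a, T.c a * n a * b a) + T.c i * n i * p := by
        simp [mul_add, Finset.sum_add_distrib, Pi.single_apply]
      rw [RootDatum.quadForm_add_single, h2, ← hC, ← hc] at h1
      have h3 : ∑ j, T.cartan i j * b j = n i - p := by linarith
      rw [h3] at h1
      linarith

/-- If m_i = 0, every term of the i-th row sum is nonpositive, which is impossible when n_i > 0. If
moreover a neighbour of i has a positive entry of m, the sum is strictly negative, contradicting n_i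
≥ 0. So positivity spreads along edges. -/
theorem RootDatum.pos_of_linked {n m : I → ℤ} (hn : ∀ i, 0 ≤ n i) (hm0 : ∀ i, 0 ≤ m i)
    (hm : ∀ i, n i ≤ ∑ j, T.cartan i j * m j) {i : I} (hi : T.Linked n i) : 0 < m i := by
  have hm' : ∀ i, T.c i * n i ≤ ∑ j, T.form i j * m j := fun i => by
    rw [← RootDatum.c_mul_sum_cartan]
    exact mul_le_mul_of_nonneg_left (hm i) (RootDatum.c_pos i).le
  have hterm : ∀ i, m i = 0 → ∀ j, T.form i j * m j ≤ 0 := fun i h0 j => by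
    by_cases hij : i = j
    · subst hij; simp [h0]
    · exact mul_nonpos_of_nonpos_of_nonneg (T.form_nonpos i j hij) (hm0 j)
  refine RootDatum.Linked.induction (P := fun i => 0 < m i) (fun i hi => ?_)
    (fun i j _ hi hne hij => ?_) hi
  · by_contra h
    have h0 : m i = 0 := le_antisymm (not_lt.1 h) (hm0 i)
    have h1 := Finset.sum_nonpos fun j (_ : j ∈ Finset.univ) => hterm i h0 j
    have := mul_pos (RootDatum.c_pos (T := T) i) hi
    linarith [hm' i]
  · by_contra h
    have h0 : m j = 0 := le_antisymm (not_lt.1 h) (hm0 j)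
    have h1 : ∑ l, T.form j l * m l < 0 := by
      refine Finset.sum_neg' (fun l _ => hterm j h0 l) ⟨i, Finset.mem_univ _, ?_⟩
      refine mul_neg_of_neg_of_pos ?_ hi
      exact lt_of_le_of_ne (T.form_nonpos j i hne.symm) (by rwa [T.form_symm])
    have := mul_nonneg (RootDatum.c_pos (T := T) j).le (hn j)
    linarith [hm' j]

/-- The classical expression of a symmetric form in terms of a vector `m`. -/
theorem RootDatum.sum_form_eq (m t : I → ℚ) :
    ∑ i, ∑ j, (T.form i j : ℚ) * (m i * t i) * (m j * t j) =
      ∑ i, (∑ j, (T.form i j : ℚ) * m j) * m i * t i ^ 2 -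
        (∑ i, ∑ j, (T.form i j : ℚ) * m i * m j * (t i - t j) ^ 2) / 2 := by
  have h1 : ∑ i, (∑ j, (T.form i j : ℚ) * m j) * m i * t i ^ 2 =
      ∑ i, ∑ j, (T.form i j : ℚ) * m i * m j * t i ^ 2 := by
    refine Finset.sum_congr rfl fun i _ => ?_
    rw [Finset.sum_mul, Finset.sum_mul]
    exact Finset.sum_congr rfl fun j _ => by ring
  have h2 : ∑ i, ∑ j, (T.form i j : ℚ) * m i * m j * t i ^ 2 =
      ∑ i, ∑ j, (T.form i j : ℚ) * m i * m j * t j ^ 2 := by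
    rw [Finset.sum_comm]
    refine Finset.sum_congr rfl fun i _ => Finset.sum_congr rfl fun j _ => ?_
    rw [T.form_symm]; ring
  have h3 : ∑ i, ∑ j, (T.form i j : ℚ) * m i * m j * (t i - t j) ^ 2 =
      ∑ i, ∑ j, (T.form i j : ℚ) * m i * m j * t i ^ 2 +
      ∑ i, ∑ j, (T.form i j : ℚ) * m i * m j * t j ^ 2 -
      2 * ∑ i, ∑ j, (T.form i j : ℚ) * (m i * t i) * (m j * t j) := by
    simp only [Finset.mul_sum, ← Finset.sum_add_distrib, ← Finset.sum_sub_distrib]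
    exact Finset.sum_congr rfl fun i _ => Finset.sum_congr rfl fun j _ => by ring
  rw [h3, h1, h2]
  ring

/-- Put b_i = m_i t_i and a_i = ∑ form_{ij} m_j, so that a_i ≥ c_i n_i ≥ 0. With `sum_form_eq`, the
inequality `quadForm_le` becomes ∑ a_i m_i (t_i - 1)² - ½ ∑ form_{ij} m_i m_j (t_i - t_j)² ≤ ∑ a_i
m_i. The diagonal differences vanish and off-diagonal form values are nonpositive, so the left side
is a sum of nonnegative terms. The first sum bounds t_i where n_i > 0, the second bounds t_j - t_i
along an edge, and unlinked entries of b are zero. -/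
theorem RootDatum.bounded_of_reflection [DecidableEq I] {n m : I → ℤ} (hn : ∀ i, 0 ≤ n i)
    (hm0 : ∀ i, 0 ≤ m i) (hm : ∀ i, n i ≤ ∑ j, T.cartan i j * m j) {R : Set (I → ℤ)}
    (hR0 : ∀ b ∈ R, ∀ i, 0 ≤ b i) (hRs : ∀ b ∈ R, ∀ i, b i ≠ 0 → T.Linked n i)
    (hR : ∀ b ∈ R, ∀ i, n i - ∑ j, T.cartan i j * b j < 0 →
      b + Pi.single i (n i - ∑ j, T.cartan i j * b j) ∈ R) :
    ∃ B : ℕ, ∀ b ∈ R, ∀ i, b i ≤ B := by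
  obtain ⟨a, ha⟩ : ∃ a : I → ℚ, ∀ i, a i = ∑ j, (T.form i j : ℚ) * m j := ⟨_, fun _ => rfl⟩
  have hν : ∀ i, ((T.c i * n i : ℤ) : ℚ) ≤ a i := fun i => by
    have : T.c i * n i ≤ ∑ j, T.form i j * m j := by
      rw [← RootDatum.c_mul_sum_cartan]
      exact mul_le_mul_of_nonneg_left (hm i) (RootDatum.c_pos i).le
    rw [ha]; exact_mod_cast this
  have hν0 : ∀ i, 0 ≤ T.c i * n i := fun i => mul_nonneg (RootDatum.c_pos i).le (hn i)
  have ha0 : ∀ i, 0 ≤ a i := fun i => le_trans (by exact_mod_cast hν0 i) (hν i)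
  have hmq : ∀ i, (0 : ℚ) ≤ m i := fun i => by exact_mod_cast hm0 i
  have hG0 : ∀ (t : I → ℚ) (i j : I),
      (T.form i j : ℚ) * m i * m j * (t i - t j) ^ 2 ≤ 0 := fun t i j => by
    by_cases hij : i = j
    · subst hij; simp
    · refine mul_nonpos_of_nonpos_of_nonneg (mul_nonpos_of_nonpos_of_nonneg
        (mul_nonpos_of_nonpos_of_nonneg ?_ (hmq i)) (hmq j)) (sq_nonneg _)
      exact_mod_cast T.form_nonpos i j hij
  obtain ⟨K, hK⟩ : ∃ K, K = ∑ i, a i * m i := ⟨_, rfl⟩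
  have key : ∀ b ∈ R, ∑ i, a i * m i * ((b i : ℚ) / m i - 1) ^ 2 -
      (∑ i, ∑ j, (T.form i j : ℚ) * m i * m j * ((b i : ℚ) / m i - b j / m j) ^ 2) / 2 ≤ K := by
    intro b hb
    -- Division by m_i = 0 does no harm: b_i ≠ 0 makes i linked and hence m_i > 0, and otherwise
    -- both sides are zero.
    have hbm : ∀ i, (b i : ℚ) = m i * ((b i : ℚ) / m i) := fun i => by
      by_cases h : b i = 0
      · simp [h]
      · have := (RootDatum.pos_of_linked hn hm0 hm (hRs b hb i h)).ne'
        field_simp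
    have ht0 : ∀ i, 0 ≤ (b i : ℚ) / m i := fun i =>
      div_nonneg (by exact_mod_cast hR0 b hb i) (hmq i)
    obtain ⟨t, ht⟩ : ∃ t : I → ℚ, ∀ i, t i = (b i : ℚ) / m i := ⟨_, fun _ => rfl⟩
    simp only [← ht] at hbm ht0 ⊢
    have h1 : ((T.quadForm b : ℤ) : ℚ) ≤ 2 * ∑ i, a i * m i * t i := by
      have h := RootDatum.quadForm_le hn hR0 hR hb
      have h' : ((T.quadForm b : ℤ) : ℚ) ≤ 2 * ∑ i, ((T.c i * n i : ℤ) : ℚ) * b i := by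
        exact_mod_cast h
      refine h'.trans ?_
      refine mul_le_mul_of_nonneg_left (Finset.sum_le_sum fun i _ => ?_) (by norm_num)
      rw [hbm i, ← mul_assoc]
      exact mul_le_mul_of_nonneg_right (mul_le_mul_of_nonneg_right (hν i) (hmq i)) (ht0 i)
    have h2 : ((T.quadForm b : ℤ) : ℚ) =
        ∑ i, ∑ j, (T.form i j : ℚ) * (m i * t i) * (m j * t j) := by
      rw [RootDatum.quadForm]
      push_cast
      refine Finset.sum_congr rfl fun i _ => ?_
      rw [Finset.mul_sum]
      refine Finset.sum_congr rfl fun j _ => ?_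
      rw [hbm i, hbm j]; ring
    rw [h2, RootDatum.sum_form_eq (fun i => (m i : ℚ))] at h1
    simp only [← ha] at h1
    have h3 : ∑ i, a i * m i * (t i - 1) ^ 2 =
        ∑ i, a i * m i * t i ^ 2 - 2 * ∑ i, a i * m i * t i + K := by
      rw [hK, Finset.mul_sum, ← Finset.sum_sub_distrib, ← Finset.sum_add_distrib]
      exact Finset.sum_congr rfl fun i _ => by ring
    rw [h3]
    linarith
  have hA0 : ∀ (t : I → ℚ) (i : I), 0 ≤ a i * m i * (t i - 1) ^ 2 := fun t i =>
    mul_nonneg (mul_nonneg (ha0 i) (hmq i)) (sq_nonneg _)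
  -- A crude bound that avoids square roots; it explains the constants K + 2 and 2 K + 1 below.
  have hsq : ∀ x L : ℚ, 0 ≤ L → x ^ 2 ≤ L → x ≤ L + 1 := fun x L hL h => by nlinarith
  have hK0 : 0 ≤ K := hK ▸ Finset.sum_nonneg fun i _ => mul_nonneg (ha0 i) (hmq i)
  have hone : ∀ z : ℤ, 0 < z → (1 : ℚ) ≤ z := fun z hz => by exact_mod_cast hz
  have hlinked : ∀ i, T.Linked n i → ∃ B : ℚ, ∀ b ∈ R, (b i : ℚ) / m i ≤ B := by
    intro i hi
    refine RootDatum.Linked.induction (P := fun i => ∃ B : ℚ, ∀ b ∈ R, (b i : ℚ) / m i ≤ B)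
      (fun i hi => ?_) (fun i j hi ih hne hij => ?_) hi
    -- Here a_i m_i ≥ 1, so the single term at i gives (t_i - 1)² ≤ K.
    · refine ⟨K + 2, fun b hb => ?_⟩
      have h1 := key b hb
      have h2 : ∑ i, ∑ j, (T.form i j : ℚ) * m i * m j * ((b i : ℚ) / m i - b j / m j) ^ 2 ≤ 0 :=
        Finset.sum_nonpos fun i _ => Finset.sum_nonpos fun j _ => hG0 (fun i => b i / m i) i j
      have h3 : a i * m i * ((b i : ℚ) / m i - 1) ^ 2 ≤
          ∑ i, a i * m i * ((b i : ℚ) / m i - 1) ^ 2 :=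
        Finset.single_le_sum (f := fun i => a i * m i * ((b i : ℚ) / m i - 1) ^ 2)
          (fun i _ => hA0 (fun i => b i / m i) i) (Finset.mem_univ i)
      have h4 : 1 ≤ a i * m i := by
        have h5 := (hone _ (mul_pos (RootDatum.c_pos (T := T) i) hi)).trans (hν i)
        have h6 := hone _ (RootDatum.pos_of_linked hn hm0 hm ⟨i, hi, .refl⟩)
        nlinarith
      have h5 : ((b i : ℚ) / m i - 1) ^ 2 ≤ a i * m i * ((b i : ℚ) / m i - 1) ^ 2 :=
        le_mul_of_one_le_left (sq_nonneg _) h4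
      linarith [hsq ((b i : ℚ) / m i - 1) K hK0 (by linarith)]
    · obtain ⟨B, hB⟩ := ih
      -- The coefficient form_{ji} m_j m_i is at most -1, so the term at (j, i) alone gives (t_j -
      -- t_i)² ≤ 2 K.
      refine ⟨B + (2 * K + 1), fun b hb => ?_⟩
      have h1 := key b hb
      have h2 : 0 ≤ ∑ i, a i * m i * ((b i : ℚ) / m i - 1) ^ 2 :=
        Finset.sum_nonneg fun i _ => hA0 (fun i => b i / m i) i
      have h3 : ∑ i, ∑ j, (T.form i j : ℚ) * m i * m j * ((b i : ℚ) / m i - b j / m j) ^ 2 ≤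
          (T.form j i : ℚ) * m j * m i * ((b j : ℚ) / m j - b i / m i) ^ 2 := by
        have h4 := fun i j => neg_nonneg.2 (hG0 (fun i => b i / m i) i j)
        have h5 := Finset.single_le_sum (f := fun i => ∑ j, -((T.form i j : ℚ) * m i * m j *
          ((b i : ℚ) / m i - b j / m j) ^ 2)) (fun i _ => Finset.sum_nonneg fun j _ => h4 i j)
          (Finset.mem_univ j)
        have h6 := Finset.single_le_sum (f := fun l => -((T.form j l : ℚ) * m j * m l *
          ((b j : ℚ) / m j - b l / m l) ^ 2)) (fun l _ => h4 j l) (Finset.mem_univ i)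
        simp only [Finset.sum_neg_distrib] at h5 h6
        linarith
      have hform : (T.form j i : ℚ) ≤ -1 := by
        have h4 := T.form_nonpos j i hne.symm
        rw [T.form_symm] at hij
        have : T.form j i ≤ -1 := by omega
        exact_mod_cast this
      have hmi := hone _ (RootDatum.pos_of_linked hn hm0 hm hi)
      have hmj := hone _ (RootDatum.pos_of_linked hn hm0 hm (i := j) (by
        obtain ⟨i₀, h0, h⟩ := hi
        exact ⟨i₀, h0, h.tail hij⟩))
      have h4 : (T.form j i : ℚ) * m j * m i ≤ -1 := by
        have h5 : (1 : ℚ) ≤ m j * m i := by nlinarith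
        rw [mul_assoc]
        nlinarith
      have h5 := mul_le_mul_of_nonneg_right h4 (sq_nonneg ((b j : ℚ) / m j - b i / m i))
      linarith [hsq ((b j : ℚ) / m j - b i / m i) (2 * K) (by linarith) (by linarith), hB b hb]
  have hall : ∀ i, ∃ B : ℕ, ∀ b ∈ R, b i ≤ B := by
    intro i
    by_cases hi : T.Linked n i
    · obtain ⟨B, hB⟩ := hlinked i hi
      obtain ⟨N, hN⟩ := exists_nat_ge (B * m i)
      refine ⟨N, fun b hb => ?_⟩
      have hmi : (0 : ℚ) < m i := by exact_mod_cast RootDatum.pos_of_linked hn hm0 hm hi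
      have := ((div_le_iff₀ hmi).1 (hB b hb)).trans hN
      exact_mod_cast this
    · refine ⟨0, fun b hb => ?_⟩
      by_contra h
      exact hi (hRs b hb i (by simp at h; omega))
  choose B hB using hall
  refine ⟨∑ i, B i, fun b hb i => (hB i b hb).trans ?_⟩
  exact_mod_cast Finset.single_le_sum (fun i _ => Nat.zero_le (B i)) (Finset.mem_univ i)

end WeightBound

/-- An integer-valued function on a finite type whose positive values are taken at most as often
as their negatives has nonpositive sum. -/
theorem sum_nonpos_of_card_fiber_le {κ : Type*} [Fintype κ] (p : κ → ℤ)
    (h : ∀ t : ℕ, Fintype.card {b // p b = t} ≤ Fintype.card {b // p b = -t}) : ∑ b, p b ≤ 0 := by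
  obtain ⟨N, hN⟩ : ∃ N : ℤ → ℤ, ∀ t, N t = Fintype.card {b // p b = t} := ⟨_, fun _ => rfl⟩
  obtain ⟨B, hB⟩ : ∃ B, B = ∑ b, |p b| := ⟨_, rfl⟩
  have hmem : ∀ b ∈ Finset.univ, p b ∈ Finset.Icc (-B) B := fun b hb => by
    rw [Finset.mem_Icc, ← abs_le, hB]
    exact Finset.single_le_sum (f := fun b => |p b|) (fun b _ => abs_nonneg _) hb
  have h1 : ∑ b, p b = ∑ t ∈ Finset.Icc (-B) B, N t * t := by
    rw [← Finset.sum_fiberwise_of_maps_to hmem]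
    refine Finset.sum_congr rfl fun t _ => ?_
    rw [Finset.sum_congr rfl (g := fun _ => t) (by simp), Finset.sum_const, hN,
      Fintype.card_subtype, nsmul_eq_mul]
  -- Adding the sum to its reindexing by t ↦ -t pairs the fibre over t with the fibre over -t, and
  -- each paired term is nonpositive.
  have h2 : ∑ t ∈ Finset.Icc (-B) B, N t * t = ∑ t ∈ Finset.Icc (-B) B, N (-t) * -t := by
    refine Finset.sum_nbij' (fun t => -t) (fun t => -t) ?_ ?_ ?_ ?_ ?_ <;>
      simp +contextual [neg_le]
  have hN' : ∀ t, 0 ≤ t → N t ≤ N (-t) := fun t ht => by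
    lift t to ℕ using ht
    rw [hN, hN]
    exact_mod_cast h t
  have h3 : ∑ t ∈ Finset.Icc (-B) B, (N t * t + N (-t) * -t) ≤ 0 := by
    refine Finset.sum_nonpos fun t _ => ?_
    rcases le_total 0 t with ht | ht
    · nlinarith [hN' t ht]
    · have := hN' (-t) (by omega)
      rw [neg_neg] at this
      nlinarith
  rw [Finset.sum_add_distrib, ← h2] at h3
  omega

/-! ### From finite-dimensionality to C m ≥ n and back. -/

section FiniteDimensional

variable {k : Type*} [Field k] {I Y X : Type*} [AddCommGroup Y] [AddCommGroup X]
  {T : RootDatum I Y X} {q : kˣ} {M : Type*} [AddCommGroup M] [Module k M]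
  {φ : Uq T q →ₐ[k] Module.End k M} {lam : X} {v : M}

theorem pow_F_mem_hWeight {i : I} {p : ℤ} {u : M} (hu : u ∈ hWeight φ i p) (n : ℕ) :
    (φ (Uq.F T q i) ^ n) u ∈ hWeight φ i (p - 2 * n) := by
  induction n with
  | zero => simpa using hu
  | succ n ih =>
    rw [pow_succ', Module.End.mul_apply]
    convert F_mem_hWeight ih using 2
    push_cast; ring

theorem pow_E_apply_ne_zero (hq : ∀ n : ℕ, 0 < n → q ^ n ≠ 1) {i : I} {m : ℕ} {u : M}
    (hu : u ∈ hWeight φ i (-m)) (h0 : u ≠ 0) (hF : u ∈ nilVectors (φ (Uq.F T q i))) :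
    (φ (Uq.E T q i) ^ m) u ≠ 0 := by
  obtain ⟨N, hN⟩ := hF
  exact pow_apply_ne_zero (Wt := hWeight φ i) hq (RootDatum.c_pos (T := T) i).ne'
    (fun _ _ => E_mem_hWeight) (fun _ _ => F_mem_hWeight) (fun _ _ => E_F_apply) N m hu h0 hN

theorem pow_F_apply_ne_zero (hq : ∀ n : ℕ, 0 < n → q ^ n ≠ 1) {i : I} {m : ℕ} {u : M}
    (hu : u ∈ hWeight φ i m) (h0 : u ≠ 0) (hE : u ∈ nilVectors (φ (Uq.E T q i))) :
    (φ (Uq.F T q i) ^ m) u ≠ 0 := by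
  obtain ⟨N, hN⟩ := hE
  exact pow_apply_ne_zero' (Wt := hWeight φ i) hq (RootDatum.c_pos (T := T) i).ne'
    (fun _ _ => E_mem_hWeight) (fun _ _ => F_mem_hWeight) (fun _ _ => E_F_apply) N m hu h0 hN

/-- As q is not a root of unity, different p give different eigenvalues of H_i. Each coordinate
functional of a weight basis is an eigenvector of the transpose of H_i, so an eigenvector involves
only basis vectors of its own weight. -/
theorem finrank_hWeight (hq : ∀ n : ℕ, 0 < n → q ^ n ≠ 1) {κ : Type*} [Fintype κ]
    (β : Module.Basis κ k M) {i : I} {p : κ → ℤ} (hβ : ∀ b, β b ∈ hWeight φ i (p b)) (t : ℤ) :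
    Module.finrank k (hWeight φ i t) = Fintype.card {b // p b = t} := by
  have h1 : hWeight φ i t = Submodule.span k (Set.range fun b : {b // p b = t} => β b) := by
    apply le_antisymm
    · intro x hx
      have hr : (Set.range fun b : {b // p b = t} => β b) = β '' {b | p b = t} := by
        ext; simp
      rw [hr, Module.Basis.mem_span_image]
      intro b hb
      by_contra hne
      have h2 : β.coord b ∘ₗ φ (Uq.H T q i) = qz q (T.c i * p b) • β.coord b := by
        refine β.ext fun b' => ?_
        rw [LinearMap.comp_apply, mem_hWeight.1 (hβ b'), map_smul, LinearMap.smul_apply,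
          β.coord_apply, β.repr_self]
        by_cases h : b' = b
        · rw [h]
        · simp [h]
      have h3 := congrArg (fun f : M →ₗ[k] k => f x) h2
      simp only [LinearMap.comp_apply, mem_hWeight.1 hx, map_smul, LinearMap.smul_apply,
        smul_eq_mul, β.coord_apply] at h3
      have h4 := mul_right_cancel₀ (by simpa using hb) h3
      have h5 := mul_left_cancel₀ (RootDatum.c_pos i).ne' (qz_injective hq h4)
      exact hne h5.symm
    · rw [Submodule.span_le]
      rintro _ ⟨⟨b, rfl⟩, rfl⟩
      exact hβ b
  rw [h1, finrank_span_eq_card]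
  exact β.linearIndependent.comp _ Subtype.val_injective

/-- A nonzero finite-dimensional module generated by a highest weight vector of dominant weight
`lam` yields a nonnegative vector `m` with `C m ≥ lam`. -/
theorem exists_cartan_ge [Fintype I] (hq : ∀ n : ℕ, 0 < n → q ^ n ≠ 1)
    [FiniteDimensional k M] [Nontrivial M] (hv : IsHighestWeight φ lam v) (htop : wordSpan φ v = ⊤)
    (hn : ∀ i, 0 ≤ T.pairing (T.i₁ i) lam) :
    ∃ m : I → ℤ, (∀ i, 0 ≤ m i) ∧ ∀ i, T.pairing (T.i₁ i) lam ≤ ∑ j, T.cartan i j * m j := by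
  classical
  -- A basis consisting of words F_{j₁} ⋯ F_{jᵣ} v, so that every basis vector has a definite
  -- content.
  obtain ⟨s, hs, hspan, hli⟩ := exists_linearIndependent k (Set.range fun w => fWord φ w v)
  have := hli.finite
  have := Fintype.ofFinite s
  have hβ : ⊤ ≤ Submodule.span k (Set.range ((↑) : s → M)) := by
    rw [Subtype.range_coe, hspan, ← wordSpan, htop]
  let β := Module.Basis.mk hli hβ
  choose w hw using fun b : s => hs b.2
  have hβw : ∀ b, β b = fWord φ (w b) v := fun b => by
    rw [Module.Basis.mk_apply]; exact (hw b).symm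
  have hne : Nonempty s := β.index_nonempty
  let p : I → s → ℤ := fun i b =>
    T.pairing (T.i₁ i) lam - ∑ j, T.cartan i j * ((w b).count j : ℤ)
  have hp : ∀ i b, β b ∈ hWeight φ i (p i b) := fun i b => by
    rw [hβw]
    exact contentSpan_le_hWeight hv.weight _ i (fWord_mem_contentSpan (w b))
  -- F_i^t maps the eigenspace of weight t injectively into that of weight -t, so positive weights
  -- are outnumbered by their negatives.
  have hsum : ∀ i, ∑ b, p i b ≤ 0 := fun i => by
    refine sum_nonpos_of_card_fiber_le _ fun t => ?_
    rw [← finrank_hWeight hq β (hp i), ← finrank_hWeight hq β (hp i)]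
    have hmap : ∀ x ∈ hWeight φ i t, (φ (Uq.F T q i) ^ t) x ∈ hWeight φ i (-t) := fun x hx => by
      convert pow_F_mem_hWeight hx t using 2
      ring
    refine LinearMap.finrank_le_finrank_of_injective
      (f := (φ (Uq.F T q i) ^ t).restrict hmap) ?_
    rw [← LinearMap.ker_eq_bot, LinearMap.ker_eq_bot']
    intro x hx
    by_contra h0
    refine pow_F_apply_ne_zero hq x.2 (by simpa using h0) (E_nilpotent hv i (htop ▸ trivial)) ?_
    exact congrArg Subtype.val hx
  -- The entry m_j is the total number of letters j in the basis words. The weight sum is then |s|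
  -- n_i - (C m)_i ≤ 0, and |s| ≥ 1 together with n_i ≥ 0 gives n_i ≤ (C m)_i.
  refine ⟨fun j => ∑ b, ((w b).count j : ℤ), fun j => Finset.sum_nonneg fun b _ => by positivity,
    fun i => ?_⟩
  have h1 : ∑ b, p i b = Fintype.card s * T.pairing (T.i₁ i) lam -
      ∑ j, T.cartan i j * ∑ b, ((w b).count j : ℤ) := by
    simp only [p, Finset.sum_sub_distrib, Finset.mul_sum]
    rw [Finset.sum_comm]
    simp
  have h2 : (1 : ℤ) ≤ Fintype.card s := by exact_mod_cast Fintype.card_pos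
  have h3 := hsum i
  rw [h1] at h3
  nlinarith [hn i]

/-- An unlinked letter j is not adjacent to any of the linked letters to its right, so F_j commutes
past them all and reaches v. There it gives zero, since an unlinked j has n_j = 0. -/
theorem linked_of_fWord_ne_zero {w : List I}
    (hn : ∀ i, 0 ≤ T.pairing (T.i₁ i) lam)
    (hF : ∀ i, T.pairing (T.i₁ i) lam = 0 → φ (Uq.F T q i) v = 0) (h0 : fWord φ w v ≠ 0) :
    ∀ i ∈ w, T.Linked (fun i => T.pairing (T.i₁ i) lam) i := by
  induction w with
  | nil => simp
  | cons j w ih =>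
    rw [fWord_cons] at h0
    have hw := ih fun h => h0 (by rw [h, map_zero])
    refine List.forall_mem_cons.2 ⟨?_, hw⟩
    by_contra hj
    have hcomm : ∀ i ∈ w, φ (Uq.F T q j) * φ (Uq.F T q i) = φ (Uq.F T q i) * φ (Uq.F T q j) := by
      intro i hi
      have hij : j ≠ i := fun h => hj (h ▸ hw i hi)
      have hform : T.form j i = 0 := by
        by_contra hne
        obtain ⟨i₀, h0, h1⟩ := hw i hi
        exact hj ⟨i₀, h0, h1.tail (by rwa [T.form_symm])⟩
      have h1 := (Uq.satisfiesRelations T q).serre_F j i hij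
      -- The Serre relation of degree one is exactly the commutation of F_j and F_i.
      have h2 : T.serreDeg j i = 1 := by simp [RootDatum.serreDeg, RootDatum.cartan, hform]
      rw [h2, serre, Finset.sum_range_succ, Finset.sum_range_one] at h1
      simp only [qbinom_zero_right, qbinom_self] at h1
      rw [← map_mul, ← map_mul]
      congr 1
      simpa [add_neg_eq_zero] using h1
    refine h0 ?_
    have h1 : ∀ w' : List I, (∀ i ∈ w', i ∈ w) → φ (Uq.F T q j) (fWord φ w' v) = 0 := by
      intro w' hw'
      induction w' with
      | nil =>
        refine hF j (le_antisymm (not_lt.1 fun h => hj ⟨j, h, .refl⟩) (hn j))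
      | cons i w' ih' =>
        rw [fWord_cons, ← Module.End.mul_apply, hcomm i (hw' i (by simp)), Module.End.mul_apply,
          ih' fun l hl => hw' l (by simp [hl]), map_zero]
    exact h1 w fun _ h => h

/-- An integrable highest weight module of dominant weight `lam` is finite-dimensional if
`C m ≥ lam` for some nonnegative vector `m`. -/
theorem finiteDimensional_wordSpan [Fintype I] (hq : ∀ n : ℕ, 0 < n → q ^ n ≠ 1)
    (hv : IsHighestWeight φ lam v) (hn : ∀ i, 0 ≤ T.pairing (T.i₁ i) lam)
    (hF : ∀ i, (φ (Uq.F T q i) ^ ((T.pairing (T.i₁ i) lam).toNat + 1)) v = 0) {m : I → ℤ}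
    (hm0 : ∀ i, 0 ≤ m i) (hm : ∀ i, T.pairing (T.i₁ i) lam ≤ ∑ j, T.cartan i j * m j) :
    FiniteDimensional k (wordSpan φ v) := by
  classical
  have hF0 : ∀ i, T.pairing (T.i₁ i) lam = 0 → φ (Uq.F T q i) v = 0 := fun i h => by
    simpa [h] using hF i
  have hnil : ∀ i b, contentSpan φ v b ≤ nilVectors (φ (Uq.F T q i)) := fun i b =>
    (Submodule.span_mono (Set.image_subset_range _ _)).trans (F_nilpotent ⟨_, hF i⟩)
  have hex : ∀ b, contentSpan φ v b ≠ ⊥ →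
      ∃ w : List I, (∀ i, (w.count i : ℤ) = b i) ∧ fWord φ w v ≠ 0 := fun b hb => by
    obtain ⟨u, hu, h0⟩ := Submodule.exists_mem_ne_zero_of_ne_bot hb
    exact exists_fWord_ne_zero hu h0
  -- Bounded contents mean bounded length of the words acting nontrivially on v, and there are
  -- finitely many words of bounded length.
  suffices hbound : ∃ B : ℕ, ∀ b ∈ {b | contentSpan φ v b ≠ ⊥}, ∀ i, b i ≤ B by
    obtain ⟨B, hB⟩ := hbound
    have hlen : {w : List I | fWord φ w v ≠ 0} ⊆ {w | w.length ≤ Fintype.card I * B} := by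
      intro w hw
      have h1 : ∀ i, w.count i ≤ B := fun i => by
        have h2 := hB (fun i => (w.count i : ℤ))
          (fun h => hw ((Submodule.mem_bot k).1 (h ▸ fWord_mem_contentSpan w))) i
        exact_mod_cast h2
      have h2 : w.length = ∑ i, w.count i := by
        simpa using (Multiset.sum_count_eq_card (s := Finset.univ) (m := (w : Multiset I))
          (by simp)).symm
      rw [Set.mem_ofPred_eq, h2, ← smul_eq_mul, ← Finset.card_univ]
      exact Finset.sum_le_card_nsmul _ _ _ fun i _ => h1 i
    have hfin := ((List.finite_length_le I (Fintype.card I * B)).subset hlen).image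
      fun w => fWord φ w v
    have hle : wordSpan φ v ≤ Submodule.span k
        ((fun w => fWord φ w v) '' {w : List I | fWord φ w v ≠ 0}) := by
      refine wordSpan_le.2 fun w => ?_
      by_cases h : fWord φ w v = 0
      · rw [h]; exact zero_mem _
      · exact Submodule.subset_span ⟨w, h, rfl⟩
    have := FiniteDimensional.span_of_finite k hfin
    exact Submodule.finiteDimensional_of_le hle
  refine RootDatum.bounded_of_reflection hn hm0 hm (fun b hb i => ?_) (fun b hb i hi => ?_)
    fun b hb i hi => ?_
  · obtain ⟨w, hw, -⟩ := hex b hb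
    rw [← hw]; positivity
  · obtain ⟨w, hw, h0⟩ := hex b hb
    refine linked_of_fWord_ne_zero hn hF0 h0 i ?_
    rw [← List.count_pos_iff]
    have := hw i
    omega
  -- Closure under reflection: a nonzero u of content b and weight -p is sent by E_i^p to a nonzero
  -- vector of content b - p e_i.
  · obtain ⟨u, hu, h0⟩ := Submodule.exists_mem_ne_zero_of_ne_bot hb
    obtain ⟨p, hp⟩ : ∃ p : ℕ, (p : ℤ) = -(T.pairing (T.i₁ i) lam - ∑ j, T.cartan i j * b j) :=
      ⟨_, Int.toNat_of_nonneg (by omega)⟩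
    have hwt := contentSpan_le_hWeight hv.weight b i hu
    rw [← neg_neg (T.pairing (T.i₁ i) lam - ∑ j, T.cartan i j * b j), ← hp] at hwt ⊢
    have h1 := pow_E_mem_contentSpan hv hu i p
    intro h
    rw [Pi.single_neg, ← sub_eq_add_neg] at h
    rw [h, Submodule.mem_bot] at h1
    exact pow_E_apply_ne_zero hq hwt h0 (hnil i b hu) h1

end FiniteDimensional

/-! ### The adjoint action on F_d H_d. -/

section AdjointPowers

variable {k : Type*} [Field k] {I Y X : Type*} [AddCommGroup Y] [AddCommGroup X]
  {T : RootDatum I Y X} {q : kˣ}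

/-- Conjugating F_d H_d by H_i gives the factor q^{-i·d}, which cancels the one from moving E_i
across H_d; what remains is the commutator of E_i and F_d. -/
theorem Ad_E_F_mul_H {i d : I} (h : i ≠ d) :
    Uq.Ad T q (Uq.E T q i) (Uq.F T q d * Uq.H T q d) = 0 := by
  have h1 := sub_eq_zero.1 ((Uq.satisfiesRelations T q).E_F_ne i d h)
  have h2 : Uq.H T q i * (Uq.F T q d * Uq.H T q d) * Uq.Hinv T q i =
      qz q (-T.form i d) • (Uq.F T q d * Uq.H T q d) := by
    have h3 : Uq.H T q d * Uq.Hinv T q i = Uq.Hinv T q i * Uq.H T q d := Uq.K_comm _ _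
    rw [← mul_assoc, Uq.H_mul_F, smul_mul_assoc, smul_mul_assoc, mul_assoc, h3, mul_assoc,
      ← mul_assoc (Uq.H T q i), Uq.H_mul_Hinv, one_mul]
  rw [Uq.Ad_E, h2, smul_mul_assoc, mul_assoc (Uq.F T q d), Uq.H_mul_E, mul_smul_comm, smul_smul,
    ← qz_add, T.form_symm d i, neg_add_cancel, qz_zero, one_smul, ← mul_assoc, h1, mul_assoc,
    sub_self]

theorem F_mul_H_mem_weightSpace (d : I) :
    Uq.F T q d * Uq.H T q d ∈ weightSpace T q (Uq.Ad T q) (-T.i₂ d) := by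
  intro μ
  have h : Uq.K T q μ * Uq.K T q (-μ) = 1 := by
    rw [← (Uq.satisfiesRelations T q).K_add, add_neg_cancel, (Uq.satisfiesRelations T q).K_zero]
  rw [Uq.Ad_K, ← mul_assoc, (Uq.satisfiesRelations T q).K_F, smul_mul_assoc, smul_mul_assoc,
    map_neg, mul_assoc, mul_assoc, Uq.H, ← mul_assoc (Uq.K T q μ), Uq.K_comm μ, mul_assoc, h,
    mul_one]

/-- Ad F_i is the commutator with F_i followed by right multiplication by H_i. Moving the
accumulated factor H_i^m H_d past F_i turns the commutator into a q-commutator with coefficient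
q_i^{-(C_{id} + 2m)}, which is the recursion `serreRec` at parameter q_i⁻¹. -/
theorem pow_Ad_F_apply (i d : I) (m : ℕ) :
    (Uq.Ad T q (Uq.F T q i) ^ m) (Uq.F T q d * Uq.H T q d) =
      serreRec (q ^ T.c i)⁻¹ (T.cartan i d) (Uq.F T q i) (Uq.F T q d) m *
        (Uq.H T q i ^ m * Uq.H T q d) := by
  have hHH : Uq.H T q d * Uq.H T q i = Uq.H T q i * Uq.H T q d := Uq.K_comm _ _
  have hz : ∀ n : ℤ, qz (q ^ T.c i)⁻¹ n = qz q (-(T.c i * n)) := fun n => by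
    simp [qz, zpow_mul]
  have hG : ∀ m : ℕ, Uq.H T q i ^ m * Uq.H T q d * Uq.F T q i =
      qz (q ^ T.c i)⁻¹ (T.cartan i d + 2 * m) •
        (Uq.F T q i * (Uq.H T q i ^ m * Uq.H T q d)) := by
    intro m
    have e : T.c i * (T.cartan i d + 2 * m) = T.form i d + m * T.form i i := by
      rw [mul_add, T.c_mul_cartan, ← T.c_eq]; ring
    rw [hz, e]
    induction m with
    | zero => simp [Uq.H_mul_F, T.form_symm d i]
    | succ m ih =>
      rw [pow_succ', mul_assoc, mul_assoc, ← mul_assoc (Uq.H T q i ^ m),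
        ih (by rw [mul_add, T.c_mul_cartan, ← T.c_eq]; ring), mul_smul_comm, ← mul_assoc,
        Uq.H_mul_F, smul_mul_assoc, smul_smul, ← qz_add]
      simp only [mul_assoc]
      congr 2
      push_cast; ring
  induction m with
  | zero => simp [serreRec]
  | succ m ih =>
    rw [pow_succ', Module.End.mul_apply, ih, Uq.Ad_F, serreRec, mul_assoc (serreRec _ _ _ _ m) _
      (Uq.F T q i), hG, sub_mul, sub_mul]
    have h : Uq.H T q i ^ m * Uq.H T q d * Uq.H T q i = Uq.H T q i ^ (m + 1) * Uq.H T q d := by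
      rw [mul_assoc, hHH, ← mul_assoc, ← pow_succ]
    simp only [mul_smul_comm, smul_mul_assoc]
    simp only [← h, mul_assoc]

theorem pow_serreDeg_Ad_F_apply {i d : I} (h : i ≠ d) :
    (Uq.Ad T q (Uq.F T q i) ^ T.serreDeg i d) (Uq.F T q d * Uq.H T q d) = 0 := by
  rw [pow_Ad_F_apply, ← T.serreDeg_cast h, ← serre_eq_serreRec, serre_inv,
    (Uq.satisfiesRelations T q).serre_F i d h, zero_mul]

end AdjointPowers

/-! ### V(λ'_d) as an integrable highest weight module. -/

namespace SubRootDatum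

variable {J Y' X' I Y X : Type*} [AddCommGroup Y'] [AddCommGroup X']
    [AddCommGroup Y] [AddCommGroup X] {S : RootDatum J Y' X'} {T : RootDatum I Y X}
    (σ : SubRootDatum S T) {k : Type*} [Field k] (q : kˣ)

theorem sX_ρ_sub_mem (x : X) : x - σ.sX (σ.ρ x) ∈ σ.X'' := by
  have h : σ.sX (σ.ρ x) =
      (Submodule.projectionOnto (LinearMap.range σ.sX) σ.X'' σ.isCompl x : X) := by
    rw [← LinearEquiv.ofInjective_apply (h := σ.sX_injective)]
    simp [ρ]
  rw [← Submodule.projectionOnto_apply_eq_zero_iff σ.isCompl, map_sub, h,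
    Submodule.projectionOnto_apply_left, sub_self]

/-- x and s_X(ρ x) differ by an element of X'', which is orthogonal to s_Y(Y'). This is why
restriction to U_q(S) takes the weight λ to ρ(λ). -/
theorem pairing_ρ (y : Y') (x : X) : S.pairing y (σ.ρ x) = T.pairing (σ.sY y) x := by
  have h := σ.orthogonal y _ (σ.sX_ρ_sub_mem x)
  rw [map_sub, sub_eq_zero, σ.pairing_eq] at h
  exact h.symm

theorem adRestrict_E (j : J) : σ.adRestrict q (Uq.E S q j) = Uq.Ad T q (Uq.E T q (σ.ι j)) := by
  rw [adRestrict, AlgHom.comp_apply, incl, Uq.lift_E]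

theorem adRestrict_F (j : J) : σ.adRestrict q (Uq.F S q j) = Uq.Ad T q (Uq.F T q (σ.ι j)) := by
  rw [adRestrict, AlgHom.comp_apply, incl, Uq.lift_F]

theorem adRestrict_K (ν : S.Z) : σ.adRestrict q (Uq.K S q ν) = Uq.Ad T q (Uq.K T q (σ.sZ ν)) := by
  rw [adRestrict, AlgHom.comp_apply, incl, Uq.lift_K]

theorem weightSpace_le (lam : X) :
    weightSpace T q (Uq.Ad T q) lam ≤ weightSpace S q (σ.adRestrict q) (σ.ρ lam) := by
  intro u hu ν
  rw [σ.adRestrict_K, hu, σ.pairing_ρ]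
  rfl

theorem ι_ne (j : J) (d : σ.D) : σ.ι j ≠ d := fun h => d.2 ⟨j, h⟩

theorem isHighestWeight (d : σ.D) :
    IsHighestWeight (σ.adRestrict q) (σ.weight d) (Uq.F T q d * Uq.H T q d) where
  E_apply j := by rw [adRestrict_E, Ad_E_F_mul_H (σ.ι_ne j d)]
  weight := σ.weightSpace_le q _ (F_mul_H_mem_weightSpace _)

theorem pairing_weight (j : J) (d : σ.D) :
    S.pairing (S.i₁ j) (σ.weight d) = -T.cartan (σ.ι j) d := by
  rw [weight, pairing_ρ, sY_i₁, map_neg, T.pairing_eq, RootDatum.cartan]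

theorem pairing_weight_nonneg (j : J) (d : σ.D) : 0 ≤ S.pairing (S.i₁ j) (σ.weight d) := by
  rw [pairing_weight, ← T.serreDeg_cast (σ.ι_ne j d)]
  have h := T.serreDeg_cast (σ.ι_ne j d)
  have h1 := T.form_nonpos _ _ (σ.ι_ne j d)
  have h2 := T.c_mul_cartan (σ.ι j) d
  have h3 := RootDatum.c_pos (T := T) (σ.ι j)
  rw [h]
  by_contra hc
  have : 0 < T.c (σ.ι j) * T.cartan (σ.ι j) d := mul_pos h3 (by omega)
  omega

/-- The exponent n_j + 1 attached to the weight λ'_d is the Serre degree 1 - C_{ι(j) d}. -/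
theorem pow_adRestrict_F_apply (j : J) (d : σ.D) :
    (σ.adRestrict q (Uq.F S q j) ^ ((S.pairing (S.i₁ j) (σ.weight d)).toNat + 1))
      (Uq.F T q d * Uq.H T q d) = 0 := by
  have h : (S.pairing (S.i₁ j) (σ.weight d)).toNat + 1 = T.serreDeg (σ.ι j) d := by
    have h1 := σ.pairing_weight_nonneg j d
    have h2 := T.serreDeg_cast (σ.ι_ne j d)
    rw [pairing_weight] at *
    omega
  rw [h, adRestrict_F, pow_serreDeg_Ad_F_apply (σ.ι_ne j d)]

theorem fWord_adRestrict_mem_weightSpace {lam : X} {v : Uq T q}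
    (hv : v ∈ weightSpace T q (Uq.Ad T q) lam) (w : List J) :
    ∃ μ, fWord (σ.adRestrict q) w v ∈ weightSpace T q (Uq.Ad T q) μ := by
  induction w with
  | nil => exact ⟨lam, hv⟩
  | cons j w ih =>
    obtain ⟨μ, hμ⟩ := ih
    rw [fWord_cons, adRestrict_F]
    exact ⟨_, F_mem_weightSpace hμ _⟩

theorem V_stable (d : σ.D) : ∀ u ∈ σ.tildeUq q, ∀ w ∈ σ.V q d, Uq.Ad T q u w ∈ σ.V q d := by
  rintro u hu _ ⟨u', hu', rfl⟩
  refine ⟨u * u', (σ.tildeUq q).mul_mem hu hu', ?_⟩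
  simp

theorem self_mem_V (d : σ.D) : Uq.F T q d * Uq.H T q d ∈ σ.V q d := by
  refine ⟨1, (σ.tildeUq q).one_mem, ?_⟩
  simp

/-- The additional K_μ give nothing new: every word applied to F_d H_d is a weight vector for all of
Z, so K_μ acts on it by a scalar. -/
theorem V_eq_wordSpan (d : σ.D) :
    σ.V q d = wordSpan (σ.adRestrict q) (Uq.F T q d * Uq.H T q d) := by
  apply le_antisymm
  · rintro _ ⟨u, hu, rfl⟩
    refine adjoin_apply_mem (φ := Uq.Ad T q) ?_ hu _ self_mem_wordSpan
    rintro _ ((⟨j, rfl⟩ | ⟨j, rfl⟩) | ⟨μ, rfl⟩)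
    · rw [← adRestrict_E]; exact E_mem_wordSpan (σ.isHighestWeight q d) j
    · rw [← adRestrict_F]; exact F_mem_wordSpan j
    · refine apply_mem_of_fWord fun w => ?_
      obtain ⟨lam, h⟩ := σ.fWord_adRestrict_mem_weightSpace q (F_mul_H_mem_weightSpace _) w
      rw [h μ]
      exact Submodule.smul_mem _ _ (fWord_mem_wordSpan w)
  · refine wordSpan_le.2 fun w => ?_
    induction w with
    | nil => exact σ.self_mem_V q d
    | cons j w ih =>
      rw [fWord_cons, adRestrict_F]
      exact σ.V_stable q d _ (Algebra.subset_adjoin (Or.inl (Or.inr ⟨j, rfl⟩))) _ ih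

theorem isIntegrable_V (d : σ.D) : σ.IsIntegrable q (σ.V q d) where
  stable := σ.V_stable q d
  weights := by
    refine le_antisymm ?_ (iSup_le fun _ => inf_le_right)
    rw [V_eq_wordSpan]
    refine wordSpan_le.2 fun w => ?_
    obtain ⟨lam, h⟩ := σ.fWord_adRestrict_mem_weightSpace q (F_mul_H_mem_weightSpace _) w
    exact Submodule.mem_iSup_of_mem lam ⟨h, fWord_mem_wordSpan w⟩
  restrict := by
    rw [V_eq_wordSpan]
    exact isIntegrableSubmodule_wordSpan (σ.isHighestWeight q d)
      fun j => ⟨_, σ.pow_adRestrict_F_apply q j d⟩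

end SubRootDatum

/-! ### The vector m obtained from a Weyl module. -/

section Weyl

variable {k : Type*} [Field k] {I Y X : Type*} [AddCommGroup Y] [AddCommGroup X]
  {T : RootDatum I Y X} {q : kˣ} {M : Type*} [AddCommGroup M] [Module k M]
  {φ : Uq T q →ₐ[k] Module.End k M} {lam : X} {v : M}

theorem mem_weightSpace_of_generators
    (h : ∀ i, φ (Uq.K T q (T.z i)) v = qz q (T.pairing (T.i₁ i) lam) • v) :
    v ∈ weightSpace T q φ lam := by
  rintro ⟨y, hy⟩
  induction hy using AddSubgroup.closure_induction with
  | mem y hy =>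
    obtain ⟨i, rfl⟩ := hy
    exact h i
  | zero =>
    have h0 : (⟨0, T.Z.zero_mem⟩ : T.Z) = 0 := rfl
    rw [h0, (Uq.satisfiesRelations T q).K_zero]
    simp [qz_zero]
  | add x y hx hy ihx ihy =>
    have h0 : (⟨x + y, T.Z.add_mem hx hy⟩ : T.Z) = ⟨x, hx⟩ + ⟨y, hy⟩ := rfl
    rw [h0, (Uq.satisfiesRelations T q).K_add, map_mul, Module.End.mul_apply, ihy, map_smul, ihx,
      smul_smul, ← qz_add, ← h0]
    simp [add_comm]
  | neg x hx ih =>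
    have h0 : (⟨-x, T.Z.neg_mem hx⟩ : T.Z) = -⟨x, hx⟩ := rfl
    have h1 := congrArg (φ (Uq.K T q (-⟨x, hx⟩))) ih
    rw [← Module.End.mul_apply, ← map_mul, ← (Uq.satisfiesRelations T q).K_add, neg_add_cancel,
      (Uq.satisfiesRelations T q).K_zero, map_one, Module.End.one_apply, map_smul] at h1
    rw [h0, Uq.smul_flip h1]
    simp

/-- The factor is used as a nonzero finite-dimensional module generated by the image of 1, a highest
weight vector. Maximality of N enters only through N being proper. -/
theorem exists_cartan_ge_of_weyl [Fintype I] (hq : ∀ n : ℕ, 0 < n → q ^ n ≠ 1)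
    (hn : ∀ i, 0 ≤ T.pairing (T.i₁ i) lam) (h : WeylModuleFiniteDimensional T q lam) :
    ∃ m : I → ℤ, (∀ i, 0 ≤ m i) ∧ ∀ i, T.pairing (T.i₁ i) lam ≤ ∑ j, T.cartan i j * m j := by
  obtain ⟨N, hN, hfin⟩ := h
  let π : Uq T q →ₗ[Uq T q] (Verma T q lam ⧸ N) := N.mkQ ∘ₗ (vermaIdeal T q lam).mkQ
  have hπ : Function.Surjective π :=
    N.mkQ_surjective.comp (vermaIdeal T q lam).mkQ_surjective
  have hπ0 : ∀ u ∈ vermaIdeal T q lam, π u = 0 := fun u hu => by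
    have : (vermaIdeal T q lam).mkQ u = 0 := by simpa using hu
    simp only [π, LinearMap.comp_apply, this, map_zero]
  have hact : ∀ u : Uq T q, Algebra.lsmul k k (Verma T q lam ⧸ N) u (π 1) = π u := fun u => by
    change u • π 1 = π u
    rw [← map_smul, smul_eq_mul, mul_one]
  have hv : IsHighestWeight (Algebra.lsmul k k (Verma T q lam ⧸ N)) lam (π 1) :=
    { E_apply := fun i => by
        rw [hact]
        exact hπ0 _ (Submodule.subset_span (Or.inl ⟨i, rfl⟩))
      weight := mem_weightSpace_of_generators fun i => by
        rw [hact, ← sub_eq_zero]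
        have h1 := hπ0 _ (Submodule.subset_span (Or.inr ⟨i, rfl⟩))
        rw [map_sub] at h1
        convert h1 using 2
        rw [← hact (algebraMap k _ _)]
        exact (algebraMap_smul _ _ _).symm }
  have : Nontrivial (Verma T q lam ⧸ N) := Submodule.Quotient.nontrivial_iff.2 hN.1
  refine exists_cartan_ge hq hv (eq_top_iff.2 fun x _ => ?_) hn
  obtain ⟨u, rfl⟩ := hπ x
  have hu := apply_mem_wordSpan hv u _ self_mem_wordSpan
  rwa [hact] at hu

end Weyl

namespace SubRootDatum

variable {J Y' X' I Y X : Type*} [AddCommGroup Y'] [AddCommGroup X']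
    [AddCommGroup Y] [AddCommGroup X] {S : RootDatum J Y' X'} {T : RootDatum I Y X}
    (σ : SubRootDatum S T) {k : Type*} [Field k] {q : kˣ}

/-- The Weyl module only supplies the vector m; m then bounds the contents occurring in V(λ'_d),
which has the same highest weight. -/
theorem finiteDimensional_V (hq : ∀ n : ℕ, 0 < n → q ^ n ≠ 1) (d : σ.D)
    (h : WeylModuleFiniteDimensional S q (σ.weight d)) : FiniteDimensional k (σ.V q d) := by
  have := S.finite
  have := Fintype.ofFinite J
  have hn := fun j => σ.pairing_weight_nonneg j d
  obtain ⟨m, hm0, hm⟩ := exists_cartan_ge_of_weyl hq hn h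
  rw [V_eq_wordSpan]
  exact finiteDimensional_wordSpan hq (σ.isHighestWeight q d) hn
    (fun j => σ.pow_adRestrict_F_apply q j d) hm0 hm

end SubRootDatum

theorem iSup_eq_iSup_inf {α κ L : Type*} [CompleteLattice α] {U : L → α} {W : κ → α}
    (h : ∀ d, W d = ⨆ l, U l ⊓ W d) : ⨆ d, W d = ⨆ l, U l ⊓ ⨆ d, W d := by
  refine le_antisymm (iSup_le fun d => ?_) (iSup_le fun _ => inf_le_right)
  rw [h d]
  exact iSup_mono fun l => inf_le_inf_left _ (le_iSup W d)

/-! ### The grading and the map x ↦ x₍₁₎ ⊗ π(x₍₂₎). -/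

section Degree

variable {k : Type*} [Field k] {I Y X : Type*} [AddCommGroup Y] [AddCommGroup X]
  {T : RootDatum I Y X} {q : kˣ} {γ : I → ℤ}

namespace Uq

theorem mem_degreePart {n : ℤ} {x : Uq T q} :
    x ∈ degreePart T q γ n ↔ coaction T q γ x = AddMonoidAlgebra.single n x := Iff.rfl

theorem F_mem_degreePart (i : I) : F T q i ∈ degreePart T q γ (-γ i) :=
  mem_degreePart.2 (lift_F _ i)

theorem K_mem_degreePart (μ : T.Z) : K T q μ ∈ degreePart T q γ 0 :=
  mem_degreePart.2 (lift_K _ μ)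

theorem one_mem_degreePart : (1 : Uq T q) ∈ degreePart T q γ 0 := by
  rw [← (satisfiesRelations T q).K_zero]
  exact K_mem_degreePart 0

theorem mul_mem_degreePart {m n : ℤ} {x y : Uq T q} (hx : x ∈ degreePart T q γ m)
    (hy : y ∈ degreePart T q γ n) : x * y ∈ degreePart T q γ (m + n) := by
  rw [mem_degreePart] at *
  rw [map_mul, hx, hy, AddMonoidAlgebra.single_mul_single]

theorem degreeProj_apply (n : ℤ) (x : Uq T q) :
    degreeProj T q γ n x = (coaction T q γ x).coeff n := rfl

theorem degreeProj_of_mem {m : ℤ} {x : Uq T q} (hx : x ∈ degreePart T q γ m) (n : ℤ) :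
    degreeProj T q γ n x = if m = n then x else 0 := by
  classical
  rw [degreeProj_apply, mem_degreePart.1 hx, AddMonoidAlgebra.coeff_single, Finsupp.single_apply]

theorem degreeProj_mul_left {m : ℤ} {a : Uq T q} (ha : a ∈ degreePart T q γ m) (n : ℤ)
    (x : Uq T q) : degreeProj T q γ n (a * x) = a * degreeProj T q γ (n - m) x := by
  rw [degreeProj_apply, degreeProj_apply, map_mul, mem_degreePart.1 ha]
  exact AddMonoidAlgebra.coeff_single_mul_eq_mul_coeff _ fun _ _ => by omega

theorem degreeProj_mul_right {m : ℤ} {a : Uq T q} (ha : a ∈ degreePart T q γ m) (n : ℤ)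
    (x : Uq T q) : degreeProj T q γ n (x * a) = degreeProj T q γ (n - m) x * a := by
  rw [degreeProj_apply, degreeProj_apply, map_mul, mem_degreePart.1 ha]
  exact AddMonoidAlgebra.coeff_mul_single_eq_coeff_mul _ fun _ _ => by omega

variable (T q γ) in
/-- The map `x ↦ x₍₁₎ ⊗ π(x₍₂₎)`. -/
noncomputable def comulProj : Uq T q →ₗ[k] Uq T q ⊗[k] Uq T q :=
  (degreeProj T q γ 0).lTensor (Uq T q) ∘ₗ (comul T q).toLinearMap

theorem comulProj_apply (x : Uq T q) :
    comulProj T q γ x = (degreeProj T q γ 0).lTensor (Uq T q) (comul T q x) := rfl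

/-- The projection π is linear over the degree-zero part on either side, so a tensor whose second
leg has degree zero can be pulled out. Consequently `comulProj` is linear over Δ(F_i) for γ i = 0.
-/
theorem lTensor_mul_left {a : Uq T q} (ha : a ∈ degreePart T q γ 0) (y : Uq T q)
    (t : Uq T q ⊗[k] Uq T q) : (degreeProj T q γ 0).lTensor (Uq T q) ((y ⊗ₜ a) * t) =
      (y ⊗ₜ a) * (degreeProj T q γ 0).lTensor (Uq T q) t := by
  induction t with
  | zero => simp
  | add s t hs ht => rw [mul_add, map_add, map_add, mul_add, hs, ht]
  | tmul b c => simp [degreeProj_mul_left ha]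

theorem lTensor_mul_right {a : Uq T q} (ha : a ∈ degreePart T q γ 0) (y : Uq T q)
    (t : Uq T q ⊗[k] Uq T q) : (degreeProj T q γ 0).lTensor (Uq T q) (t * (y ⊗ₜ a)) =
      (degreeProj T q γ 0).lTensor (Uq T q) t * (y ⊗ₜ a) := by
  induction t with
  | zero => simp
  | add s t hs ht => rw [add_mul, map_add, map_add, add_mul, hs, ht]
  | tmul b c => simp [degreeProj_mul_right ha]

theorem comulProj_F_mul {i : I} (hi : γ i = 0) (x : Uq T q) :
    comulProj T q γ (F T q i * x) = comul T q (F T q i) * comulProj T q γ x := by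
  have hF : F T q i ∈ degreePart T q γ 0 := by simpa [hi] using F_mem_degreePart (γ := γ) i
  have hH : Hinv T q i ∈ degreePart T q γ 0 := K_mem_degreePart _
  rw [comulProj_apply, map_mul, comul_F, add_mul, map_add, lTensor_mul_left hH,
    lTensor_mul_left hF, ← add_mul, comulProj_apply]

theorem comulProj_mul_F {i : I} (hi : γ i = 0) (x : Uq T q) :
    comulProj T q γ (x * F T q i) = comulProj T q γ x * comul T q (F T q i) := by
  have hF : F T q i ∈ degreePart T q γ 0 := by simpa [hi] using F_mem_degreePart (γ := γ) i
  have hH : Hinv T q i ∈ degreePart T q γ 0 := K_mem_degreePart _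
  rw [comulProj_apply, map_mul, comul_F, mul_add, map_add, lTensor_mul_right hH,
    lTensor_mul_right hF, ← mul_add, comulProj_apply]

theorem comulProj_mul_K (μ : T.Z) (x : Uq T q) :
    comulProj T q γ (x * K T q μ) = comulProj T q γ x * comul T q (K T q μ) := by
  rw [comulProj_apply, map_mul, comul_K, lTensor_mul_right (K_mem_degreePart _), comulProj_apply]

variable (T q) in
/-- The map `x ⊗ y ↦ x S(y)`. -/
noncomputable def mulAntipode : Uq T q ⊗[k] Uq T q →ₗ[k] Uq T q :=
  (Algebra.TensorProduct.lift (Algebra.lmul k (Uq T q)) (mulRightAntipode T q)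
    (commute_mulRightAntipode T q)).toLinearMap.flip 1

theorem mulAntipode_tmul_one_mul (w : Uq T q) (t : Uq T q ⊗[k] Uq T q) :
    mulAntipode T q ((w ⊗ₜ 1) * t) = w * mulAntipode T q t := by
  simp only [mulAntipode, LinearMap.flip_apply, AlgHom.toLinearMap_apply, map_mul,
    Module.End.mul_apply, Ad_aux, map_one, MulOpposite.unop_one, mul_one]

theorem mulAntipode_tmul_one (w : Uq T q) : mulAntipode T q (w ⊗ₜ 1) = w := by
  simp [mulAntipode]

/-- Reading a₍₁₎ S(a₍₂₎) as the adjoint action on 1 makes it unnecessary to introduce a counit. -/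
theorem mulAntipode_comul (a : Uq T q) : mulAntipode T q (comul T q a) = Ad T q a 1 := rfl

end Uq

end Degree

/-! ### B_1 is the sum of the modules V(λ'_d). -/

namespace SubRootDatum

variable {J Y' X' I Y X : Type*} [AddCommGroup Y'] [AddCommGroup X']
    [AddCommGroup Y] [AddCommGroup X] {S : RootDatum J Y' X'} {T : RootDatum I Y X}
    (σ : SubRootDatum S T) {k : Type*} [Field k] (q : kˣ)

theorem negChi_ι (j : J) : σ.negChi (σ.ι j) = 0 := by simp [negChi]

theorem negChi_D (d : σ.D) : σ.negChi d = -1 := if_neg d.2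

theorem F_ι_mem_degreePart (j : J) : Uq.F T q (σ.ι j) ∈ Uq.degreePart T q σ.negChi 0 := by
  simpa [negChi_ι] using Uq.F_mem_degreePart (T := T) (q := q) (γ := σ.negChi) (σ.ι j)

theorem F_D_mem_degreePart (d : σ.D) : Uq.F T q d ∈ Uq.degreePart T q σ.negChi 1 := by
  simpa [negChi_D] using Uq.F_mem_degreePart (T := T) (q := q) (γ := σ.negChi) d

variable {q} in
theorem mem_B {b : Uq T q} :
    b ∈ σ.B q ↔ b ∈ negBorel T q ∧ Uq.comulProj T q σ.negChi b = b ⊗ₜ 1 := Iff.rfl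

theorem F_mem_negBorel (i : I) : Uq.F T q i ∈ negBorel T q :=
  Algebra.subset_adjoin (Or.inl ⟨i, rfl⟩)

theorem K_mem_negBorel (μ : T.Z) : Uq.K T q μ ∈ negBorel T q :=
  Algebra.subset_adjoin (Or.inr ⟨μ, rfl⟩)

/-- Δ(F_d H_d) = F_d H_d ⊗ 1 + H_d ⊗ F_d H_d, and π kills the second leg of the last term, which has
degree one. -/
theorem F_mul_H_mem_B₁ (d : σ.D) : Uq.F T q d * Uq.H T q d ∈ σ.B₁ q := by
  have hdeg : Uq.F T q d * Uq.H T q d ∈ Uq.degreePart T q σ.negChi 1 := by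
    have h := Uq.mul_mem_degreePart (σ.F_D_mem_degreePart q d)
      (Uq.K_mem_degreePart (T.c d • T.z d))
    rwa [add_zero] at h
  refine ⟨σ.mem_B.2 ⟨mul_mem (F_mem_negBorel q _) (K_mem_negBorel q _), ?_⟩, hdeg⟩
  have h : Uq.comul T q (Uq.F T q d * Uq.H T q d) =
      (Uq.F T q d * Uq.H T q d) ⊗ₜ 1 + Uq.H T q d ⊗ₜ (Uq.F T q d * Uq.H T q d) := by
    have hH : Uq.comul T q (Uq.H T q d) = Uq.H T q d ⊗ₜ Uq.H T q d := Uq.comul_K T q _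
    rw [map_mul, Uq.comul_F, hH, add_mul, Algebra.TensorProduct.tmul_mul_tmul,
      Algebra.TensorProduct.tmul_mul_tmul, one_mul, Uq.Hinv_mul_H]
  rw [Uq.comulProj_apply, h, map_add, LinearMap.lTensor_tmul, LinearMap.lTensor_tmul,
    Uq.degreeProj_of_mem hdeg, Uq.degreeProj_of_mem Uq.one_mem_degreePart]
  simp

/-- By two-sided linearity of `comulProj`, the commutator of F_j with b goes to the commutator of
Δ(F_j) with b ⊗ 1. The terms from 1 ⊗ F_j cancel, and Δ(H_j) turns the remaining second leg H_j⁻¹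
into 1. -/
theorem Ad_F_mem_B₁ (j : J) {b : Uq T q} (hb : b ∈ σ.B₁ q) :
    Uq.Ad T q (Uq.F T q (σ.ι j)) b ∈ σ.B₁ q := by
  obtain ⟨⟨hb1, hb2⟩, hb3⟩ := hb
  change Uq.comulProj T q σ.negChi b = b ⊗ₜ 1 at hb2
  have hF := F_mem_negBorel (T := T) q (σ.ι j)
  have hF0 := σ.F_ι_mem_degreePart q j
  rw [Uq.Ad_F]
  refine ⟨σ.mem_B.2 ⟨mul_mem (sub_mem (mul_mem hF hb1) (mul_mem hb1 hF)) (K_mem_negBorel q _), ?_⟩,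
    ?_⟩
  · have hH : Uq.comul T q (Uq.H T q (σ.ι j)) = Uq.H T q (σ.ι j) ⊗ₜ Uq.H T q (σ.ι j) :=
      Uq.comul_K T q _
    have h1 : Uq.comulProj T q σ.negChi
        ((Uq.F T q (σ.ι j) * b - b * Uq.F T q (σ.ι j)) * Uq.H T q (σ.ι j)) =
        Uq.comulProj T q σ.negChi (Uq.F T q (σ.ι j) * b - b * Uq.F T q (σ.ι j)) *
          Uq.comul T q (Uq.H T q (σ.ι j)) := Uq.comulProj_mul_K _ _
    rw [h1, map_sub, Uq.comulProj_F_mul (σ.negChi_ι j), Uq.comulProj_mul_F (σ.negChi_ι j), hb2, hH,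
      Uq.comul_F]
    simp only [add_mul, mul_add, Algebra.TensorProduct.tmul_mul_tmul, one_mul, mul_one,
      add_sub_add_right_eq_sub, sub_mul, Uq.Hinv_mul_H, TensorProduct.sub_tmul]
  · have h1 : Uq.F T q (σ.ι j) * b ∈ Uq.degreePart T q σ.negChi 1 := by
      simpa using Uq.mul_mem_degreePart hF0 hb3
    have h2 : b * Uq.F T q (σ.ι j) ∈ Uq.degreePart T q σ.negChi 1 := by
      simpa using Uq.mul_mem_degreePart hb3 hF0
    have h3 := Uq.mul_mem_degreePart (sub_mem h1 h2)
      (Uq.K_mem_degreePart (T.c (σ.ι j) • T.z (σ.ι j)))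
    rwa [add_zero] at h3

theorem V_le_B₁ (d : σ.D) : σ.V q d ≤ σ.B₁ q := by
  rw [V_eq_wordSpan]
  refine wordSpan_le.2 fun w => ?_
  induction w with
  | nil => exact σ.F_mul_H_mem_B₁ q d
  | cons j w ih =>
    rw [fWord_cons, adRestrict_F]
    exact σ.Ad_F_mem_B₁ q j ih

/-- The subalgebra generated by the `F_j`, `j ∈ ι(J)`, and all `K_μ`. -/
def leviNegBorel : Subalgebra k (Uq T q) :=
  Algebra.adjoin k (Set.range (fun j => Uq.F T q (σ.ι j)) ∪ Set.range (Uq.K T q))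

theorem F_mem_leviNegBorel (j : J) : Uq.F T q (σ.ι j) ∈ σ.leviNegBorel q :=
  Algebra.subset_adjoin (Or.inl ⟨j, rfl⟩)

theorem K_mem_leviNegBorel (μ : T.Z) : Uq.K T q μ ∈ σ.leviNegBorel q :=
  Algebra.subset_adjoin (Or.inr ⟨μ, rfl⟩)

variable {q}

theorem comulProj_mul_leviNegBorel {a : Uq T q} (ha : a ∈ σ.leviNegBorel q) (x : Uq T q) :
    Uq.comulProj T q σ.negChi (x * a) = Uq.comulProj T q σ.negChi x * Uq.comul T q a := by
  induction ha using Algebra.adjoin_induction generalizing x with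
  | mem a ha =>
    obtain ⟨j, rfl⟩ | ⟨μ, rfl⟩ := ha
    · exact Uq.comulProj_mul_F (σ.negChi_ι j) x
    · exact Uq.comulProj_mul_K μ x
  | algebraMap r =>
    rw [AlgHom.commutes, ← Algebra.commutes, ← Algebra.commutes, ← Algebra.smul_def,
      ← Algebra.smul_def, map_smul]
  | add a b _ _ ha hb => rw [mul_add, map_add, map_add, mul_add, ha, hb]
  | mul a b _ _ ha hb => rw [← mul_assoc, hb, ha, map_mul, mul_assoc]

/-- The antipode axiom up to an unnamed scalar: Ad F_j kills 1 and Ad K_μ fixes it, so the line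
through 1 is stable. -/
theorem Ad_one_mem {a : Uq T q} (ha : a ∈ σ.leviNegBorel q) :
    Uq.Ad T q a 1 ∈ Submodule.span k {(1 : Uq T q)} := by
  refine adjoin_apply_mem (φ := Uq.Ad T q) ?_ ha _ (Submodule.mem_span_singleton_self 1)
  intro x hx w hw
  obtain ⟨r, rfl⟩ := Submodule.mem_span_singleton.1 hw
  rw [map_smul]
  refine Submodule.smul_mem _ _ ?_
  obtain ⟨j, rfl⟩ | ⟨μ, rfl⟩ := hx
  · rw [Uq.Ad_F]; simp
  · rw [Uq.Ad_K, mul_one, ← (Uq.satisfiesRelations T q).K_add, add_neg_cancel,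
      (Uq.satisfiesRelations T q).K_zero]
    exact Submodule.mem_span_singleton_self 1

variable (q) in
/-- The product of the sum of the `V(λ'_d)` with `leviNegBorel`. -/
noncomputable def sumVMul : Submodule k (Uq T q) :=
  (⨆ d, σ.V q d) * Subalgebra.toSubmodule (σ.leviNegBorel q)

theorem iSup_V_stable {u : Uq T q} (hu : u ∈ σ.tildeUq q) {w : Uq T q} (hw : w ∈ ⨆ d, σ.V q d) :
    Uq.Ad T q u w ∈ ⨆ d, σ.V q d := by
  have h : ⨆ d, σ.V q d ≤ (⨆ d, σ.V q d).comap (Uq.Ad T q u) :=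
    iSup_le fun d w hw => Submodule.mem_iSup_of_mem d (σ.V_stable q d u hu w hw)
  exact h hw

/-- An instance of u w = Ad_{u₍₁₎}(w) u₍₂₎: left multiplication by F_j becomes the adjoint action on
w, which stays in ∑ V(λ'_d), plus factors moved to the right of w. -/
theorem F_ι_mul_mem_sumVMul (j : J) {x : Uq T q} (hx : x ∈ σ.sumVMul q) :
    Uq.F T q (σ.ι j) * x ∈ σ.sumVMul q := by
  have hu : Uq.F T q (σ.ι j) ∈ σ.tildeUq q := Algebra.subset_adjoin (Or.inl (Or.inr ⟨j, rfl⟩))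
  induction hx using Submodule.mul_induction_on' with
  | mem_mul_mem w hw a ha =>
    have h : Uq.F T q (σ.ι j) * (w * a) =
        Uq.Ad T q (Uq.F T q (σ.ι j)) w * (Uq.Hinv T q (σ.ι j) * a) +
          w * (Uq.F T q (σ.ι j) * a) := by
      rw [Uq.Ad_F, mul_assoc _ (Uq.H T q (σ.ι j)), ← mul_assoc (Uq.H T q (σ.ι j)), Uq.H_mul_Hinv]
      noncomm_ring
    rw [h]
    exact add_mem
      (Submodule.mul_mem_mul (σ.iSup_V_stable hu hw)
        ((σ.leviNegBorel q).mul_mem (σ.K_mem_leviNegBorel q _) ha))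
      (Submodule.mul_mem_mul hw ((σ.leviNegBorel q).mul_mem (σ.F_mem_leviNegBorel q j) ha))
  | add x _ y _ hx hy => rw [mul_add]; exact add_mem hx hy

theorem K_mul_mem_sumVMul (μ : T.Z) {x : Uq T q} (hx : x ∈ σ.sumVMul q) :
    Uq.K T q μ * x ∈ σ.sumVMul q := by
  have hu : Uq.K T q μ ∈ σ.tildeUq q := Algebra.subset_adjoin (Or.inr ⟨μ, rfl⟩)
  induction hx using Submodule.mul_induction_on' with
  | mem_mul_mem w hw a ha =>
    have hK : Uq.K T q (-μ) * Uq.K T q μ = 1 := by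
      rw [← (Uq.satisfiesRelations T q).K_add, neg_add_cancel, (Uq.satisfiesRelations T q).K_zero]
    have h : Uq.K T q μ * (w * a) = Uq.Ad T q (Uq.K T q μ) w * (Uq.K T q μ * a) := by
      rw [Uq.Ad_K, mul_assoc _ (Uq.K T q (-μ)), ← mul_assoc (Uq.K T q (-μ)), hK, one_mul, mul_assoc]
    rw [h]
    exact Submodule.mul_mem_mul (σ.iSup_V_stable hu hw)
      ((σ.leviNegBorel q).mul_mem (σ.K_mem_leviNegBorel q _) ha)
  | add x _ y _ hx hy => rw [mul_add]; exact add_mem hx hy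

theorem F_D_mul_mem_sumVMul (d : σ.D) {a : Uq T q} (ha : a ∈ σ.leviNegBorel q) :
    Uq.F T q d * a ∈ σ.sumVMul q := by
  have h : Uq.F T q d * a = Uq.F T q d * Uq.H T q d * (Uq.Hinv T q d * a) := by
    rw [mul_assoc, ← mul_assoc (Uq.H T q d), Uq.H_mul_Hinv, one_mul]
  rw [h]
  exact Submodule.mul_mem_mul (Submodule.mem_iSup_of_mem d (σ.self_mem_V q d))
    ((σ.leviNegBorel q).mul_mem (σ.K_mem_leviNegBorel q _) ha)

/-- The components of degree at most one of an element of the negative Borel subalgebra. -/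
theorem degreeProj_negBorel {x : Uq T q} (hx : x ∈ negBorel T q) :
    (∀ n < 0, Uq.degreeProj T q σ.negChi n x = 0) ∧
      Uq.degreeProj T q σ.negChi 0 x ∈ σ.leviNegBorel q ∧
      Uq.degreeProj T q σ.negChi 1 x ∈ σ.sumVMul q := by
  -- The three conditions must be proved together: for i ∈ D, the degree-one component of F_i w is
  -- F_i times the degree-zero component of w, and its degree-zero component vanishes because w has
  -- none in degree -1.
  let P : Submodule k (Uq T q) :=
    { carrier := {x | (∀ n < 0, Uq.degreeProj T q σ.negChi n x = 0) ∧
        Uq.degreeProj T q σ.negChi 0 x ∈ σ.leviNegBorel q ∧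
        Uq.degreeProj T q σ.negChi 1 x ∈ σ.sumVMul q}
      zero_mem' := by simp [zero_mem]
      add_mem' := by
        rintro x y ⟨hx1, hx2, hx3⟩ ⟨hy1, hy2, hy3⟩
        refine ⟨fun n hn => ?_, ?_, ?_⟩
        · rw [map_add, hx1 n hn, hy1 n hn, add_zero]
        · rw [map_add]; exact add_mem hx2 hy2
        · rw [map_add]; exact add_mem hx3 hy3
      smul_mem' := by
        rintro r x ⟨hx1, hx2, hx3⟩
        refine ⟨fun n hn => ?_, ?_, ?_⟩
        · rw [map_smul, hx1 n hn, smul_zero]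
        · rw [map_smul]; exact (σ.leviNegBorel q).smul_mem hx2 r
        · rw [map_smul]; exact Submodule.smul_mem _ r hx3 }
  refine mem_of_mul_left_mem (W := P) ⟨fun n hn => ?_, ?_, ?_⟩ ?_ hx
  · rw [Uq.degreeProj_of_mem Uq.one_mem_degreePart, if_neg hn.ne']
  · rw [Uq.degreeProj_of_mem Uq.one_mem_degreePart, if_pos rfl]
    exact one_mem _
  · rw [Uq.degreeProj_of_mem Uq.one_mem_degreePart, if_neg (by norm_num)]
    exact zero_mem _
  · rintro _ (⟨i, rfl⟩ | ⟨μ, rfl⟩) w ⟨hw1, hw2, hw3⟩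
    · by_cases hi : i ∈ Set.range σ.ι
      · obtain ⟨j, rfl⟩ := hi
        have h := fun n => Uq.degreeProj_mul_left (σ.F_ι_mem_degreePart q j) n w
        simp only [sub_zero] at h
        refine ⟨fun n hn => ?_, ?_, ?_⟩
        · rw [h, hw1 n hn, mul_zero]
        · rw [h]; exact mul_mem (σ.F_mem_leviNegBorel q j) hw2
        · rw [h]; exact σ.F_ι_mul_mem_sumVMul j hw3
      · have h := fun n => Uq.degreeProj_mul_left (σ.F_D_mem_degreePart q ⟨i, hi⟩) n w
        refine ⟨fun n hn => ?_, ?_, ?_⟩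
        · rw [h, hw1 _ (by omega), mul_zero]
        · rw [h, hw1 _ (by omega), mul_zero]; exact zero_mem _
        · rw [h, sub_self]; exact σ.F_D_mul_mem_sumVMul ⟨i, hi⟩ hw2
    · have h := fun n => Uq.degreeProj_mul_left (Uq.K_mem_degreePart (γ := σ.negChi) μ) n w
      simp only [sub_zero] at h
      refine ⟨fun n hn => ?_, ?_, ?_⟩
      · rw [h, hw1 n hn, mul_zero]
      · rw [h]; exact mul_mem (σ.K_mem_leviNegBorel q μ) hw2
      · rw [h]; exact σ.K_mul_mem_sumVMul μ hw3

/-- A degree-one b lies in (∑ V)·`leviNegBorel`. The composite of `comulProj` with x ⊗ y ↦ x S(y)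
sends w a to w a₍₁₎ S(a₍₂₎), a multiple of w, because w is itself coinvariant. It returns b when b ∈
B, since b ⊗ 1 ↦ b. -/
theorem B₁_eq_iSup : σ.B₁ q = ⨆ d, σ.V q d := by
  refine le_antisymm ?_ (iSup_le fun d => σ.V_le_B₁ q d)
  rintro b ⟨⟨hb1, hb2⟩, hb3⟩
  change Uq.comulProj T q σ.negChi b = b ⊗ₜ 1 at hb2
  have h1 := (σ.degreeProj_negBorel hb1).2.2
  rw [Uq.degreeProj_of_mem hb3, if_pos rfl] at h1
  have h2 : ∀ x ∈ σ.sumVMul q,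
      Uq.mulAntipode T q (Uq.comulProj T q σ.negChi x) ∈ ⨆ d, σ.V q d := by
    intro x hx
    induction hx using Submodule.mul_induction_on' with
    | mem_mul_mem w hw a ha =>
      have hwB : w ∈ σ.B₁ q := (iSup_le fun d => σ.V_le_B₁ q d : ⨆ d, σ.V q d ≤ σ.B₁ q) hw
      rw [σ.comulProj_mul_leviNegBorel ha, (σ.mem_B.1 hwB.1).2, Uq.mulAntipode_tmul_one_mul,
        Uq.mulAntipode_comul]
      obtain ⟨r, hr⟩ := Submodule.mem_span_singleton.1 (σ.Ad_one_mem ha)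
      rw [← hr, mul_smul_comm, mul_one]
      exact Submodule.smul_mem _ _ hw
    | add x _ y _ hx hy => rw [map_add, map_add]; exact add_mem hx hy
  have h3 := h2 b h1
  rwa [hb2, Uq.mulAntipode_tmul_one] at h3

theorem isIntegrable_iSup {κ : Type*} {W : κ → Submodule k (Uq T q)}
    (h : ∀ d, σ.IsIntegrable q (W d)) : σ.IsIntegrable q (⨆ d, W d) := by
  have hst : ∀ f : Module.End k (Uq T q), (∀ d, ∀ w ∈ W d, f w ∈ W d) →
      ∀ w ∈ ⨆ d, W d, f w ∈ ⨆ d, W d := fun f hf w hw =>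
    (iSup_le fun d w hw => Submodule.mem_iSup_of_mem d (hf d w hw) :
      ⨆ d, W d ≤ (⨆ d, W d).comap f) hw
  have hnil : ∀ u : Uq S q,
      (∀ d, ∀ w ∈ W d, ∃ n₀ : ℕ, ∀ n ≥ n₀, σ.adRestrict q (u ^ n) w = 0) →
      ∀ w ∈ ⨆ d, W d, ∃ n₀ : ℕ, ∀ n ≥ n₀, σ.adRestrict q (u ^ n) w = 0 := by
    intro u hu w hw
    have hle : ⨆ d, W d ≤ nilVectors (σ.adRestrict q u) := iSup_le fun d w hw => by
      obtain ⟨n, hn⟩ := hu d w hw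
      exact ⟨n, by rw [← map_pow]; exact hn n le_rfl⟩
    obtain ⟨n, hn⟩ := hle hw
    exact ⟨n, fun m hm => by rw [map_pow]; exact pow_apply_eq_zero_of_le hm hn⟩
  exact
    { stable := fun u hu => hst _ fun d => (h d).stable u hu
      weights := iSup_eq_iSup_inf fun d => (h d).weights
      restrict :=
        { stable := fun u => hst _ fun d => (h d).restrict.stable u
          weights := iSup_eq_iSup_inf fun d => (h d).restrict.weights
          E_nilpotent := fun j => hnil _ fun d => (h d).restrict.E_nilpotent j
          F_nilpotent := fun j => hnil _ fun d => (h d).restrict.F_nilpotent j } }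

end SubRootDatum

end QEA

theorem proposition4p3 {k : Type*} [Field k] {I Y X J Y' X' : Type*}
    [AddCommGroup Y] [AddCommGroup X] [AddCommGroup Y'] [AddCommGroup X']
    (T : QEA.RootDatum I Y X) (S : QEA.RootDatum J Y' X') (σ : QEA.SubRootDatum S T)
    (q : kˣ) (hq : ∀ n : ℕ, 0 < n → q ^ n ≠ 1) :
    (∀ d : σ.D, σ.V q d ≤ σ.B₁ q ∧ σ.IsIntegrable q (σ.V q d)) ∧
    σ.IsIntegrable q (σ.B₁ q) ∧
    ((∀ d : σ.D, QEA.WeylModuleFiniteDimensional S q (σ.weight d)) →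
      (∀ d : σ.D, FiniteDimensional k (σ.V q d)) ∧ FiniteDimensional k (σ.B₁ q)) := by
  refine ⟨fun d => ⟨σ.V_le_B₁ q d, σ.isIntegrable_V q d⟩, ?_, fun h => ?_⟩
  · rw [σ.B₁_eq_iSup]
    exact σ.isIntegrable_iSup fun d => σ.isIntegrable_V q d
  · have hV := fun d => σ.finiteDimensional_V hq d (h d)
    have := T.finite
    refine ⟨hV, ?_⟩
    rw [σ.B₁_eq_iSup]
    -- D is finite because I is, so this is a finite sum of finite-dimensional subspaces.
    infer_instance
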